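/- For a real number $y>16$ put $$\mathcal L(y):=\exp\sqrt{\frac{\log y\,\log_3 y}{\log_2 y}},$$ where $\log_k$ denotes the $k$-fold iterated logarithm. For an integer $q\ge 3$ and real $x$ put $$\Delta(x,q):=\max_{\substack{\chi \bmod q\\ \chi\ne\chi_0}}\Big|\sum_{1\le n\le x}\chi(n)\Big|,$$ the maximum being over all non-principal Dirichlet characters modulo $q$, and let $\omega(q)$ be the number of distinct prime factors of $q$. Let $\varepsilon>0$. There exist a constant $c>0$, a function $\delta:\mathbb N\to\mathbb R$ with $\delta(q)\to0$ as $q\to\infty$, and an integer $q_0$, all depending only on $\varepsilon$, such that for every integer $q\ge q_0$ (with no other restriction on $q$) and every real $x$ satisfying $$\exp\big((\log q)^{1/2+\varepsilon}\big)\le x\le \frac{q}{e^{(1+\varepsilon)\omega(q)}}\qquad\text{and}\qquad \frac qx>16,$$ one has $$\Delta(x,q)\ \ge\ c\,\sqrt{x}\;\mathcal L(q/x)^{\sqrt2+\delta(q)} .$$ In other words, $\Delta(x,q)\gg\sqrt x\,\mathcal L(q/x)^{\sqrt2+o(1)}$ as $q\to\infty$, uniformly in $x$ in this range. -/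

import Mathlib

open Filter Topology

namespace LargeCharSums

/-- The function `𝓛(y) = exp √(log y · log₃ y / log₂ y)`, where `log_k` is the `k`-fold iterated
logarithm. It is used only for `y > 16`, where `log₂ y > 0` and `log₃ y > 0`. -/
noncomputable def scriptL (y : ℝ) : ℝ :=
  Real.exp (Real.sqrt
    (Real.log y * Real.log (Real.log (Real.log y)) / Real.log (Real.log y)))

/-- The character sum `S(x, χ) = ∑_{1 ≤ n ≤ x} χ(n)`. -/
noncomputable def charSum {q : ℕ} (x : ℝ) (χ : DirichletCharacter ℂ q) : ℂ :=
  ∑ n ∈ Finset.Icc 1 ⌊x⌋₊, χ (n : ZMod q)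

/-- `Δ(x, q)`, the maximum of `|S(x, χ)|` over the non-principal Dirichlet characters modulo `q`.
For `q ≥ 3` the index set is finite and non-empty, so that the supremum is a maximum. -/
noncomputable def Delta (x : ℝ) (q : ℕ) : ℝ :=
  ⨆ χ : {χ : DirichletCharacter ℂ q // χ ≠ 1}, ‖charSum x χ.1‖

end LargeCharSums

/-!
Throughout, `y = q / x`, `u = log y` and `l = log u`. The proof treats large `y` and bounded `y`
separately; in both cases it uses only orthogonality of the characters modulo `q`.

**Large `y`.** A resonator is a function `r` on `(ℤ/q)ˣ` with transform `R(χ)`. Comparing the second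
moment of `S(x, χ) R(χ)` with that of `R(χ)` gives

  `∑ r r' #{(a, b) : a g = b g', a, b ≤ x} ≤ (Δ(x, q)² + principal character) * ∑ r²`.

The resonator is built from the integers `∏ p ^ e p` with `e p ∈ {0, 1, 2}`, that is, up to a common
factor, from quotients of coprime squarefree integers, with `p` in the window
`l + a < log p ≤ l + b`, where `a = l ^ τ`, `b = l ^ (1 - τ)` and `p ∤ q`. These integers are far
larger than `q`; those in a common residue class are merged into the square root of the sum of the
squares of their weights, which loses nothing in the count of the solutions of `a m = b n` in
integers and makes the principal character cost only the number of integers used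
(`resonance_inequality`). That number is kept below `y ^ (1 - 4 τ)` by a cap on the cost
`∑ (log p - l)` over the primes with `e p ≠ 1`, and the weight of a prime is a multiple of
`1 / (√p (log p - l))`, the optimal choice under this cap (`weighted_resonator_bound`). Chernoff's
bound shows that the cap, and the conditions under which the equation `a m = b n` has many
solutions `a, b ≤ x`, fail for at most half of the total weight of the pairs
(`half_le_sum_goodPairs`). The gain is `exp D` with `D ^ 2` about `8 u V`, where `V`, the sum of
`1 / (p (log p - l))`, is about `log l / l` by Mertens' theorem
(`log_div_le_sum_logPrimes_not_dvd`). Hence `Δ(x, q)²` is at least `x 𝓛(y) ^ (2 √2 - o(1))` as `y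
→ ∞` (`Delta_lower_bound_of_ge`). The lower bound for `x` in terms of `log q` makes `√x` exceed
the coprime parts of the pairs of integers that occur.

**Bounded `y`.** Then `𝓛(y)` is bounded, but the constant must not depend on the bound `Y` for `y`.
Here `Δ(x, q)` is tested against the odd function `sin (2 π g / q)`, whose transform vanishes at the
principal character, averaged over the divisors of `D ^ (2 D + 1)`, where `D` is the product of the
integers up to `Y` prime to `q`. This set of divisors is almost invariant under multiplication by
`k ∣ D`, so that the sums of `sin (2 π n k / q)` over `n ≤ x`, for all these `k`, contribute at once
(`Delta_mul_sqrt_ge`), while the remaining pairs of divisors contribute a bounded amount as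
`q → ∞`. This gives a power of `y` more than is needed (`Delta_lower_bound_of_le`).

For a fixed loss `η` in the exponent the two bounds cover all `y > 16`, with a constant independent
of `η`; a diagonal argument (`exists_tendsto_zero_of_forall_eventually`) lets `η` tend to `0`.
-/

namespace LargeCharSums

/-! ### Character sums and Fourier analysis on the unit group -/

open scoped ComplexConjugate

/-- The residue class of `n` as an element of `(ℤ/q)ˣ`; the value is the junk value `1` if `n` is
not prime to `q`. -/
noncomputable def toUnit (q n : ℕ) : (ZMod q)ˣ :=
  if h : n.Coprime q then ZMod.unitOfCoprime n h else 1

lemma coe_toUnit {q n : ℕ} (h : n.Coprime q) : ((toUnit q n : (ZMod q)ˣ) : ZMod q) = n := by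
  rw [toUnit, dif_pos h, ZMod.coe_unitOfCoprime]

lemma toUnit_mul {q m n : ℕ} (hm : m.Coprime q) (hn : n.Coprime q) :
    toUnit q (m * n) = toUnit q m * toUnit q n := by
  ext
  rw [Units.val_mul, coe_toUnit hm, coe_toUnit hn, coe_toUnit (hm.mul_left hn)]
  push_cast
  rfl

/-- The positive integers `n ≤ x` that are prime to `q`. -/
noncomputable def coprimeUpTo (q : ℕ) (x : ℝ) : Finset ℕ :=
  (Finset.Icc 1 ⌊x⌋₊).filter fun n => n.Coprime q

lemma mem_coprimeUpTo {q n : ℕ} {x : ℝ} :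
    n ∈ coprimeUpTo q x ↔ (1 ≤ n ∧ (n : ℝ) ≤ x) ∧ n.Coprime q := by
  unfold coprimeUpTo
  rw [Finset.mem_filter, Finset.mem_Icc]
  constructor
  · rintro ⟨⟨h1, h2⟩, h3⟩
    exact ⟨⟨h1, (Nat.le_floor_iff' (by omega)).1 h2⟩, h3⟩
  · rintro ⟨⟨h1, h2⟩, h3⟩
    exact ⟨⟨h1, (Nat.le_floor_iff' (by omega)).2 h2⟩, h3⟩

lemma charSum_eq {q : ℕ} (x : ℝ) (χ : DirichletCharacter ℂ q) :
    charSum x χ = ∑ n ∈ coprimeUpTo q x, χ (toUnit q n : ZMod q) := by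
  unfold charSum coprimeUpTo
  rw [Finset.sum_filter]
  refine Finset.sum_congr rfl fun n _ => ?_
  split_ifs with h
  · rw [coe_toUnit h]
  · exact χ.map_nonunit fun h' => h ((ZMod.isUnit_iff_coprime n q).1 h')

lemma norm_charSum_le_Delta {q : ℕ} (x : ℝ) {χ : DirichletCharacter ℂ q} (h : χ ≠ 1) :
    ‖charSum x χ‖ ≤ Delta x q :=
  le_ciSup (f := fun χ : {χ : DirichletCharacter ℂ q // χ ≠ 1} => ‖charSum x χ.1‖)
    (Set.finite_range _).bddAbove ⟨χ, h⟩

lemma Delta_nonneg {q : ℕ} (x : ℝ) : 0 ≤ Delta x q := Real.iSup_nonneg fun _ => norm_nonneg _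

lemma conj_char_unit {q : ℕ} (χ : DirichletCharacter ℂ q) (g : (ZMod q)ˣ) :
    conj (χ (g : ZMod q)) = χ ((g : ZMod q)⁻¹) := by
  have h1 : conj (χ (g : ZMod q)) = χ⁻¹ (g : ZMod q) := MulChar.star_apply' χ _
  rw [h1, MulChar.inv_apply, Ring.inverse_unit, ZMod.inv_coe_unit]

section Fourier

variable {q : ℕ} [NeZero q]

/-- The Fourier transform on the group `(ℤ/q)ˣ`. -/
noncomputable def unitTransform (u : (ZMod q)ˣ → ℂ) (χ : DirichletCharacter ℂ q) : ℂ :=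
  ∑ g : (ZMod q)ˣ, u g * χ (g : ZMod q)

lemma parseval (u v : (ZMod q)ˣ → ℂ) :
    ∑ χ : DirichletCharacter ℂ q, unitTransform u χ * conj (unitTransform v χ) =
      q.totient * ∑ g, u g * conj (v g) := by
  have h : ∀ χ : DirichletCharacter ℂ q, unitTransform u χ * conj (unitTransform v χ) =
      ∑ g : (ZMod q)ˣ, ∑ h : (ZMod q)ˣ,
        u g * conj (v h) * (χ ((h : ZMod q)⁻¹) * χ (g : ZMod q)) := by
    intro χ
    unfold unitTransform
    rw [map_sum, Finset.sum_mul_sum]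
    refine Finset.sum_congr rfl fun g _ => Finset.sum_congr rfl fun h _ => ?_
    rw [map_mul, conj_char_unit]
    ring
  simp_rw [h]
  rw [Finset.sum_comm, Finset.mul_sum]
  refine Finset.sum_congr rfl fun g _ => ?_
  rw [Finset.sum_comm]
  simp_rw [← Finset.mul_sum, DirichletCharacter.sum_char_inv_mul_char_eq ℂ (Units.isUnit _)]
  simp only [Units.val_inj, mul_ite, mul_zero, Finset.sum_ite_eq', Finset.mem_univ, if_true]
  ring

lemma sum_normSq_unitTransform (u : (ZMod q)ˣ → ℂ) :
    ∑ χ : DirichletCharacter ℂ q, ‖unitTransform u χ‖ ^ 2 = q.totient * ∑ g, ‖u g‖ ^ 2 := by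
  have h := parseval u u
  simp_rw [Complex.mul_conj, Complex.normSq_eq_norm_sq] at h
  exact_mod_cast h

/-- Multiplying a transform by a sum of character values amounts to a convolution. -/
lemma sum_char_mul_unitTransform {ι : Type*} (A : Finset ι) (a : ι → (ZMod q)ˣ)
    (u : (ZMod q)ˣ → ℂ) (χ : DirichletCharacter ℂ q) :
    (∑ i ∈ A, χ (a i : ZMod q)) * unitTransform u χ =
      unitTransform (fun g => ∑ i ∈ A, u (g * (a i)⁻¹)) χ := by
  unfold unitTransform
  simp_rw [Finset.sum_mul]
  rw [Finset.sum_comm]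
  refine Finset.sum_congr rfl fun i _ => ?_
  rw [Finset.mul_sum, ← Equiv.sum_comp (Equiv.mulRight (a i))
    (fun g => u (g * (a i)⁻¹) * χ (g : ZMod q))]
  refine Finset.sum_congr rfl fun g _ => ?_
  simp only [Equiv.coe_mulRight, mul_inv_cancel_right, Units.val_mul, map_mul]
  ring

/-- The second moment of `S(x, χ)` against a resonator `χ ↦ ∑ r(g) χ(g)`: the principal
character contributes at most the last term, every other character at most `Δ(x, q)²`. -/
lemma convolution_sq_le (x : ℝ) (r : (ZMod q)ˣ → ℝ) :
    q.totient * ∑ g, (∑ n ∈ coprimeUpTo q x, r (g * (toUnit q n)⁻¹)) ^ 2 ≤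
      Delta x q ^ 2 * (q.totient * ∑ g, r g ^ 2) +
        ((coprimeUpTo q x).card * ∑ g, r g) ^ 2 := by
  set u : (ZMod q)ˣ → ℂ := fun g => (r g : ℂ) with hu
  have h1 : q.totient * ∑ g, (∑ n ∈ coprimeUpTo q x, r (g * (toUnit q n)⁻¹)) ^ 2 =
      ∑ χ : DirichletCharacter ℂ q, ‖charSum x χ * unitTransform u χ‖ ^ 2 := by
    simp_rw [charSum_eq, sum_char_mul_unitTransform, sum_normSq_unitTransform]
    congr 1
    refine Finset.sum_congr rfl fun g _ => ?_
    rw [hu]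
    simp only
    rw [← Complex.ofReal_sum, Complex.norm_real, Real.norm_eq_abs, sq_abs]
  have h2 : q.totient * ∑ g, r g ^ 2 =
      ∑ χ : DirichletCharacter ℂ q, ‖unitTransform u χ‖ ^ 2 := by
    rw [sum_normSq_unitTransform]
    congr 1
    refine Finset.sum_congr rfl fun g _ => ?_
    rw [hu, Complex.norm_real, Real.norm_eq_abs, sq_abs]
  have h3 : ‖charSum x (1 : DirichletCharacter ℂ q) * unitTransform u 1‖ ^ 2 =
      ((coprimeUpTo q x).card * ∑ g, r g) ^ 2 := by
    have ha : charSum x (1 : DirichletCharacter ℂ q) = ((coprimeUpTo q x).card : ℂ) := by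
      rw [charSum_eq]
      simp [MulChar.one_apply_coe]
    have hb : unitTransform u 1 = ((∑ g, r g : ℝ) : ℂ) := by
      unfold unitTransform
      simp [MulChar.one_apply_coe, hu]
    rw [ha, hb, ← Complex.ofReal_natCast, ← Complex.ofReal_mul, Complex.norm_real,
      Real.norm_eq_abs, sq_abs]
  rw [h1, h2, ← h3, ← Finset.sum_erase_add _ _ (Finset.mem_univ (1 : DirichletCharacter ℂ q))]
  gcongr
  rw [Finset.mul_sum]
  refine (Finset.sum_le_sum fun χ hχ => ?_).trans
    (Finset.sum_le_sum_of_subset_of_nonneg (Finset.erase_subset _ _) fun χ _ _ => by positivity)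
  rw [norm_mul, mul_pow]
  gcongr
  exact norm_charSum_le_Delta x (Finset.ne_of_mem_erase hχ)

end Fourier

/-! ### Integers prime to `q` -/

/-- Inclusion–exclusion over a set `P` of primes. If for every `d` in a class closed under
multiplication by `P` the sum of `g` over the multiples of `d` up to `x` is `A / d + O(B)`, then
the sum over the integers free of the primes of `P` is `A ∏ (1 - 1/p) + O(2 ^ |P| B)`. -/
lemma abs_sum_sifted_sub_le {g : ℕ → ℝ} {x A B : ℝ} {D : ℕ → Prop} (P : Finset ℕ)
    (hP : ∀ p ∈ P, p.Prime) (hD : ∀ d, D d → ∀ p ∈ P, D (d * p))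
    (h : ∀ d, D d → |∑ l ∈ Finset.Icc 1 ⌊x / d⌋₊, g (d * l) - A / d| ≤ B) :
    ∀ d, D d →
      |∑ l ∈ (Finset.Icc 1 ⌊x / d⌋₊).filter (fun l => ∀ p ∈ P, ¬ p ∣ l), g (d * l) -
        A / d * ∏ p ∈ P, (1 - 1 / (p : ℝ))| ≤ 2 ^ P.card * B := by
  induction P using Finset.induction_on with
  | empty => simpa using h
  | insert p P hp ih =>
    intro d hd
    have ih' := ih (fun p' h' => hP p' (Finset.mem_insert_of_mem h'))
      (fun d hd p' h' => hD d hd p' (Finset.mem_insert_of_mem h'))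
    have h1 := ih' d hd
    have h2 := ih' (d * p) (hD d hd p (Finset.mem_insert_self _ _))
    have hpp : p.Prime := hP p (Finset.mem_insert_self _ _)
    have hp0 : (p : ℝ) ≠ 0 := by exact_mod_cast hpp.ne_zero
    -- the sifted integers divisible by `p` are `p` times the sifted integers up to `x / (d p)`
    have key : ∑ l ∈ (Finset.Icc 1 ⌊x / d⌋₊).filter (fun l => ∀ p' ∈ P, ¬ p' ∣ l), g (d * l) =
        ∑ l ∈ (Finset.Icc 1 ⌊x / d⌋₊).filter (fun l => ∀ p' ∈ insert p P, ¬ p' ∣ l), g (d * l) +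
        ∑ l ∈ (Finset.Icc 1 ⌊x / ((d * p : ℕ) : ℝ)⌋₊).filter (fun l => ∀ p' ∈ P, ¬ p' ∣ l),
          g (d * p * l) := by
      rw [← Finset.sum_filter_add_sum_filter_not
        ((Finset.Icc 1 ⌊x / d⌋₊).filter (fun l => ∀ p' ∈ P, ¬ p' ∣ l)) (fun l => ¬ p ∣ l)]
      congr 1
      · refine Finset.sum_congr ?_ fun _ _ => rfl
        ext l
        simp only [Finset.mem_filter, Finset.mem_insert, forall_eq_or_imp]
        tauto
      · symm
        refine Finset.sum_bij (fun l _ => p * l) ?_ ?_ ?_ ?_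
        · intro l hl
          simp only [Finset.mem_filter, Finset.mem_Icc, not_not] at hl ⊢
          obtain ⟨⟨hl1, hl2⟩, hl3⟩ := hl
          refine ⟨⟨⟨Nat.mul_pos hpp.pos hl1, ?_⟩, ?_⟩, dvd_mul_right _ _⟩
          · rw [Nat.le_floor_iff' (by omega)] at hl2
            rw [Nat.le_floor_iff' (Nat.mul_pos hpp.pos hl1).ne']
            push_cast at hl2 ⊢
            rw [← div_div, le_div_iff₀ (by exact_mod_cast hpp.pos)] at hl2
            linarith
          · intro p' hp' hdvd
            have hp'' := hP p' (Finset.mem_insert_of_mem hp')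
            rcases (hp''.dvd_mul).1 hdvd with h' | h'
            · rw [Nat.prime_dvd_prime_iff_eq hp'' hpp] at h'
              exact hp (h' ▸ hp')
            · exact hl3 p' hp' h'
        · intro a _ b _ hab
          exact Nat.eq_of_mul_eq_mul_left hpp.pos hab
        · intro l hl
          simp only [Finset.mem_filter, Finset.mem_Icc, not_not] at hl
          obtain ⟨⟨⟨hl1, hl2⟩, hl3⟩, m, rfl⟩ := hl
          have hm : m ≠ 0 := by rintro rfl; simp at hl1
          refine ⟨m, ?_, rfl⟩
          simp only [Finset.mem_filter, Finset.mem_Icc]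
          refine ⟨⟨Nat.one_le_iff_ne_zero.2 hm, ?_⟩, fun p' hp' h' =>
            hl3 p' hp' (h'.mul_left _)⟩
          rw [Nat.le_floor_iff' (by omega)] at hl2
          rw [Nat.le_floor_iff' hm]
          push_cast at hl2 ⊢
          rw [← div_div, le_div_iff₀ (by exact_mod_cast hpp.pos)]
          linarith
        · intro l _
          rw [mul_assoc]
    rw [Finset.prod_insert hp, Finset.card_insert_of_notMem hp, pow_succ]
    rw [key] at h1
    push_cast at h1 h2 ⊢
    rw [abs_le] at h1 h2 ⊢
    have e : A / (d : ℝ) * ((1 - 1 / (p : ℝ)) * ∏ p ∈ P, (1 - 1 / (p : ℝ))) =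
        A / d * ∏ p ∈ P, (1 - 1 / (p : ℝ)) -
          A / (d * p) * ∏ p ∈ P, (1 - 1 / (p : ℝ)) := by
      rw [← div_div]
      ring
    rw [e]
    constructor <;> linarith [h1.1, h1.2, h2.1, h2.2]

/-- The product is smallest when `P = {2, …, |P| + 1}`, where it telescopes to the left-hand side.
-/
lemma inv_card_add_one_le_prod (P : Finset ℕ) (hP : ∀ p ∈ P, 2 ≤ p) :
    1 / ((P.card : ℝ) + 1) ≤ ∏ p ∈ P, (1 - 1 / (p : ℝ)) := by
  induction P using Finset.induction_on_max with
  | empty => simp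
  | insert p P hlt ih =>
    have hp : p ∉ P := fun h => lt_irrefl _ (hlt p h)
    rw [Finset.prod_insert hp, Finset.card_insert_of_notMem hp]
    have ih' := ih fun a ha => hP a (Finset.mem_insert_of_mem ha)
    have hsub : P ⊆ Finset.Ico 2 p := fun a ha =>
      Finset.mem_Ico.2 ⟨hP a (Finset.mem_insert_of_mem ha), hlt a ha⟩
    have hcard := Finset.card_le_card hsub
    rw [Nat.card_Ico] at hcard
    have h2 := hP p (Finset.mem_insert_self _ _)
    have hcard' : (P.card : ℝ) + 2 ≤ p := by
      have : P.card + 2 ≤ p := by omega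
      exact_mod_cast this
    have h3 : 1 / (p : ℝ) ≤ 1 / ((P.card : ℝ) + 2) := by gcongr
    have h4 : (0 : ℝ) < (P.card : ℝ) + 1 := by positivity
    have h5 : ((P.card : ℝ) + 1) / ((P.card : ℝ) + 2) ≤ 1 - 1 / (p : ℝ) := by
      have : ((P.card : ℝ) + 1) / ((P.card : ℝ) + 2) = 1 - 1 / ((P.card : ℝ) + 2) := by
        field_simp; ring
      linarith
    calc 1 / (((P.card + 1 : ℕ) : ℝ) + 1) =
        ((P.card : ℝ) + 1) / ((P.card : ℝ) + 2) * (1 / ((P.card : ℝ) + 1)) := by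
          push_cast; field_simp; ring
      _ ≤ _ := mul_le_mul h5 ih' (by positivity) (le_trans (by positivity) h5)

lemma coprime_iff_forall_primeFactors {q n : ℕ} (hq : q ≠ 0) :
    n.Coprime q ↔ ∀ p ∈ q.primeFactors, ¬ p ∣ n := by
  rw [Nat.Coprime, Nat.eq_one_iff_not_exists_prime_dvd]
  constructor
  · intro h p hp hpn
    exact h p (Nat.prime_of_mem_primeFactors hp)
      (Nat.dvd_gcd hpn (Nat.dvd_of_mem_primeFactors hp))
  · intro h p hp hpd
    exact h p (Nat.mem_primeFactors.2 ⟨hp, hpd.trans (Nat.gcd_dvd_right _ _), hq⟩)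
      (hpd.trans (Nat.gcd_dvd_left _ _))

lemma totient_div_eq_prod {q : ℕ} (hq : q ≠ 0) :
    (q.totient : ℝ) / q = ∏ p ∈ q.primeFactors, (1 - 1 / (p : ℝ)) := by
  have h := Nat.totient_eq_mul_prod_factors q
  have h' : ((q.totient : ℚ) : ℝ) = ((q * ∏ p ∈ q.primeFactors, (1 - (p : ℚ)⁻¹) : ℚ) : ℝ) := by
    rw [h]
  push_cast at h'
  rw [h']
  have : (q : ℝ) ≠ 0 := by exact_mod_cast hq
  field_simp

/-- A lower bound for `φ(q) / q` in terms of `ω(q)` only. -/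
lemma inv_card_add_one_le_totient_div {q : ℕ} (hq : q ≠ 0) :
    1 / ((q.primeFactors.card : ℝ) + 1) ≤ (q.totient : ℝ) / q := by
  rw [totient_div_eq_prod hq]
  exact inv_card_add_one_le_prod _ fun p hp => (Nat.prime_of_mem_primeFactors hp).two_le

/-- Inclusion–exclusion over the prime factors of `q`. The predicate `D` records what is known
about the divisors `d` that occur, beyond their being products of primes of `q`. -/
lemma abs_sum_coprimeUpTo_sub_le {q : ℕ} (hq : q ≠ 0) {g : ℕ → ℝ} {x A B : ℝ} {D : ℕ → Prop}
    (hD1 : D 1) (hD : ∀ d, D d → ∀ p ∈ q.primeFactors, D (d * p))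
    (h : ∀ d, D d → |∑ l ∈ Finset.Icc 1 ⌊x / d⌋₊, g (d * l) - A / d| ≤ B) :
    |∑ l ∈ coprimeUpTo q x, g l - A * (q.totient / q)| ≤ 2 ^ q.primeFactors.card * B := by
  have h1 := abs_sum_sifted_sub_le q.primeFactors
    (fun p hp => Nat.prime_of_mem_primeFactors hp) hD h 1 hD1
  have h2 : (Finset.Icc 1 ⌊x / ((1 : ℕ) : ℝ)⌋₊).filter (fun l => ∀ p ∈ q.primeFactors, ¬ p ∣ l) =
      coprimeUpTo q x := by
    unfold coprimeUpTo
    simp only [Nat.cast_one, div_one]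
    exact Finset.filter_congr fun n _ => (coprime_iff_forall_primeFactors hq).symm
  rw [h2, ← totient_div_eq_prod hq] at h1
  simpa using h1

lemma abs_card_coprimeUpTo_sub_le {q : ℕ} (hq : q ≠ 0) {x : ℝ} (hx : 0 ≤ x) :
    |((coprimeUpTo q x).card : ℝ) - x * (q.totient / q)| ≤ 2 ^ q.primeFactors.card := by
  have h := abs_sum_coprimeUpTo_sub_le (g := fun _ => 1) (x := x) (A := x) (B := 1)
    (D := fun _ => True) hq trivial (fun _ _ _ _ => trivial) ?_
  · simpa using h
  · intro d _
    have h0 : 0 ≤ x / d := by positivity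
    simp only [Finset.sum_const, Nat.card_Icc, nsmul_eq_mul, mul_one, Nat.add_sub_cancel]
    rw [abs_le]
    constructor <;> linarith [Nat.floor_le h0, Nat.lt_floor_add_one (x / d)]

/-! ### Sums of sines -/

/-- The second order expansion of the cosine at `a`, with the step written as `-t`. -/
lemma abs_cos_sub_cos_sub_mul_sin_le {t : ℝ} (ht : 0 ≤ t) (a : ℝ) :
    |Real.cos (a - t) - Real.cos a - t * Real.sin a| ≤ 3 * t ^ 2 := by
  have e : Real.cos (a - t) - Real.cos a - t * Real.sin a =
      Real.cos a * (Real.cos t - 1) + Real.sin a * (Real.sin t - t) := by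
    rw [Real.cos_sub]; ring
  have h1 : |Real.cos t - 1| ≤ t ^ 2 / 2 := by
    rw [abs_le]
    constructor <;> nlinarith [Real.one_sub_sq_div_two_le_cos (x := t), Real.cos_le_one t]
  have h2 : |Real.sin t - t| ≤ 2 * t ^ 2 := by
    have h3 := Real.sin_le ht
    rw [abs_sub_comm, abs_of_nonneg (by linarith)]
    rcases le_or_gt t 1 with h | h
    · rcases ht.eq_or_lt with rfl | h0
      · simp
      · nlinarith [Real.sin_gt_sub_cube h0, sq_nonneg t, mul_nonneg ht (sq_nonneg t)]
    · nlinarith [Real.neg_one_le_sin t]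
  rw [e]
  calc _ ≤ |Real.cos a * (Real.cos t - 1)| + |Real.sin a * (Real.sin t - t)| := abs_add_le _ _
    _ ≤ 1 * (t ^ 2 / 2) + 1 * (2 * t ^ 2) := by
      rw [abs_mul, abs_mul]
      gcongr
      · exact Real.abs_cos_le_one a
      · exact Real.abs_sin_le_one a
    _ ≤ 3 * t ^ 2 := by nlinarith [sq_nonneg t]

/-- The sum of `sin (l θ)` over `l ≤ X`, compared with the integral `(1 - cos (X θ)) / θ` of `sin
(t θ)` over `[0, X]`. -/
lemma abs_sum_sin_sub_le {θ X : ℝ} (hθ : 0 < θ) (hX : 0 ≤ X) :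
    |∑ l ∈ Finset.Icc 1 ⌊X⌋₊, Real.sin (l * θ) - (1 - Real.cos (X * θ)) / θ| ≤
      3 * (X * θ) + 1 := by
  have h1 : ∀ N : ℕ, |∑ l ∈ Finset.Icc 1 N, Real.sin (l * θ) - (1 - Real.cos (N * θ)) / θ| ≤
      3 * (N * θ) := by
    intro N
    induction N with
    | zero => simp
    | succ N ih =>
      rw [Finset.sum_Icc_succ_top (by omega)]
      have h2 := abs_cos_sub_cos_sub_mul_sin_le hθ.le (((N + 1 : ℕ) : ℝ) * θ)
      have e1 : ((N + 1 : ℕ) : ℝ) * θ - θ = N * θ := by push_cast; ring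
      rw [e1] at h2
      have h3 : |(Real.cos (N * θ) - Real.cos (((N + 1 : ℕ) : ℝ) * θ)) / θ -
          Real.sin (((N + 1 : ℕ) : ℝ) * θ)| ≤ 3 * θ := by
        have e2 : (Real.cos (N * θ) - Real.cos (((N + 1 : ℕ) : ℝ) * θ)) / θ -
          Real.sin (((N + 1 : ℕ) : ℝ) * θ) = (Real.cos (N * θ) - Real.cos (((N + 1 : ℕ) : ℝ) * θ) -
            θ * Real.sin (((N + 1 : ℕ) : ℝ) * θ)) / θ := by field_simp
        rw [e2, abs_div, abs_of_pos hθ, div_le_iff₀ hθ]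
        nlinarith
      rw [abs_le] at ih h3 ⊢
      rw [sub_div] at ih h3
      rw [sub_div]
      push_cast at *
      constructor <;> [nlinarith [ih.1, h3.2]; nlinarith [ih.2, h3.1]]
  have h2 := h1 ⌊X⌋₊
  have hf := Nat.floor_le hX
  have hf' := Nat.lt_floor_add_one X
  have h3 : |(1 - Real.cos (⌊X⌋₊ * θ)) / θ - (1 - Real.cos (X * θ)) / θ| ≤ 1 := by
    rw [← sub_div, abs_div, abs_of_pos hθ, div_le_iff₀ hθ]
    calc _ = |Real.cos (X * θ) - Real.cos (⌊X⌋₊ * θ)| := by congr 1; ring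
      _ ≤ |X * θ - ⌊X⌋₊ * θ| := Real.abs_cos_sub_cos_le _ _
      _ = (X - ⌊X⌋₊) * θ := by rw [← sub_mul, abs_mul, abs_of_nonneg (by linarith), abs_of_pos hθ]
      _ ≤ 1 * θ := by gcongr; linarith
  have h4 : (⌊X⌋₊ : ℝ) * θ ≤ X * θ := by gcongr
  rw [abs_le] at h2 h3 ⊢
  constructor <;> linarith [h2.1, h2.2, h3.1, h3.2]

lemma norm_pow_sub_one_le {z : ℂ} (hz : ‖z‖ = 1) (n : ℕ) : ‖z ^ n - 1‖ ≤ n * ‖z - 1‖ := by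
  rw [← geom_sum_mul, norm_mul]
  gcongr
  calc _ ≤ ∑ i ∈ Finset.range n, ‖z ^ i‖ := norm_sum_le _ _
    _ = n := by simp [hz]

/-- A root of unity of order dividing `n` stays away from `1`: its powers sum to `0`, but each of
the `n` powers is within `n ‖z - 1‖` of `1`. -/
lemma inv_le_norm_sub_one_of_pow_eq_one {z : ℂ} {n : ℕ} (hn : 0 < n) (hz : z ^ n = 1)
    (hz1 : z ≠ 1) : 1 / (n : ℝ) ≤ ‖z - 1‖ := by
  have hnorm : ‖z‖ = 1 := Complex.norm_eq_one_of_pow_eq_one hz hn.ne'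
  have h1 : ∑ i ∈ Finset.range n, z ^ i = 0 := by
    have := geom_sum_mul z n
    rw [hz, sub_self] at this
    exact (mul_eq_zero.1 this).resolve_right (sub_ne_zero.2 hz1)
  have h2 : (n : ℂ) = -∑ i ∈ Finset.range n, (z ^ i - 1) := by
    rw [Finset.sum_sub_distrib, h1]; simp
  have h3 : (n : ℝ) ≤ n * (n * ‖z - 1‖) := by
    calc (n : ℝ) = ‖(n : ℂ)‖ := by simp
      _ ≤ ∑ i ∈ Finset.range n, ‖z ^ i - 1‖ := by rw [h2, norm_neg]; exact norm_sum_le _ _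
      _ ≤ ∑ i ∈ Finset.range n, n * ‖z - 1‖ := by
        refine Finset.sum_le_sum fun i hi => (norm_pow_sub_one_le hnorm i).trans ?_
        gcongr
        exact (Finset.mem_range.1 hi).le
      _ = _ := by simp
  have hn' : (0 : ℝ) < n := by exact_mod_cast hn
  rw [div_le_iff₀ hn']
  nlinarith

lemma norm_sum_pow_le {z : ℂ} (hz : ‖z‖ = 1) (hz1 : z ≠ 1) (L : ℕ) :
    ‖∑ l ∈ Finset.Icc 1 L, z ^ l‖ ≤ 2 / ‖z - 1‖ := by
  have h0 : 0 < ‖z - 1‖ := norm_pos_iff.2 (sub_ne_zero.2 hz1)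
  have h1 : ∑ l ∈ Finset.Icc 1 L, z ^ l = z * ∑ i ∈ Finset.range L, z ^ i := by
    rw [Finset.mul_sum, Finset.range_eq_Ico, Finset.sum_Ico_eq_sum_range,
      ← Finset.Ico_add_one_right_eq_Icc, Finset.sum_Ico_eq_sum_range]
    simp [pow_add]
  rw [le_div_iff₀ h0, h1, norm_mul, hz, one_mul, ← norm_mul, geom_sum_mul]
  calc _ ≤ ‖z ^ L‖ + ‖(1 : ℂ)‖ := norm_sub_le _ _
    _ = 2 := by rw [norm_pow, hz]; norm_num

section ModSine

variable {q : ℕ} [NeZero q]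

/-- The function `a ↦ sin (2 π a / q)` on `ℤ/q`. -/
noncomputable def modSin (a : ZMod q) : ℝ := (ZMod.stdAddChar a).im

lemma modSin_natCast (k : ℕ) : modSin (k : ZMod q) = Real.sin (2 * Real.pi * k / q) := by
  unfold modSin
  have h := ZMod.stdAddChar_coe (N := q) (k : ℤ)
  push_cast at h
  rw [h]
  have : (2 * (Real.pi : ℂ) * Complex.I * k / q) =
      ((2 * Real.pi * k / q : ℝ) : ℂ) * Complex.I := by
    push_cast; ring
  rw [this, Complex.exp_ofReal_mul_I_im]

lemma modSin_neg (a : ZMod q) : modSin (-a) = -modSin a := by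
  unfold modSin
  rw [AddChar.map_neg_eq_conj, Complex.conj_im]

lemma norm_stdAddChar (a : ZMod q) : ‖ZMod.stdAddChar a‖ = 1 := by
  exact AddChar.norm_apply _ _

lemma modSin_mul_modSin (a b : ZMod q) : modSin a * modSin b =
    ((ZMod.stdAddChar (a - b)).re - (ZMod.stdAddChar (a + b)).re) / 2 := by
  unfold modSin
  rw [sub_eq_add_neg a b, AddChar.map_add_eq_mul, AddChar.map_add_eq_mul, AddChar.map_neg_eq_conj,
    Complex.mul_re, Complex.mul_re, Complex.conj_re, Complex.conj_im]
  ring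

/-- Orthogonality of the functions `g ↦ sin (2 π g m / q)` for `0 < m < q / 2`. -/
lemma sum_modSin_mul {m n : ℕ} (hm : 0 < m) (hmq : 2 * m < q) (hnq : 2 * n < q) :
    ∑ g : ZMod q, modSin (g * (m : ZMod q)) * modSin (g * (n : ZMod q)) =
      if m = n then (q : ℝ) / 2 else 0 := by
  have h1 : ∀ a : ZMod q, ∑ g : ZMod q, (ZMod.stdAddChar (g * a)).re =
      if a = 0 then (q : ℝ) else 0 := by
    intro a
    rw [← Complex.re_sum, AddChar.sum_mulShift a (ZMod.isPrimitive_stdAddChar q)]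
    split_ifs <;> simp
  have h2 : ((m : ZMod q) + n = 0) ↔ False := by
    rw [iff_false]
    intro h
    have h' : ((m + n : ℕ) : ZMod q) = 0 := by push_cast; exact h
    rw [ZMod.natCast_eq_zero_iff] at h'
    exact absurd (Nat.le_of_dvd (by omega) h') (by omega)
  have h3 : ((m : ZMod q) - n = 0) ↔ m = n := by
    rw [sub_eq_zero, ZMod.natCast_eq_natCast_iff']
    rw [Nat.mod_eq_of_lt (by omega), Nat.mod_eq_of_lt (by omega)]
  simp_rw [modSin_mul_modSin, ← mul_sub, ← mul_add]
  rw [← Finset.sum_div, Finset.sum_sub_distrib, h1, h1]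
  simp only [h2, h3, if_false]
  split_ifs <;> simp

lemma sum_sq_sum_modSin {M : Finset ℕ} (hM : ∀ m ∈ M, 0 < m ∧ 2 * m < q) :
    ∑ g : ZMod q, (∑ m ∈ M, modSin (g * (m : ZMod q))) ^ 2 = q / 2 * M.card := by
  simp_rw [sq, Finset.sum_mul_sum]
  rw [Finset.sum_comm]
  simp_rw [Finset.sum_comm (s := Finset.univ)]
  rw [Finset.sum_congr rfl fun m hm => Finset.sum_congr rfl fun n hn =>
    sum_modSin_mul (hM m hm).1 (hM m hm).2 (hM n hn).2]
  simp [Finset.sum_ite_eq]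
  ring

/-- The sum of `sin (2 π l a / q)` stays bounded when `a` is the residue `d m / m'` with
`m' ∤ d m` and `d m` small compared with `q`: then `a / q` is far from the integers. -/
lemma abs_sum_modSin_le {a : ZMod q} {d m m' : ℕ} (hm' : 0 < m')
    (ha : (m' : ZMod q) * a = ((d * m : ℕ) : ZMod q)) (hdvd : ¬ m' ∣ d * m)
    (hsmall : 4 * Real.pi * (d * m) ≤ q) (L : ℕ) :
    |∑ l ∈ Finset.Icc 1 L, modSin ((l : ZMod q) * a)| ≤ 4 * m' := by
  have hq : (0 : ℝ) < q := by exact_mod_cast NeZero.pos q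
  have hm'' : (0 : ℝ) < m' := by exact_mod_cast hm'
  set z : ℂ := ZMod.stdAddChar a with hz
  set t : ℝ := 2 * Real.pi * (d * m) / (q * m') with ht
  set ζ : ℂ := Complex.exp (Complex.I * t) with hζ
  have hznorm : ‖z‖ = 1 := norm_stdAddChar a
  have hζnorm : ‖ζ‖ = 1 := by rw [hζ, mul_comm, Complex.norm_exp_ofReal_mul_I]
  have hζ0 : ζ ≠ 0 := Complex.exp_ne_zero _
  -- `z / ζ` is an `m'`-th root of unity; it is not `1` because `m' ∤ d m`, and `ζ` is close to
  -- `1`, so that `z` is far from `1`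
  have hpow : z ^ m' = ζ ^ m' := by
    rw [hz, ← AddChar.map_nsmul_eq_pow, nsmul_eq_mul, ha, hζ, ← Complex.exp_nat_mul]
    have h := ZMod.stdAddChar_coe (N := q) ((d * m : ℕ) : ℤ)
    rw [Int.cast_natCast] at h
    rw [h, ht]
    congr 1
    push_cast
    have : (m' : ℂ) ≠ 0 := by exact_mod_cast hm'.ne'
    field_simp
  have hne : z / ζ ≠ 1 := by
    intro h
    rw [div_eq_one_iff_eq hζ0] at h
    have h1 : z ^ q = 1 := by
      rw [hz, ← AddChar.map_nsmul_eq_pow, nsmul_eq_mul, ZMod.natCast_self, zero_mul,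
        AddChar.map_zero_eq_one]
    rw [h, hζ, ← Complex.exp_nat_mul, Complex.exp_eq_one_iff] at h1
    obtain ⟨k, hk⟩ := h1
    have h2 : ((d * m : ℕ) : ℂ) = (m' : ℂ) * k := by
      have hπ : (2 * Real.pi * Complex.I : ℂ) ≠ 0 := Complex.two_pi_I_ne_zero
      have h3 : (m' : ℂ) ≠ 0 := by exact_mod_cast hm'.ne'
      have h4 : (q : ℂ) ≠ 0 := by exact_mod_cast NeZero.ne q
      have h5 : (q : ℂ) * (Complex.I * t) = (2 * Real.pi * Complex.I) * ((d * m : ℕ) / m') := by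
        rw [ht]; push_cast; field_simp
      rw [h5, mul_comm (k : ℂ)] at hk
      have h6 := mul_left_cancel₀ hπ hk
      rw [← h6]
      field_simp
    have h3 : ((d * m : ℕ) : ℤ) = (m' : ℤ) * k := by exact_mod_cast h2
    exact hdvd (by exact_mod_cast Dvd.intro _ h3.symm)
  have h1 : 1 / (m' : ℝ) ≤ ‖z / ζ - 1‖ := by
    refine inv_le_norm_sub_one_of_pow_eq_one hm' ?_ hne
    rw [div_pow, hpow, div_self (pow_ne_zero _ hζ0)]
  have h2 : ‖z / ζ - 1‖ = ‖z - ζ‖ := by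
    rw [div_sub_one hζ0, norm_div, hζnorm, div_one]
  have h3 : ‖ζ - 1‖ ≤ 1 / (2 * m') := by
    calc ‖ζ - 1‖ ≤ ‖t‖ := Real.norm_exp_I_mul_ofReal_sub_one_le
      _ = t := by rw [Real.norm_eq_abs, abs_of_nonneg (by positivity)]
      _ ≤ 1 / (2 * m') := by
        rw [ht, div_le_div_iff₀ (by positivity) (by positivity)]
        nlinarith
  have h4 : 1 / (2 * m' : ℝ) ≤ ‖z - 1‖ := by
    have h5 : ‖z - ζ‖ ≤ ‖z - 1‖ + ‖ζ - 1‖ := by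
      calc ‖z - ζ‖ = ‖(z - 1) - (ζ - 1)‖ := by congr 1; ring
        _ ≤ _ := norm_sub_le _ _
    have h6 : 1 / (m' : ℝ) = 1 / (2 * m') + 1 / (2 * m') := by field_simp; ring
    linarith
  have h5 : (0 : ℝ) < 1 / (2 * m') := by positivity
  have hz1 : z ≠ 1 := by
    rintro h
    rw [h, sub_self, norm_zero] at h4
    linarith
  have h6 : ∑ l ∈ Finset.Icc 1 L, modSin ((l : ZMod q) * a) = (∑ l ∈ Finset.Icc 1 L, z ^ l).im := by
    rw [Complex.im_sum]
    refine Finset.sum_congr rfl fun l _ => ?_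
    rw [modSin, ← nsmul_eq_mul, AddChar.map_nsmul_eq_pow]
  rw [h6]
  calc _ ≤ ‖∑ l ∈ Finset.Icc 1 L, z ^ l‖ := Complex.abs_im_le_norm _
    _ ≤ 2 / ‖z - 1‖ := norm_sum_pow_le hznorm hz1 L
    _ ≤ 2 / (1 / (2 * m')) := by gcongr
    _ = 4 * m' := by field_simp; norm_num

lemma abs_modSin_le_one (a : ZMod q) : |modSin a| ≤ 1 :=
  (Complex.abs_im_le_norm _).trans (norm_stdAddChar a).le

end ModSine

/-! ### Duality -/

/-- Integers below `q` and prime to `q` are determined by their classes. -/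
lemma toUnit_inj {q m n : ℕ} (hm : m.Coprime q) (hn : n.Coprime q) (hmq : m < q) (hnq : n < q)
    (h : toUnit q m = toUnit q n) : m = n := by
  have h1 : (m : ZMod q) = n := by rw [← coe_toUnit hm, ← coe_toUnit hn, h]
  rw [ZMod.natCast_eq_natCast_iff', Nat.mod_eq_of_lt hmq, Nat.mod_eq_of_lt hnq] at h1
  exact h1

section Duality

variable {q : ℕ} [NeZero q]

/-- Testing the character sums against the transform of a function `v` of mean zero, so that
the principal character does not contribute. -/
lemma sum_convolution_mul_le (x : ℝ) (w v : (ZMod q)ˣ → ℝ) (hv : ∑ g, v g = 0) :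
    ∑ g, (∑ n ∈ coprimeUpTo q x, w (g * (toUnit q n)⁻¹)) * v g ≤
      Delta x q * (Real.sqrt (∑ g, w g ^ 2) * Real.sqrt (∑ g, v g ^ 2)) := by
  set W : (ZMod q)ˣ → ℂ := fun g => (w g : ℂ) with hW
  set V : (ZMod q)ˣ → ℂ := fun g => (v g : ℂ) with hV
  have hφ : (0 : ℝ) < q.totient := by exact_mod_cast Nat.totient_pos.2 (NeZero.pos q)
  have h1 : ((q.totient * ∑ g, (∑ n ∈ coprimeUpTo q x, w (g * (toUnit q n)⁻¹)) * v g : ℝ) : ℂ) =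
      ∑ χ : DirichletCharacter ℂ q,
        charSum x χ * unitTransform W χ * conj (unitTransform V χ) := by
    simp_rw [charSum_eq, sum_char_mul_unitTransform, parseval]
    push_cast
    simp [hW, hV]
  have hsq : ∀ f : (ZMod q)ˣ → ℝ, ∑ χ : DirichletCharacter ℂ q,
      ‖unitTransform (fun g => (f g : ℂ)) χ‖ ^ 2 = q.totient * ∑ g, f g ^ 2 := by
    intro f
    rw [sum_normSq_unitTransform]
    simp
  have h2 : ∀ χ : DirichletCharacter ℂ q,
      ‖charSum x χ * unitTransform W χ * conj (unitTransform V χ)‖ ≤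
        Delta x q * (‖unitTransform W χ‖ * ‖unitTransform V χ‖) := by
    intro χ
    rw [norm_mul, norm_mul, RCLike.norm_conj, mul_assoc]
    by_cases hχ : χ = 1
    · have : unitTransform V χ = ((∑ g, v g : ℝ) : ℂ) := by
        unfold unitTransform
        simp [hχ, MulChar.one_apply_coe, hV]
      rw [this, hv]
      simp
    · gcongr
      exact norm_charSum_le_Delta x hχ
  have h3 : q.totient * ∑ g, (∑ n ∈ coprimeUpTo q x, w (g * (toUnit q n)⁻¹)) * v g ≤
      Delta x q * ∑ χ : DirichletCharacter ℂ q, ‖unitTransform W χ‖ * ‖unitTransform V χ‖ := by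
    calc _ ≤ ‖((q.totient * ∑ g,
          (∑ n ∈ coprimeUpTo q x, w (g * (toUnit q n)⁻¹)) * v g : ℝ) : ℂ)‖ := by
          rw [Complex.norm_real]; exact Real.le_norm_self _
      _ ≤ ∑ χ : DirichletCharacter ℂ q,
          ‖charSum x χ * unitTransform W χ * conj (unitTransform V χ)‖ := by
          rw [h1]; exact norm_sum_le _ _
      _ ≤ ∑ χ : DirichletCharacter ℂ q,
          Delta x q * (‖unitTransform W χ‖ * ‖unitTransform V χ‖) :=
          Finset.sum_le_sum fun χ _ => h2 χ
      _ = _ := by rw [Finset.mul_sum]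
  have h4 : ∑ χ : DirichletCharacter ℂ q, ‖unitTransform W χ‖ * ‖unitTransform V χ‖ ≤
      q.totient * (Real.sqrt (∑ g, w g ^ 2) * Real.sqrt (∑ g, v g ^ 2)) := by
    refine (Real.sum_mul_le_sqrt_mul_sqrt _ _ _).trans_eq ?_
    rw [hsq w, hsq v, Real.sqrt_mul hφ.le, Real.sqrt_mul hφ.le]
    rw [mul_mul_mul_comm, Real.mul_self_sqrt hφ.le]
  have h5 := h3.trans (mul_le_mul_of_nonneg_left h4 (Delta_nonneg x))
  rw [mul_left_comm] at h5
  exact le_of_mul_le_mul_left h5 hφ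

lemma sum_units_modSin : ∑ g : (ZMod q)ˣ, modSin (g : ZMod q) = 0 := by
  have h := Equiv.sum_comp (Equiv.neg (ZMod q)ˣ) (fun g => modSin (g : ZMod q))
  simp only [Equiv.neg_apply, Units.val_neg, modSin_neg, Finset.sum_neg_distrib] at h
  linarith

/-- The duality bound for the indicator function of `M` and the sum of the translates of `sin (2 π
g / q)` by the elements of `M`: a sum over triples `(n, m, m')` of `sin (2 π n m m'⁻¹ / q)`. -/
lemma sum_pairs_modSin_le (x : ℝ) {M : Finset ℕ} (hM : ∀ m ∈ M, m.Coprime q ∧ m < q) :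
    ∑ m ∈ M, ∑ m' ∈ M, ∑ n ∈ coprimeUpTo q x,
      modSin ((toUnit q n * toUnit q m * (toUnit q m')⁻¹ : (ZMod q)ˣ) : ZMod q) ≤
    Delta x q * (Real.sqrt M.card * Real.sqrt
      (∑ g : (ZMod q)ˣ, (∑ m ∈ M, modSin ((g * (toUnit q m)⁻¹ : (ZMod q)ˣ) : ZMod q)) ^ 2)) := by
  classical
  have hinj : Set.InjOn (toUnit q) M := fun a ha b hb h =>
    toUnit_inj (hM a ha).1 (hM b hb).1 (hM a ha).2 (hM b hb).2 h
  set I := M.image (toUnit q) with hI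
  set w : (ZMod q)ˣ → ℝ := fun g => if g ∈ I then 1 else 0 with hw
  set v : (ZMod q)ˣ → ℝ := fun g =>
    ∑ m ∈ M, modSin ((g * (toUnit q m)⁻¹ : (ZMod q)ˣ) : ZMod q) with hv
  have hv0 : ∑ g, v g = 0 := by
    rw [hv, Finset.sum_comm]
    refine Finset.sum_eq_zero fun m _ => ?_
    exact (Equiv.sum_comp (Equiv.mulRight (toUnit q m)⁻¹)
      (fun g : (ZMod q)ˣ => modSin (g : ZMod q))).trans sum_units_modSin
  have hw2 : ∑ g, w g ^ 2 = M.card := by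
    simp only [hw, ite_pow, one_pow, ne_eq, OfNat.ofNat_ne_zero, not_false_eq_true, zero_pow]
    rw [Finset.sum_ite_mem, Finset.univ_inter, Finset.sum_const, hI,
      Finset.card_image_of_injOn hinj, nsmul_eq_mul, mul_one]
  have h := sum_convolution_mul_le x w v hv0
  rw [hw2] at h
  refine le_trans (le_of_eq ?_) h
  simp_rw [Finset.sum_mul]
  rw [Finset.sum_comm (s := Finset.univ)]
  have e : ∀ n ∈ coprimeUpTo q x, ∑ g, w (g * (toUnit q n)⁻¹) * v g =
      ∑ m ∈ M, ∑ m' ∈ M,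
        modSin ((toUnit q n * toUnit q m * (toUnit q m')⁻¹ : (ZMod q)ˣ) : ZMod q) := by
    intro n _
    rw [← Equiv.sum_comp (Equiv.mulRight (toUnit q n))]
    simp only [Equiv.coe_mulRight, mul_inv_cancel_right, hw, ite_mul, one_mul, zero_mul]
    rw [Finset.sum_ite_mem, Finset.univ_inter, hI, Finset.sum_image hinj]
    refine Finset.sum_congr rfl fun m _ => Finset.sum_congr rfl fun m' _ => ?_
    rw [mul_comm (toUnit q m)]
  rw [Finset.sum_congr rfl e, Finset.sum_comm (s := coprimeUpTo q x)]
  refine Finset.sum_congr rfl fun m _ => ?_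
  rw [Finset.sum_comm]

/-- The complementary divisor turns the inverses into genuine integer multiples, so that the sum
over the units can be extended to all of `ℤ/q`. -/
lemma sum_sq_divisors_modSin_le {E : ℕ} (hE : E.Coprime q) (hEq : 2 * E < q) :
    ∑ g : (ZMod q)ˣ,
      (∑ m ∈ E.divisors, modSin ((g * (toUnit q m)⁻¹ : (ZMod q)ˣ) : ZMod q)) ^ 2 ≤
      q / 2 * E.divisors.card := by
  have hsub : ∀ m ∈ E.divisors, 0 < m ∧ 2 * m < q := by
    intro m hm
    have := Nat.divisor_le hm
    exact ⟨Nat.pos_of_mem_divisors hm, by omega⟩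
  rw [← sum_sq_sum_modSin hsub, ← Equiv.sum_comp (Equiv.mulRight (toUnit q E))]
  have e : ∀ g : (ZMod q)ˣ,
      (∑ m ∈ E.divisors, modSin ((g * toUnit q E * (toUnit q m)⁻¹ : (ZMod q)ˣ) : ZMod q)) ^ 2 =
      (∑ m ∈ E.divisors, modSin ((g : ZMod q) * (m : ZMod q))) ^ 2 := by
    intro g
    rw [← Nat.sum_div_divisors E (fun m => modSin ((g : ZMod q) * (m : ZMod q)))]
    congr 1
    refine Finset.sum_congr rfl fun m hm => ?_
    obtain ⟨k, hk⟩ := Nat.dvd_of_mem_divisors hm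
    have hm0 := Nat.pos_of_mem_divisors hm
    have hmq : m.Coprime q := Nat.Coprime.coprime_dvd_left ⟨k, hk⟩ hE
    have hkq : k.Coprime q := Nat.Coprime.coprime_dvd_left ⟨m, by rw [hk, mul_comm]⟩ hE
    have h1 : E / m = k := by rw [hk, Nat.mul_div_cancel_left _ hm0]
    rw [h1, hk, toUnit_mul hmq hkq, ← coe_toUnit hkq, ← Units.val_mul]
    congr 2
    rw [mul_comm (toUnit q m), ← mul_assoc, mul_inv_cancel_right]
  simp only [Equiv.coe_mulRight]
  rw [Finset.sum_congr rfl fun g _ => e g]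
  have h2 : ∑ g : (ZMod q)ˣ, (∑ m ∈ E.divisors, modSin ((g : ZMod q) * (m : ZMod q))) ^ 2 =
      ∑ a ∈ Finset.univ.map ⟨((↑) : (ZMod q)ˣ → ZMod q), Units.val_injective⟩,
        (∑ m ∈ E.divisors, modSin (a * (m : ZMod q))) ^ 2 := by
    rw [Finset.sum_map]; rfl
  rw [h2]
  exact Finset.sum_le_sum_of_subset_of_nonneg (Finset.subset_univ _) fun _ _ _ => sq_nonneg _

/-- The pairs `(m, m')` with `m' ∤ m` contribute little: for every product `d` of primes of `q`,
the multiples of `d` have a bounded sum, by `abs_sum_modSin_le` if `d` is small, and trivially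
otherwise. -/
lemma neg_le_sum_modSin_of_not_dvd {x : ℝ} (hx0 : 0 ≤ x) (hxq : x ≤ q) {m m' E : ℕ}
    (hm : m.Coprime q) (hm' : m'.Coprime q) (hm0 : 0 < m) (hm0' : 0 < m') (hmE : m ≤ E)
    (hmE' : m' ≤ E) (hdvd : ¬ m' ∣ m) :
    -(2 ^ q.primeFactors.card * (20 * E : ℝ)) ≤ ∑ n ∈ coprimeUpTo q x,
      modSin ((toUnit q n * toUnit q m * (toUnit q m')⁻¹ : (ZMod q)ˣ) : ZMod q) := by
  set a : ZMod q := ((toUnit q m * (toUnit q m')⁻¹ : (ZMod q)ˣ) : ZMod q) with ha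
  have hma : (m' : ZMod q) * a = m := by
    rw [ha, ← coe_toUnit hm', ← Units.val_mul, mul_left_comm, mul_inv_cancel, mul_one,
      coe_toUnit hm]
  have hq : (0 : ℝ) < q := by exact_mod_cast NeZero.pos q
  have hmE1 : (m : ℝ) ≤ E := by exact_mod_cast hmE
  have hmE2 : (m' : ℝ) ≤ E := by exact_mod_cast hmE'
  have hm1 : (0 : ℝ) < m := by exact_mod_cast hm0
  have h := abs_sum_coprimeUpTo_sub_le (q := q) (NeZero.ne q) (x := x) (A := 0)
    (g := fun l => modSin ((l : ZMod q) * a)) (B := 20 * E)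
    (D := fun d => 0 < d ∧ d.Coprime m') ⟨one_pos, Nat.coprime_one_left _⟩ ?_ ?_
  · have e : ∑ n ∈ coprimeUpTo q x,
        modSin ((toUnit q n * toUnit q m * (toUnit q m')⁻¹ : (ZMod q)ˣ) : ZMod q) =
        ∑ n ∈ coprimeUpTo q x, modSin ((n : ZMod q) * a) := by
      refine Finset.sum_congr rfl fun n hn => ?_
      rw [mul_assoc, Units.val_mul, coe_toUnit (mem_coprimeUpTo.1 hn).2]
    rw [e]
    rw [zero_mul, sub_zero] at h
    exact (abs_le.1 h).1
  · rintro d ⟨hd0, hd⟩ p hp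
    refine ⟨Nat.mul_pos hd0 (Nat.prime_of_mem_primeFactors hp).pos, Nat.Coprime.mul_left hd ?_⟩
    exact (Nat.Coprime.coprime_dvd_right (Nat.dvd_of_mem_primeFactors hp) hm').symm
  · rintro d ⟨hd0, hd⟩
    have hd0' : (0 : ℝ) < d := by exact_mod_cast hd0
    rw [zero_div, sub_zero]
    have e : ∀ l : ℕ, ((d * l : ℕ) : ZMod q) * a = (l : ZMod q) * ((d : ZMod q) * a) := by
      intro l; push_cast; ring
    simp_rw [e]
    by_cases hs : 4 * Real.pi * (d * m) ≤ q
    · refine (abs_sum_modSin_le hm0' ?_ ?_ hs _).trans ?_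
      · rw [mul_left_comm, hma]; push_cast; rfl
      · exact fun h' => hdvd (Nat.Coprime.dvd_of_dvd_mul_left hd.symm h')
      · linarith
    · have h0 : 0 ≤ x / d := by positivity
      calc _ ≤ ∑ l ∈ Finset.Icc 1 ⌊x / d⌋₊, |modSin ((l : ZMod q) * ((d : ZMod q) * a))| :=
            Finset.abs_sum_le_sum_abs _ _
        _ ≤ ∑ l ∈ Finset.Icc 1 ⌊x / d⌋₊, (1 : ℝ) :=
            Finset.sum_le_sum fun _ _ => abs_modSin_le_one _
        _ = ⌊x / d⌋₊ := by simp
        _ ≤ x / d := Nat.floor_le h0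
        _ ≤ 20 * E := by
          rw [div_le_iff₀ hd0']
          push Not at hs
          have hp := Real.pi_lt_d2
          have h1 : 4 * Real.pi * (d * m) ≤ 20 * (d * m) := by
            have : (0 : ℝ) ≤ d * m := by positivity
            nlinarith
          nlinarith

/-- The pairs `(m' k, m')` contribute a sum of `sin (2 π n k / q)`, which has a positive main
term. -/
lemma le_sum_modSin_of_dvd {x : ℝ} (hx0 : 0 ≤ x) (hxq : x ≤ q) {m' k E : ℕ}
    (hk : k.Coprime q) (hm' : m'.Coprime q) (hk0 : 0 < k) (hkE : k ≤ E) :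
    q.totient * ((1 - Real.cos (2 * Real.pi * k * x / q)) / (2 * Real.pi * k)) -
      2 ^ q.primeFactors.card * (20 * E : ℝ) ≤ ∑ n ∈ coprimeUpTo q x,
      modSin ((toUnit q n * toUnit q (m' * k) * (toUnit q m')⁻¹ : (ZMod q)ˣ) : ZMod q) := by
  have hq : (0 : ℝ) < q := by exact_mod_cast NeZero.pos q
  have hk1 : (1 : ℝ) ≤ k := by exact_mod_cast hk0
  have hkE1 : (k : ℝ) ≤ E := by exact_mod_cast hkE
  have h := abs_sum_coprimeUpTo_sub_le (q := q) (NeZero.ne q) (x := x)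
    (A := q * ((1 - Real.cos (2 * Real.pi * k * x / q)) / (2 * Real.pi * k)))
    (g := fun l => modSin ((l * k : ℕ) : ZMod q)) (B := 20 * E)
    (D := fun d => 0 < d) one_pos
    (fun d hd p hp => Nat.mul_pos hd (Nat.prime_of_mem_primeFactors hp).pos) ?_
  · have e : ∑ n ∈ coprimeUpTo q x,
        modSin ((toUnit q n * toUnit q (m' * k) * (toUnit q m')⁻¹ : (ZMod q)ˣ) : ZMod q) =
        ∑ n ∈ coprimeUpTo q x, modSin ((n * k : ℕ) : ZMod q) := by
      refine Finset.sum_congr rfl fun n hn => ?_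
      rw [toUnit_mul hm' hk, mul_comm (toUnit q m'), ← mul_assoc, mul_inv_cancel_right,
        Units.val_mul, coe_toUnit (mem_coprimeUpTo.1 hn).2, coe_toUnit hk]
      push_cast; rfl
    rw [e]
    have e2 : q * ((1 - Real.cos (2 * Real.pi * k * x / q)) / (2 * Real.pi * k)) *
        (q.totient / q) =
        q.totient * ((1 - Real.cos (2 * Real.pi * k * x / q)) / (2 * Real.pi * k)) := by
      field_simp
    rw [e2] at h
    linarith [(abs_le.1 h).1]
  · intro d hd
    have hd0' : (0 : ℝ) < d := by exact_mod_cast hd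
    have hX : 0 ≤ x / d := by positivity
    have hθ : 0 < 2 * Real.pi * k * d / q := by positivity
    have h1 := abs_sum_sin_sub_le hθ hX
    have e1 : x / d * (2 * Real.pi * k * d / q) = 2 * Real.pi * k * x / q := by field_simp
    have e2 : ∀ l : ℕ, modSin ((d * l * k : ℕ) : ZMod q) =
        Real.sin (l * (2 * Real.pi * k * d / q)) := by
      intro l
      rw [modSin_natCast]
      congr 1
      push_cast
      ring
    simp_rw [e2]
    rw [e1] at h1
    have e3 : q * ((1 - Real.cos (2 * Real.pi * k * x / q)) / (2 * Real.pi * k)) / d =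
        (1 - Real.cos (2 * Real.pi * k * x / q)) / (2 * Real.pi * k * d / q) := by
      field_simp
    rw [e3]
    refine h1.trans ?_
    have h2 : 2 * Real.pi * k * x / q ≤ 2 * Real.pi * k := by
      rw [div_le_iff₀ hq]
      gcongr
    have hp := Real.pi_lt_d2
    nlinarith

end Duality

/-! ### Divisors of a power as an almost invariant set -/

lemma card_divisors_pow {D : ℕ} (hD : D ≠ 0) {B : ℕ} (hB : B ≠ 0) :
    (D ^ B).divisors.card = ∏ p ∈ D.primeFactors, (B * D.factorization p + 1) := by
  rw [Nat.card_divisors (pow_ne_zero _ hD), Nat.primeFactors_pow _ hB]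
  simp [Nat.factorization_pow]

/-- Passing from the exponent `2 D` to `2 D + 1` multiplies each factor of the number of divisors
by at most `exp (1 / (2 D))`, and there are at most `D` factors. -/
lemma card_divisors_pow_succ_le {D : ℕ} (hD : D ≠ 0) :
    ((D ^ (2 * D + 1)).divisors.card : ℝ) ≤ 2 * (D ^ (2 * D)).divisors.card := by
  have hD' : (0 : ℝ) < D := by exact_mod_cast Nat.pos_of_ne_zero hD
  rw [card_divisors_pow hD (by omega), card_divisors_pow hD (by omega)]
  push_cast
  have hcard : (D.primeFactors.card : ℝ) ≤ D := by
    have h1 : D.primeFactors ⊆ Finset.Icc 1 D := fun p hp => Finset.mem_Icc.2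
      ⟨(Nat.prime_of_mem_primeFactors hp).one_le, Nat.le_of_mem_primeFactors hp⟩
    have h2 := Finset.card_le_card h1
    rw [Nat.card_Icc, Nat.add_sub_cancel] at h2
    exact_mod_cast h2
  calc ∏ p ∈ D.primeFactors, ((2 * (D : ℝ) + 1) * D.factorization p + 1)
      ≤ ∏ p ∈ D.primeFactors,
        (Real.exp (1 / (2 * D)) * (2 * (D : ℝ) * D.factorization p + 1)) := by
        refine Finset.prod_le_prod (fun _ _ => by positivity) fun p _ => ?_
        have h1 := Real.add_one_le_exp (1 / (2 * (D : ℝ)))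
        have h2 : (0 : ℝ) ≤ 2 * (D : ℝ) * D.factorization p + 1 := by positivity
        calc _ ≤ (1 / (2 * (D : ℝ)) + 1) * (2 * (D : ℝ) * D.factorization p + 1) := by
              have h3 : (1 / (2 * (D : ℝ)) + 1) * (2 * (D : ℝ) * D.factorization p + 1) =
                ((2 * (D : ℝ) + 1) * D.factorization p + 1) + 1 / (2 * D) := by
                field_simp; ring
              rw [h3]
              have : 0 ≤ 1 / (2 * (D : ℝ)) := by positivity
              linarith
          _ ≤ _ := by gcongr
    _ = Real.exp (D.primeFactors.card * (1 / (2 * D))) *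
        ∏ p ∈ D.primeFactors, (2 * (D : ℝ) * D.factorization p + 1) := by
        rw [Finset.prod_mul_distrib, Finset.prod_const, ← Real.exp_nat_mul]
    _ ≤ 2 * ∏ p ∈ D.primeFactors, (2 * (D : ℝ) * D.factorization p + 1) := by
        refine mul_le_mul_of_nonneg_right ?_ (Finset.prod_nonneg fun _ _ => by positivity)
        have h1 : D.primeFactors.card * (1 / (2 * (D : ℝ))) ≤ 1 / 2 := by
          rw [mul_one_div, div_le_iff₀ (by positivity)]
          linarith
        calc _ ≤ Real.exp (1 / 2) := Real.exp_le_exp.2 h1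
          _ ≤ 2 := by
            have h2 : Real.exp (1 / 2) * Real.exp (1 / 2) = Real.exp 1 := by
              rw [← Real.exp_add]; norm_num
            nlinarith [Real.exp_one_lt_d9, Real.exp_pos (1 / 2 : ℝ)]

/-- The divisors of a high power of `D` are almost invariant under multiplication by a divisor
of `D`. -/
lemma half_card_divisors_le {D k : ℕ} (hD : D ≠ 0) (hk : k ∣ D) :
    ((D ^ (2 * D + 1)).divisors.card : ℝ) / 2 ≤
      ((D ^ (2 * D + 1)).divisors.filter fun m => m * k ∈ (D ^ (2 * D + 1)).divisors).card := by
  have h1 : (D ^ (2 * D)).divisors ⊆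
      (D ^ (2 * D + 1)).divisors.filter fun m => m * k ∈ (D ^ (2 * D + 1)).divisors := by
    intro m hm
    have hm' := Nat.dvd_of_mem_divisors hm
    rw [Finset.mem_filter, Nat.mem_divisors, Nat.mem_divisors]
    refine ⟨⟨hm'.trans (pow_dvd_pow _ (by omega)), pow_ne_zero _ hD⟩, ?_, pow_ne_zero _ hD⟩
    rw [pow_succ]
    exact mul_dvd_mul hm' hk
  have h2 : ((D ^ (2 * D)).divisors.card : ℝ) ≤ _ := Nat.cast_le.2 (Finset.card_le_card h1)
  linarith [card_divisors_pow_succ_le hD]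

/-- The duality bound for the set `M` of divisors of `D ^ (2 D + 1)`: for every divisor `k` of
`D`, at least half of the `m' ∈ M` have `m' k ∈ M`, and only these pairs matter. -/
lemma Delta_mul_sqrt_ge {q : ℕ} [NeZero q] {x : ℝ} (hx0 : 0 ≤ x) (hxq : x ≤ q) {D : ℕ}
    (hD : D.Coprime q) (hD0 : D ≠ 0) (hq : 2 * D ^ (2 * D + 1) < q) {K : Finset ℕ}
    (hK : ∀ k ∈ K, k ∣ D) :
    q.totient / 2 * ∑ k ∈ K, (1 - Real.cos (2 * Real.pi * k * x / q)) / (2 * Real.pi * k) -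
      2 ^ q.primeFactors.card * (20 * ((D ^ (2 * D + 1) : ℕ) : ℝ) ^ 2) ≤
      Delta x q * Real.sqrt (q / 2) := by
  classical
  set E := D ^ (2 * D + 1) with hE
  -- every bound below carries a factor `|M|`, which cancels at the end
  have hE0 : E ≠ 0 := pow_ne_zero _ hD0
  have hEq : E.Coprime q := Nat.Coprime.pow_left _ hD
  set M := E.divisors with hMdef
  have hM : ∀ m ∈ M, m.Coprime q ∧ m < q := fun m hm =>
    ⟨Nat.Coprime.coprime_dvd_left (Nat.dvd_of_mem_divisors hm) hEq,
      lt_of_le_of_lt (Nat.divisor_le hm) (by omega)⟩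
  have hMpos : (0 : ℝ) < M.card := by
    have : 0 < M.card := Finset.card_pos.2 ⟨1, Nat.one_mem_divisors.2 hE0⟩
    exact_mod_cast this
  have hq0 : (0 : ℝ) < q := by exact_mod_cast NeZero.pos q
  set B : ℝ := 2 ^ q.primeFactors.card * (20 * E : ℝ) with hB
  set G : ℕ → ℝ := fun k => (1 - Real.cos (2 * Real.pi * k * x / q)) / (2 * Real.pi * k) with hG
  have hG0 : ∀ k, 0 ≤ G k := fun k =>
    div_nonneg (by linarith [Real.cos_le_one (2 * Real.pi * k * x / q)]) (by positivity)
  have h1 := sum_pairs_modSin_le (q := q) x hM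
  have h2 : Real.sqrt M.card * Real.sqrt
      (∑ g : (ZMod q)ˣ, (∑ m ∈ M, modSin ((g * (toUnit q m)⁻¹ : (ZMod q)ˣ) : ZMod q)) ^ 2) ≤
      M.card * Real.sqrt (q / 2) := by
    calc _ ≤ Real.sqrt M.card * Real.sqrt (q / 2 * M.card) := by
          gcongr
          exact sum_sq_divisors_modSin_le hEq hq
      _ = _ := by
          rw [Real.sqrt_mul (by positivity), mul_left_comm, Real.mul_self_sqrt hMpos.le, mul_comm]
  -- for a fixed `m'`, the pairs `(m' k, m')` contribute and all others lose at most `B`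
  have h3 : ∀ m' ∈ M, ∑ k ∈ K.filter (fun k => m' * k ∈ M), q.totient * G k - M.card * B ≤
      ∑ m ∈ M, ∑ n ∈ coprimeUpTo q x,
        modSin ((toUnit q n * toUnit q m * (toUnit q m')⁻¹ : (ZMod q)ˣ) : ZMod q) := by
    intro m' hm'
    have hm'0 := Nat.pos_of_mem_divisors hm'
    set S := (K.filter (fun k => m' * k ∈ M)).image (fun k => m' * k) with hS
    have hSM : S ⊆ M := by
      intro a ha
      obtain ⟨k, hk, rfl⟩ := Finset.mem_image.1 ha
      exact (Finset.mem_filter.1 hk).2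
    have hinj : Set.InjOn (fun k => m' * k) (K.filter (fun k => m' * k ∈ M)) :=
      fun a _ b _ h => Nat.eq_of_mul_eq_mul_left hm'0 h
    have h4 : ∑ k ∈ K.filter (fun k => m' * k ∈ M), q.totient * G k =
        ∑ m ∈ M, if m ∈ S then q.totient * G (m / m') else 0 := by
      rw [Finset.sum_ite_mem, Finset.inter_eq_right.2 hSM, hS, Finset.sum_image hinj]
      refine Finset.sum_congr rfl fun k _ => ?_
      rw [Nat.mul_div_cancel_left _ hm'0]
    have h5 : (M.card : ℝ) * B = ∑ m ∈ M, B := by simp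
    rw [h4, h5, ← Finset.sum_sub_distrib]
    refine Finset.sum_le_sum fun m hm => ?_
    have hm0 := Nat.pos_of_mem_divisors hm
    by_cases hdvd : m' ∣ m
    · obtain ⟨k, rfl⟩ := hdvd
      have hkm : k ∣ m' * k := dvd_mul_left _ _
      have hk0 : 0 < k := Nat.pos_of_dvd_of_pos hkm hm0
      have hkE : k ≤ E := (Nat.le_of_dvd hm0 hkm).trans (Nat.divisor_le hm)
      have h6 := le_sum_modSin_of_dvd (q := q) hx0 hxq (m' := m')
        (Nat.Coprime.coprime_dvd_left hkm (hM _ hm).1) (hM m' hm').1 hk0 hkE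
      refine le_trans ?_ h6
      rw [Nat.mul_div_cancel_left _ hm'0]
      have : 0 ≤ q.totient * G k := mul_nonneg (by positivity) (hG0 k)
      split_ifs
      · exact le_rfl
      · simp only [hG, hB] at this ⊢
        linarith
    · have h6 := neg_le_sum_modSin_of_not_dvd (q := q) hx0 hxq (hM m hm).1 (hM m' hm').1 hm0 hm'0
        (Nat.divisor_le hm) (Nat.divisor_le hm') hdvd
      rw [if_neg, zero_sub]
      · exact h6
      · intro h
        obtain ⟨k, _, hk⟩ := Finset.mem_image.1 h
        exact hdvd ⟨k, hk.symm⟩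
  have h4 : M.card * (q.totient / 2 * ∑ k ∈ K, G k) ≤
      ∑ m' ∈ M, ∑ k ∈ K.filter (fun k => m' * k ∈ M), q.totient * G k := by
    simp_rw [Finset.sum_filter]
    rw [Finset.sum_comm, Finset.mul_sum, Finset.mul_sum]
    refine Finset.sum_le_sum fun k hk => ?_
    rw [← Finset.sum_filter, Finset.sum_const, nsmul_eq_mul]
    have h5 := half_card_divisors_le hD0 (hK k hk)
    have h6 : 0 ≤ q.totient * G k := mul_nonneg (by positivity) (hG0 k)
    calc (M.card : ℝ) * (q.totient / 2 * G k) = M.card / 2 * (q.totient * G k) := by ring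
      _ ≤ _ := mul_le_mul_of_nonneg_right h5 h6
  have h5 := Finset.sum_le_sum h3
  rw [Finset.sum_sub_distrib, Finset.sum_comm (s := M) (t := M)] at h5
  simp only [Finset.sum_const, nsmul_eq_mul] at h5
  have hcardE : (M.card : ℝ) ≤ E := by exact_mod_cast Nat.card_divisors_le_self E
  have hBle : M.card * B ≤ 2 ^ q.primeFactors.card * (20 * (E : ℝ) ^ 2) := by
    rw [hB]
    calc _ ≤ (E : ℝ) * (2 ^ q.primeFactors.card * (20 * E : ℝ)) := by gcongr
      _ = _ := by ring
  have h6 : M.card * (q.totient / 2 * ∑ k ∈ K, G k - 2 ^ q.primeFactors.card * (20 * (E : ℝ) ^ 2)) ≤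
      M.card * (Delta x q * Real.sqrt (q / 2)) := by
    calc _ ≤ M.card * (q.totient / 2 * ∑ k ∈ K, G k) - M.card * (M.card * B) := by
          rw [mul_sub]; gcongr
      _ ≤ Delta x q * (M.card * Real.sqrt (q / 2)) := by
          have := mul_le_mul_of_nonneg_left h2 (Delta_nonneg (q := q) x)
          linarith
      _ = _ := by ring
  exact le_of_mul_le_mul_left h6 hMpos

/-- For `q / x` in a bounded range, `Δ(x, q)` is bounded below by the sum that arises from
integers `k ≤ Y` prime to `q`, up to an error that does not grow with `q`. -/
lemma exists_Delta_mul_sqrt_ge (Y : ℕ) : ∃ C : ℝ, ∀ (q : ℕ) (x : ℝ), C < q → 0 ≤ x → x ≤ q →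
    q.totient / 2 * ∑ k ∈ coprimeUpTo q Y,
      (1 - Real.cos (2 * Real.pi * k * x / q)) / (2 * Real.pi * k) -
      2 ^ q.primeFactors.card * C ≤ Delta x q * Real.sqrt (q / 2) := by
  set F := Y.factorial with hF
  refine ⟨20 * ((F ^ (2 * F + 1) : ℕ) : ℝ) ^ 2, fun q x hq hx0 hxq => ?_⟩
  have hF1 : 1 ≤ F := Nat.factorial_pos _
  have hone : 1 ≤ F ^ (2 * F + 1) := Nat.one_le_pow _ _ hF1
  have hone' : (1 : ℝ) ≤ ((F ^ (2 * F + 1) : ℕ) : ℝ) := by exact_mod_cast hone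
  have hq' : 2 * F ^ (2 * F + 1) < q := by
    have : (2 : ℝ) * ((F ^ (2 * F + 1) : ℕ) : ℝ) < q := by nlinarith
    exact_mod_cast this
  have : NeZero q := ⟨by omega⟩
  set D := ∏ k ∈ coprimeUpTo q Y, k with hD
  have hDq : D.Coprime q := Nat.Coprime.prod_left fun k hk => (mem_coprimeUpTo.1 hk).2
  have hD0 : D ≠ 0 := by
    rw [hD, Finset.prod_ne_zero_iff]
    intro k hk
    have := (mem_coprimeUpTo.1 hk).1.1
    omega
  have hDF : D ≤ F := by
    rw [hF, ← Finset.prod_Ico_id_eq_factorial, Finset.Ico_add_one_right_eq_Icc]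
    refine Nat.le_of_dvd (Finset.prod_pos fun i hi => (Finset.mem_Icc.1 hi).1) ?_
    refine Finset.prod_dvd_prod_of_subset _ _ _ ?_
    unfold coprimeUpTo
    rw [Nat.floor_natCast]
    exact Finset.filter_subset _ _
  have hpow : D ^ (2 * D + 1) ≤ F ^ (2 * F + 1) :=
    (Nat.pow_le_pow_left hDF _).trans (Nat.pow_le_pow_right hF1 (by omega))
  have h := Delta_mul_sqrt_ge hx0 hxq hDq hD0 (by omega) (K := coprimeUpTo q Y)
    fun k hk => Finset.dvd_prod_of_mem _ hk
  refine le_trans ?_ h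
  gcongr

/-! ### The bound for bounded `q / x` -/

/-- All the iterated logarithms in `scriptL y` are positive beyond `16`. -/
lemma one_lt_log_log {y : ℝ} (hy : 16 < y) : 1 < Real.log (Real.log y) := by
  have h1 : Real.log 16 < Real.log y := Real.log_lt_log (by norm_num) hy
  have h2 : Real.log 16 = 4 * Real.log 2 := by
    rw [show (16 : ℝ) = 2 ^ (4 : ℕ) by norm_num, Real.log_pow]; norm_num
  have h3 : Real.exp 1 < Real.log y := by
    linarith [Real.log_two_gt_d9, Real.exp_one_lt_d9]
  rwa [Real.lt_log_iff_exp_lt (by linarith [Real.exp_pos 1])]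

/-- A crude bound by a small power of `y`, enough when `q / x` is bounded. -/
lemma scriptL_rpow_le {y : ℝ} (hy : 16 < y) :
    scriptL y ^ Real.sqrt 2 ≤ Real.exp (Real.log y / 10 + 5) := by
  have hl := one_lt_log_log hy
  have hu : 0 < Real.log y := Real.log_pos (by linarith)
  have h1 : Real.log y * Real.log (Real.log (Real.log y)) / Real.log (Real.log y) ≤
      Real.log y := by
    rw [div_le_iff₀ (by linarith)]
    gcongr
    exact (Real.log_le_sub_one_of_pos (by linarith)).trans (by linarith)
  unfold scriptL
  rw [← Real.exp_mul]
  refine Real.exp_le_exp.2 ?_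
  have h2 := Real.sqrt_le_sqrt h1
  have h3 : Real.sqrt (Real.log y) * Real.sqrt 2 ≤ Real.log y / 10 + 5 := by
    rw [← Real.sqrt_mul hu.le, Real.sqrt_le_left (by positivity)]
    nlinarith [sq_nonneg (Real.log y / 10 - 5)]
  exact (mul_le_mul_of_nonneg_right h2 (Real.sqrt_nonneg _)).trans h3

/-- Since `log 2 < 7 / 10`, inclusion–exclusion over at most `log y` primes costs a power of `y`
smaller than `1`. -/
lemma two_pow_le_exp {n : ℕ} {u : ℝ} (h : (n : ℝ) ≤ u) :
    (2 : ℝ) ^ n ≤ Real.exp (7 / 10 * u) := by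
  rw [← Real.rpow_natCast, Real.rpow_def_of_pos (by norm_num)]
  refine Real.exp_le_exp.2 ?_
  have h1 := Real.log_two_lt_d9
  have h2 := Real.log_two_gt_d9
  have h3 : (0 : ℝ) ≤ n := Nat.cast_nonneg n
  nlinarith

/-- The main term of the duality bound, uniformly in `y = q / x`. For large `y` the integers `k`
between `y / 4` and `3 y / 4` that are prime to `q` give at least a constant times `1 / log y ^
2`, more than `y ^ (-2 / 5)`; for bounded `y` the term `k = 1` suffices. -/
lemma exists_le_totient_div_mul_sum : ∃ c : ℝ, 0 < c ∧ ∀ (q : ℕ) (y Y : ℝ), q ≠ 0 → 16 < y →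
    y ≤ Y → (q.primeFactors.card : ℝ) ≤ Real.log y →
    c * Real.exp (-(2 / 5 * Real.log y)) ≤ (q.totient : ℝ) / q * ∑ k ∈ coprimeUpTo q Y,
      (1 - Real.cos (2 * Real.pi * k / y)) / (2 * Real.pi * k) := by
  refine ⟨Real.exp (-6000) / 3001, by positivity, fun q y Y hq hy hY hω => ?_⟩
  set u := Real.log y with hu
  have hy0 : 0 < y := by linarith
  have hye : y = Real.exp u := (Real.exp_log hy0).symm
  have hu0 : 0 < u := Real.log_pos (by linarith)
  have hφ : 1 / (u + 1) ≤ (q.totient : ℝ) / q :=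
    (one_div_le_one_div_of_le (Nat.cast_add_one_pos _) (by linarith)).trans
      (inv_card_add_one_le_totient_div hq)
  have hφ1 : 0 ≤ (q.totient : ℝ) / q := by positivity
  have hG0 : ∀ k : ℕ, 0 ≤ (1 - Real.cos (2 * Real.pi * k / y)) / (2 * Real.pi * k) := fun k =>
    div_nonneg (by linarith [Real.cos_le_one (2 * Real.pi * k / y)]) (by positivity)
  have hpi := Real.pi_pos
  have hpi3 := Real.pi_lt_d2
  rcases le_or_gt 3000 u with h | h
  · -- many `k` of size about `y / 2`
    set S := coprimeUpTo q (3 / 4 * y) \ coprimeUpTo q (1 / 4 * y) with hS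
    have hsub : S ⊆ coprimeUpTo q Y := by
      intro k hk
      rw [hS, Finset.mem_sdiff, mem_coprimeUpTo] at hk
      rw [mem_coprimeUpTo]
      exact ⟨⟨hk.1.1.1, by linarith [hk.1.1.2]⟩, hk.1.2⟩
    have hG : ∀ k ∈ S, 1 / (2 * Real.pi * y) ≤
        (1 - Real.cos (2 * Real.pi * k / y)) / (2 * Real.pi * k) := by
      intro k hk
      rw [hS, Finset.mem_sdiff, mem_coprimeUpTo, mem_coprimeUpTo] at hk
      obtain ⟨⟨⟨hk1, hk2⟩, hk3⟩, hk4⟩ := hk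
      have hk5 : 1 / 4 * y < k := by
        by_contra h'
        exact hk4 ⟨⟨hk1, not_lt.1 h'⟩, hk3⟩
      have hk6 : (0 : ℝ) < k := by exact_mod_cast hk1
      have hcos : Real.cos (2 * Real.pi * k / y) ≤ 0 := by
        apply Real.cos_nonpos_of_pi_div_two_le_of_le
        · rw [le_div_iff₀ hy0]; nlinarith
        · rw [div_le_iff₀ hy0]; nlinarith
      have hky : (k : ℝ) ≤ y := by linarith
      have hcos' : 1 ≤ 1 - Real.cos (2 * Real.pi * k / y) := by linarith
      gcongr
    have hcard : y / 2 * (q.totient / q) - 2 * Real.exp (7 / 10 * u) ≤ (S.card : ℝ) := by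
      have h1 := abs_le.1 (abs_card_coprimeUpTo_sub_le hq (x := 3 / 4 * y) (by positivity))
      have h2 := abs_le.1 (abs_card_coprimeUpTo_sub_le hq (x := 1 / 4 * y) (by positivity))
      have h3 : ((coprimeUpTo q (3 / 4 * y)).card : ℝ) ≤
          S.card + (coprimeUpTo q (1 / 4 * y)).card := by
        have := Finset.card_le_card_sdiff_add_card (s := coprimeUpTo q (3 / 4 * y))
          (t := coprimeUpTo q (1 / 4 * y))
        exact_mod_cast this
      have h4 := two_pow_le_exp hω
      linarith [h1.1, h2.2]
    have e1 : 8 * (u + 1) ≤ Real.exp (3 / 10 * u) := by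
      have := Real.pow_div_factorial_le_exp (3 / 10 * u) (by positivity) 2
      norm_num [Nat.factorial] at this
      nlinarith
    have e2 : 8 * Real.pi * (u + 1) ^ 2 ≤ Real.exp (2 / 5 * u) := by
      have := Real.pow_div_factorial_le_exp (2 / 5 * u) (by positivity) 3
      norm_num [Nat.factorial] at this
      have h1 : 8 * Real.pi * (u + 1) ^ 2 ≤ 26 * (u + 1) ^ 2 := by gcongr; linarith
      have h2 : 26 * (u + 1) ^ 2 ≤ 30 * u ^ 2 := by nlinarith
      have h3 : 30 * u ^ 2 ≤ (2 / 5 * u) ^ 3 / 6 := by nlinarith [sq_nonneg u]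
      linarith
    have hcard' : y / (4 * (u + 1)) ≤ S.card := by
      have h1 : y / 2 * (1 / (u + 1)) ≤ y / 2 * (q.totient / q) := by gcongr
      have h2 : 2 * Real.exp (7 / 10 * u) ≤ y / (4 * (u + 1)) := by
        rw [le_div_iff₀ (by positivity), hye]
        have : Real.exp u = Real.exp (7 / 10 * u) * Real.exp (3 / 10 * u) := by
          rw [← Real.exp_add]; ring_nf
        rw [this]
        nlinarith [Real.exp_pos (7 / 10 * u)]
      have h3 : y / 2 * (1 / (u + 1)) = y / (4 * (u + 1)) + y / (4 * (u + 1)) := by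
        field_simp; norm_num
      linarith
    calc Real.exp (-6000) / 3001 * Real.exp (-(2 / 5 * u)) ≤ 1 * Real.exp (-(2 / 5 * u)) := by
          gcongr
          rw [div_le_one (by norm_num)]
          exact (Real.exp_le_one_iff.2 (show (-6000 : ℝ) ≤ 0 by linarith)).trans (by norm_num)
      _ ≤ 1 / (8 * Real.pi * (u + 1) ^ 2) := by
          rw [one_mul, Real.exp_neg, inv_eq_one_div]
          gcongr
      _ = 1 / (u + 1) * (y / (4 * (u + 1)) * (1 / (2 * Real.pi * y))) := by
          field_simp; norm_num
      _ ≤ (q.totient : ℝ) / q * (S.card * (1 / (2 * Real.pi * y))) := by gcongr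
      _ ≤ (q.totient : ℝ) / q * ∑ k ∈ S,
          (1 - Real.cos (2 * Real.pi * k / y)) / (2 * Real.pi * k) := by
          gcongr
          rw [← nsmul_eq_mul, ← Finset.sum_const]
          exact Finset.sum_le_sum hG
      _ ≤ _ := by
          refine mul_le_mul_of_nonneg_left ?_ hφ1
          exact Finset.sum_le_sum_of_subset_of_nonneg hsub fun k _ _ => hG0 k
  · -- the term `k = 1` is enough for bounded `y`
    have h1 : 1 ∈ coprimeUpTo q Y :=
      mem_coprimeUpTo.2 ⟨⟨le_rfl, by push_cast; linarith⟩, Nat.coprime_one_left q⟩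
    have h2 := Finset.single_le_sum (f := fun k : ℕ =>
      (1 - Real.cos (2 * Real.pi * k / y)) / (2 * Real.pi * k)) (fun k _ => hG0 k) h1
    simp only [Nat.cast_one, mul_one] at h2
    have h3 : Real.cos (2 * Real.pi / y) ≤ 1 - 2 / Real.pi ^ 2 * (2 * Real.pi / y) ^ 2 := by
      apply Real.cos_le_one_sub_mul_cos_sq
      rw [abs_of_nonneg (by positivity), div_le_iff₀ hy0]
      nlinarith
    have h4 : 1 / y ^ 2 ≤ (1 - Real.cos (2 * Real.pi / y)) / (2 * Real.pi) := by
      rw [le_div_iff₀ (by positivity)]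
      have : 2 / Real.pi ^ 2 * (2 * Real.pi / y) ^ 2 = 8 * (1 / y ^ 2) := by
        field_simp; norm_num
      have h5 : 0 ≤ 1 / y ^ 2 := by positivity
      nlinarith
    have h5 : Real.exp (-6000) ≤ 1 / y ^ 2 := by
      rw [hye, ← Real.exp_nat_mul, one_div, ← Real.exp_neg]
      apply Real.exp_le_exp.2
      push_cast
      linarith
    calc Real.exp (-6000) / 3001 * Real.exp (-(2 / 5 * u)) ≤ Real.exp (-6000) / 3001 * 1 := by
          gcongr
          exact Real.exp_le_one_iff.2 (by linarith)
      _ = 1 / 3001 * Real.exp (-6000) := by ring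
      _ ≤ 1 / (u + 1) * (1 / y ^ 2) := by gcongr; linarith
      _ ≤ _ := by gcongr; exact h4.trans h2

/-- The lower bound for `q / x` in a bounded range, with a constant independent of the range. -/
theorem Delta_lower_bound_of_le {ε : ℝ} (hε : 0 < ε) : ∃ c : ℝ, 0 < c ∧ ∀ Y : ℝ,
    ∀ᶠ q : ℕ in atTop, ∀ x : ℝ,
      x ≤ (q : ℝ) / Real.exp ((1 + ε) * (q.primeFactors.card : ℝ)) →
      16 < (q : ℝ) / x → (q : ℝ) / x ≤ Y →
      c * (Real.sqrt x * scriptL ((q : ℝ) / x) ^ Real.sqrt 2) ≤ Delta x q := by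
  obtain ⟨c, hc, hsum⟩ := exists_le_totient_div_mul_sum
  refine ⟨c / (4 * Real.exp 5), by positivity, fun Y => ?_⟩
  set N := ⌈max Y 16⌉₊ with hN
  have hYN : max Y 16 ≤ N := Nat.le_ceil _
  have hN16 : (16 : ℝ) ≤ N := (le_max_right _ _).trans hYN
  obtain ⟨C, hC⟩ := exists_Delta_mul_sqrt_ge N
  set R : ℝ := 4 / c * Real.exp (2 / 5 * Real.log N) * (Real.exp (7 / 10 * Real.log N) * |C|)
    with hR
  filter_upwards [tendsto_natCast_atTop_atTop.eventually_gt_atTop C, eventually_gt_atTop 0,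
    tendsto_natCast_atTop_atTop.eventually_ge_atTop R] with q hqC hq0 hqR x hx hy hyY
  have hq : (0 : ℝ) < q := by exact_mod_cast hq0
  have hx0 : 0 < x := by
    by_contra h
    have := div_nonpos_of_nonneg_of_nonpos hq.le (not_lt.1 h)
    linarith
  set y := (q : ℝ) / x with hydef
  set u := Real.log y with hu
  have hy0 : 0 < y := by linarith
  have hye : Real.exp u = y := Real.exp_log hy0
  have hu0 : 0 < u := Real.log_pos (by linarith)
  have hqxy : (q : ℝ) = x * y := by rw [hydef]; field_simp
  have hω : (q.primeFactors.card : ℝ) ≤ u := by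
    rw [le_div_iff₀ (Real.exp_pos _), mul_comm, ← le_div_iff₀ hx0, ← hydef, ← hye,
      Real.exp_le_exp] at hx
    have : (0 : ℝ) ≤ q.primeFactors.card := Nat.cast_nonneg _
    nlinarith
  have hyN : y ≤ N := hyY.trans ((le_max_left _ _).trans hYN)
  have huN : u ≤ Real.log N := Real.log_le_log hy0 hyN
  have h1 := hC q x hqC hx0.le (by nlinarith)
  have h2 := hsum q y N (by omega) hy hyN hω
  have e : ∀ k : ℕ, 2 * Real.pi * k * x / q = 2 * Real.pi * k / y := by
    intro k; rw [hydef]; field_simp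
  simp_rw [e] at h1
  set T := ∑ k ∈ coprimeUpTo q N, (1 - Real.cos (2 * Real.pi * k / y)) / (2 * Real.pi * k)
  have h3 : (q.totient : ℝ) / 2 * T = q / 2 * (q.totient / q * T) := by field_simp
  rw [h3] at h1
  have h4 : 2 ^ q.primeFactors.card * C ≤ q / 4 * (c * Real.exp (-(2 / 5 * u))) := by
    calc 2 ^ q.primeFactors.card * C ≤ Real.exp (7 / 10 * Real.log N) * |C| := by
          refine (mul_le_mul_of_nonneg_left (le_abs_self C) (by positivity)).trans ?_
          gcongr
          exact two_pow_le_exp (hω.trans huN)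
      _ = R / 4 * (c * Real.exp (-(2 / 5 * Real.log N))) := by
          rw [hR, Real.exp_neg]; field_simp
      _ ≤ _ := by gcongr
  have h5 : q / 4 * (c * Real.exp (-(2 / 5 * u))) ≤ Delta x q * Real.sqrt (q / 2) := by
    have := mul_le_mul_of_nonneg_left h2 (show (0 : ℝ) ≤ q / 2 by positivity)
    linarith
  have h6 : Delta x q * Real.sqrt (q / 2) ≤ Delta x q * Real.sqrt q := by
    gcongr
    · exact Delta_nonneg x
    · linarith
  have h7 : Real.sqrt q * (c / 4 * (Real.sqrt q * Real.exp (-(2 / 5 * u)))) ≤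
      Real.sqrt q * Delta x q := by
    have : Real.sqrt q * Real.sqrt q = q := Real.mul_self_sqrt hq.le
    calc _ = Real.sqrt q * Real.sqrt q / 4 * (c * Real.exp (-(2 / 5 * u))) := by ring
      _ ≤ _ := by rw [this]; linarith
  have h8 := le_of_mul_le_mul_left h7 (Real.sqrt_pos.2 hq)
  refine le_trans ?_ h8
  have h9 : Real.sqrt q = Real.sqrt x * Real.exp (u / 2) := by
    rw [hqxy, Real.sqrt_mul hx0.le, ← hye, Real.exp_half]
  calc c / (4 * Real.exp 5) * (Real.sqrt x * scriptL y ^ Real.sqrt 2)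
      ≤ c / (4 * Real.exp 5) * (Real.sqrt x * Real.exp (u / 10 + 5)) := by
        gcongr
        exact scriptL_rpow_le hy
    _ = c / 4 * (Real.sqrt x * Real.exp (u / 10)) := by
        rw [Real.exp_add]; field_simp
    _ = c / 4 * (Real.sqrt q * Real.exp (-(2 / 5 * u))) := by
        rw [h9, mul_assoc (Real.sqrt x), ← Real.exp_add]; ring_nf

/-! ### Mertens' theorem -/

lemma log_factorial_eq_sum (N : ℕ) : Real.log (N.factorial : ℕ) =
    ∑ p ∈ Nat.primesLE N, (N.factorial.factorization p : ℝ) * Real.log p := by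
  rw [Real.log_nat_eq_sum_factorization, Finsupp.sum]
  refine Finset.sum_subset (fun p hp => ?_) fun p _ hp => ?_
  · rw [Nat.support_factorization] at hp
    have hpp := Nat.prime_of_mem_primeFactors hp
    exact Nat.mem_primesLE.2 ⟨(hpp.dvd_factorial).1 (Nat.dvd_of_mem_primeFactors hp), hpp⟩
  · rw [Finsupp.notMem_support_iff] at hp
    simp [hp]

/-- The contribution of the higher prime powers to `log N!`, by telescoping. -/
lemma sum_log_div_mul_pred_le (N : ℕ) :
    ∑ n ∈ Finset.Icc 2 N, Real.log n / (n * (n - 1)) ≤ 2 := by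
  have h : ∀ N : ℕ, 1 ≤ N →
      ∑ n ∈ Finset.Icc 2 N, Real.log n / (n * (n - 1)) ≤ 2 - (Real.log N + 2) / N := by
    intro N hN
    induction N, hN using Nat.le_induction with
    | base => simp
    | succ N hN ih =>
      rw [Finset.sum_Icc_succ_top (by omega)]
      have hN0 : (1 : ℝ) ≤ N := by exact_mod_cast hN
      have hlog : Real.log ((N : ℝ) + 1) ≤ Real.log N + 1 / N := by
        have h1 := Real.log_le_sub_one_of_pos (show (0 : ℝ) < (N + 1) / N by positivity)
        rw [Real.log_div (by positivity) (by positivity)] at h1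
        have h2 : ((N : ℝ) + 1) / N - 1 = 1 / N := by field_simp; ring
        linarith
      have h3 : (0 : ℝ) < N * (N + 1) := by positivity
      have key : Real.log ((N : ℝ) + 1) / ((N + 1) * N) ≤
          (Real.log N + 2) / N - (Real.log ((N : ℝ) + 1) + 2) / (N + 1) := by
        have e : (Real.log N + 2) / N - (Real.log ((N : ℝ) + 1) + 2) / (N + 1) =
            ((N + 1) * (Real.log N + 2) - N * (Real.log ((N : ℝ) + 1) + 2)) / ((N + 1) * N) := by
          field_simp
        rw [e]
        gcongr
        have h4 : ((N : ℝ) + 1) * (1 / N) ≤ 2 := by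
          rw [mul_one_div, div_le_iff₀ (by positivity)]; linarith
        nlinarith
      push_cast
      have e2 : ((N : ℝ) + 1 - 1) = N := by ring
      rw [e2]
      linarith
  rcases Nat.lt_or_ge N 1 with h0 | h0
  · have : N = 0 := by omega
    subst this
    simp
  · have h1 := h N h0
    have : 0 ≤ (Real.log N + 2) / N :=
      div_nonneg (by linarith [Real.log_natCast_nonneg N]) (Nat.cast_nonneg _)
    linarith

/-- The lower bound in Mertens' first theorem, from `log N! ≥ N (log N - 1)` and Legendre's
formula. -/
lemma log_sub_three_le_sum_log_div {N : ℕ} (hN : 1 ≤ N) :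
    Real.log N - 3 ≤ ∑ p ∈ Nat.primesLE N, Real.log p / p := by
  have hN0 : (0 : ℝ) < N := by exact_mod_cast hN
  have h1 : N * (Real.log N - 1) ≤ Real.log (N.factorial : ℕ) := by
    have h := Real.pow_div_factorial_le_exp (N : ℝ) hN0.le N
    have hf : (0 : ℝ) < (N.factorial : ℕ) := by exact_mod_cast Nat.factorial_pos N
    have h2 := Real.log_le_log (by positivity) h
    rw [Real.log_exp, Real.log_div (by positivity) hf.ne', Real.log_pow] at h2
    linarith
  have h2 : Real.log (N.factorial : ℕ) ≤
      N * ∑ p ∈ Nat.primesLE N, (Real.log p / p + Real.log p / (p * (p - 1))) := by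
    rw [log_factorial_eq_sum, Finset.mul_sum]
    refine Finset.sum_le_sum fun p hp => ?_
    have hpp := Nat.prime_of_mem_primesLE hp
    have hp2 : (2 : ℝ) ≤ p := by exact_mod_cast hpp.two_le
    have hv := Nat.factorization_factorial_le_div_pred hpp N
    have hv' : (N.factorial.factorization p : ℝ) ≤ N / (p - 1) := by
      have h3 : ((N / (p - 1) : ℕ) : ℝ) ≤ (N : ℝ) / ((p - 1 : ℕ) : ℝ) := Nat.cast_div_le
      rw [Nat.cast_sub hpp.one_le, Nat.cast_one] at h3
      exact (Nat.cast_le.2 hv).trans h3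
    have hl : 0 ≤ Real.log p := Real.log_natCast_nonneg p
    calc _ ≤ (N : ℝ) / (p - 1) * Real.log p := by gcongr
      _ = _ := by
        have : (p : ℝ) - 1 ≠ 0 := by linarith
        field_simp; ring
  have h3 : ∑ p ∈ Nat.primesLE N, Real.log p / ((p : ℝ) * (p - 1)) ≤ 2 := by
    refine le_trans (Finset.sum_le_sum_of_subset_of_nonneg (fun p hp => ?_) fun p hp _ => ?_)
      (sum_log_div_mul_pred_le N)
    · exact Finset.mem_Icc.2 ⟨Nat.two_le_of_mem_primesLE hp, Nat.le_of_mem_primesLE hp⟩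
    · have : (2 : ℝ) ≤ p := by exact_mod_cast (Finset.mem_Icc.1 hp).1
      exact div_nonneg (Real.log_natCast_nonneg p) (by nlinarith)
  rw [Finset.sum_add_distrib] at h2
  have h4 := h1.trans (h2.trans (mul_le_mul_of_nonneg_left (add_le_add_right h3 _) hN0.le))
  have h5 := le_of_mul_le_mul_left h4 hN0
  linarith

/-- The upper bound in Mertens' first theorem, from `log N! ≤ N log N` and Chebyshev's bound. -/
lemma sum_log_div_le_log_add_two {N : ℕ} (hN : 1 ≤ N) :
    ∑ p ∈ Nat.primesLE N, Real.log p / p ≤ Real.log N + 2 := by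
  have hN0 : (0 : ℝ) < N := by exact_mod_cast hN
  have h1 : Real.log (N.factorial : ℕ) ≤ N * Real.log N := by
    rw [← Real.log_pow]
    exact Real.log_le_log (by exact_mod_cast Nat.factorial_pos N)
      (by exact_mod_cast Nat.factorial_le_pow N)
  have h2 : N * ∑ p ∈ Nat.primesLE N, Real.log p / p - Chebyshev.theta N ≤
      Real.log (N.factorial : ℕ) := by
    rw [Chebyshev.theta_eq_sum_primesLE_log, log_factorial_eq_sum, Finset.mul_sum,
      ← Finset.sum_sub_distrib]
    refine Finset.sum_le_sum fun p hp => ?_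
    have hpp := Nat.prime_of_mem_primesLE hp
    have hv : N / p ≤ N.factorial.factorization p := by
      rw [Nat.factorization_factorial hpp (Nat.lt_add_of_pos_right (n := Nat.log p N) two_pos)]
      have := Finset.single_le_sum (f := fun i => N / p ^ i) (s := Finset.Ico 1 (Nat.log p N + 2))
        (fun _ _ => Nat.zero_le _) (Finset.mem_Ico.2 ⟨le_refl 1, by omega⟩)
      simpa using this
    have hv' : (N : ℝ) / p - 1 ≤ N.factorial.factorization p := by
      have h3 : ((N / p : ℕ) : ℝ) ≤ N.factorial.factorization p := Nat.cast_le.2 hv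
      have h4 := Nat.lt_floor_add_one ((N : ℝ) / p)
      rw [Nat.floor_div_eq_div] at h4
      linarith
    have hl : 0 ≤ Real.log p := Real.log_natCast_nonneg p
    calc _ = ((N : ℝ) / p - 1) * Real.log p := by ring
      _ ≤ _ := by gcongr
  have h3 := Chebyshev.theta_le_log4_mul_x hN0.le
  have h4 : Real.log 4 ≤ 2 := by
    rw [show (4 : ℝ) = 2 ^ (2 : ℕ) by norm_num, Real.log_pow]
    push_cast
    linarith [Real.log_two_lt_d9]
  have h5 : N * ∑ p ∈ Nat.primesLE N, Real.log p / p ≤ N * (Real.log N + 2) := by nlinarith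
  exact le_of_mul_le_mul_left h5 hN0

/-- The primes `p` with `A < log p ≤ B`. -/
noncomputable def logPrimes (A B : ℝ) : Finset ℕ :=
  (Nat.primesLE ⌊Real.exp B⌋₊).filter fun p => A < Real.log p

lemma mem_logPrimes {A B : ℝ} {p : ℕ} :
    p ∈ logPrimes A B ↔ p.Prime ∧ A < Real.log p ∧ Real.log p ≤ B := by
  unfold logPrimes
  rw [Finset.mem_filter, Nat.mem_primesLE]
  constructor
  · rintro ⟨⟨h1, h2⟩, h3⟩
    rw [Nat.le_floor_iff' h2.ne_zero] at h1
    exact ⟨h2, h3, (Real.log_le_iff_le_exp (by exact_mod_cast h2.pos)).2 h1⟩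
  · rintro ⟨h2, h3, h1⟩
    refine ⟨⟨?_, h2⟩, h3⟩
    rw [Nat.le_floor_iff' h2.ne_zero]
    exact (Real.log_le_iff_le_exp (by exact_mod_cast h2.pos)).1 h1

/-- Mertens' first theorem, as a lower bound over an interval. -/
lemma sub_six_le_sum_logPrimes {A B : ℝ} (hA : 0 ≤ A) (hAB : A ≤ B) :
    B - A - 6 ≤ ∑ p ∈ logPrimes A B, Real.log p / p := by
  have hB : 0 ≤ B := hA.trans hAB
  have hfl : ∀ t : ℝ, 0 ≤ t → 1 ≤ ⌊Real.exp t⌋₊ := fun t ht =>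
    (Nat.le_floor_iff' one_ne_zero).2 (by rw [Nat.cast_one]; exact Real.one_le_exp ht)
  have h1 := log_sub_three_le_sum_log_div (hfl B hB)
  have h2 := sum_log_div_le_log_add_two (hfl A hA)
  have hA' : Real.log (⌊Real.exp A⌋₊ : ℝ) ≤ A := by
    rw [Real.log_le_iff_le_exp (by exact_mod_cast hfl A hA)]
    exact Nat.floor_le (Real.exp_pos _).le
  have hB' : B - 1 ≤ Real.log (⌊Real.exp B⌋₊ : ℝ) := by
    have h0 : (1 : ℝ) ≤ ⌊Real.exp B⌋₊ := by exact_mod_cast hfl B hB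
    rw [Real.le_log_iff_exp_le (by linarith), Real.exp_sub]
    have h3 := Nat.lt_floor_add_one (Real.exp B)
    rw [div_le_iff₀ (Real.exp_pos _)]
    nlinarith [Real.exp_one_gt_d9]
  have h3 : ∑ p ∈ Nat.primesLE ⌊Real.exp B⌋₊, Real.log p / p ≤
      ∑ p ∈ logPrimes A B, Real.log p / p + ∑ p ∈ Nat.primesLE ⌊Real.exp A⌋₊, Real.log p / p := by
    rw [← Finset.sum_filter_add_sum_filter_not (Nat.primesLE ⌊Real.exp B⌋₊)
      (fun p => A < Real.log p)]
    unfold logPrimes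
    refine add_le_add_right (Finset.sum_le_sum_of_subset_of_nonneg (fun p hp => ?_)
      fun p _ _ => div_nonneg (Real.log_natCast_nonneg p) (Nat.cast_nonneg p)) _
    · rw [Finset.mem_filter, Nat.mem_primesLE] at hp
      obtain ⟨⟨_, h5⟩, h6⟩ := hp
      rw [Nat.mem_primesLE, Nat.le_floor_iff' h5.ne_zero]
      exact ⟨(Real.log_le_iff_le_exp (by exact_mod_cast h5.pos)).1 (not_lt.1 h6), h5⟩
  linarith

/-- Summation by parts replaces the weight `1 / j` by a sum of the differences `1 / k - 1 / (k +
1)` over `k ≥ j`. -/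
lemma sum_Ico_one_div_mul_succ_le {b : ℕ} {j : ℝ} (hj : 0 < j) (a : ℕ) :
    ∑ k ∈ Finset.Ico a b, (if j ≤ k then 1 / ((k : ℝ) * (k + 1)) else 0) ≤ 1 / j := by
  set v := ⌈j⌉₊ with hv
  have hv0 : 0 < v := Nat.ceil_pos.2 hj
  have hv1 : (1 : ℝ) ≤ v := by exact_mod_cast hv0
  have hjv : j ≤ v := Nat.le_ceil j
  have h1 : ∀ b : ℕ, v ≤ b → ∑ k ∈ Finset.Ico v b, 1 / ((k : ℝ) * (k + 1)) = 1 / v - 1 / b := by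
    intro b hb
    induction b, hb using Nat.le_induction with
    | base => simp
    | succ b hb ih =>
      rw [Finset.sum_Ico_succ_top hb, ih]
      have : (b : ℝ) ≠ 0 := by
        have : 0 < b := by omega
        positivity
      push_cast
      field_simp
      ring
  rw [← Finset.sum_filter]
  have h2 : (Finset.Ico a b).filter (fun k : ℕ => j ≤ k) ⊆ Finset.Ico v (max v b) := by
    intro k hk
    rw [Finset.mem_filter, Finset.mem_Ico] at hk
    rw [Finset.mem_Ico]
    exact ⟨Nat.ceil_le.2 hk.2, lt_of_lt_of_le hk.1.2 (le_max_right _ _)⟩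
  calc _ ≤ ∑ k ∈ Finset.Ico v (max v b), 1 / ((k : ℝ) * (k + 1)) :=
        Finset.sum_le_sum_of_subset_of_nonneg h2 fun _ _ _ => by positivity
    _ = 1 / v - 1 / (max v b : ℕ) := h1 _ (le_max_left _ _)
    _ ≤ 1 / v := by
        have : (0 : ℝ) ≤ 1 / (max v b : ℕ) := by positivity
        linarith
    _ ≤ 1 / j := by gcongr

/-- The outcome of summation by parts, with the bound `k - a - 6` for the sum of `log p / p` over
`l + a < log p ≤ l + k`. -/
lemma log_div_sub_eight_le_sum {a b : ℕ} (ha : 1 ≤ a) (hab : a ≤ b) :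
    Real.log (b / a) - 8 ≤
      ∑ k ∈ Finset.Ico a b, 1 / ((k : ℝ) * (k + 1)) * (k - a - 6) := by
  have ha0 : (1 : ℝ) ≤ a := by exact_mod_cast ha
  -- each term is at least the difference of `log (k + 1) + (a + 7) / k`
  have h : ∀ b : ℕ, a ≤ b → Real.log b - Real.log a - (a + 7) / a + (a + 7) / b ≤
      ∑ k ∈ Finset.Ico a b, 1 / ((k : ℝ) * (k + 1)) * (k - a - 6) := by
    intro b hb
    induction b, hb using Nat.le_induction with
    | base => simp
    | succ b hb ih =>
      rw [Finset.sum_Ico_succ_top hb]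
      have hb0 : (1 : ℝ) ≤ b := by exact_mod_cast ha.trans hb
      have hlog : Real.log ((b : ℝ) + 1) ≤ Real.log b + 1 / b := by
        have h1 := Real.log_le_sub_one_of_pos (show (0 : ℝ) < (b + 1) / b by positivity)
        rw [Real.log_div (by positivity) (by positivity)] at h1
        have h2 : ((b : ℝ) + 1) / b - 1 = 1 / b := by field_simp; ring
        linarith
      have e : 1 / ((b : ℝ) * (b + 1)) * (b - a - 6) =
          1 / b - (a + 7) / b + (a + 7) / (b + 1) := by
        field_simp; ring
      push_cast
      linarith
  have h1 := h b hab
  have hb0 : (1 : ℝ) ≤ b := by exact_mod_cast ha.trans hab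
  rw [Real.log_div (by positivity) (by positivity)]
  have h2 : ((a : ℝ) + 7) / a ≤ 8 := by
    rw [div_le_iff₀ (by positivity)]; linarith
  have h3 : 0 ≤ ((a : ℝ) + 7) / b := by positivity
  linarith

/-- The weighted prime sum that determines the size of the resonator. -/
lemma log_div_le_sum_logPrimes {l : ℝ} (hl : 0 ≤ l) {a b : ℕ} (ha : 1 ≤ a) (hab : a ≤ b) :
    (Real.log (b / a) - 8) / (l + b) ≤
      ∑ p ∈ logPrimes (l + a) (l + b), 1 / (p * (Real.log p - l)) := by
  have ha0 : (1 : ℝ) ≤ a := by exact_mod_cast ha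
  have hb0 : (1 : ℝ) ≤ b := by exact_mod_cast ha.trans hab
  have hlb : 0 < l + b := by linarith
  rw [div_le_iff₀ hlb]
  refine (log_div_sub_eight_le_sum ha hab).trans ?_
  have h1 : ∀ k ∈ Finset.Ico a b, 1 / ((k : ℝ) * (k + 1)) * (k - a - 6) ≤
      ∑ p ∈ logPrimes (l + a) (l + b),
        (if Real.log p - l ≤ k then 1 / ((k : ℝ) * (k + 1)) else 0) * (Real.log p / p) := by
    intro k hk
    rw [Finset.mem_Ico] at hk
    have hk1 : (a : ℝ) ≤ k := by exact_mod_cast hk.1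
    have hk2 : (k : ℝ) ≤ b := by exact_mod_cast hk.2.le
    have h2 := sub_six_le_sum_logPrimes (A := l + a) (B := l + k) (by linarith) (by linarith)
    calc _ ≤ 1 / ((k : ℝ) * (k + 1)) * ∑ p ∈ logPrimes (l + a) (l + k), Real.log p / p := by
          gcongr
          linarith
      _ = ∑ p ∈ logPrimes (l + a) (l + k),
          (if Real.log p - l ≤ k then 1 / ((k : ℝ) * (k + 1)) else 0) * (Real.log p / p) := by
          rw [Finset.mul_sum]
          refine Finset.sum_congr rfl fun p hp => ?_
          rw [if_pos (by linarith [(mem_logPrimes.1 hp).2.2])]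
      _ ≤ _ := by
          refine Finset.sum_le_sum_of_subset_of_nonneg (fun p hp => ?_) fun p _ _ => ?_
          · rw [mem_logPrimes] at hp ⊢
            exact ⟨hp.1, hp.2.1, by linarith [hp.2.2]⟩
          · have := div_nonneg (Real.log_natCast_nonneg p) (Nat.cast_nonneg (α := ℝ) p)
            split_ifs <;> positivity
  refine (Finset.sum_le_sum h1).trans ?_
  rw [Finset.sum_comm, Finset.sum_mul]
  refine Finset.sum_le_sum fun p hp => ?_
  obtain ⟨hpp, hp1, hp2⟩ := mem_logPrimes.1 hp
  have hp0 : (0 : ℝ) < p := by exact_mod_cast hpp.pos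
  have hj : 0 < Real.log p - l := by linarith
  rw [← Finset.sum_mul]
  calc _ ≤ 1 / (Real.log p - l) * (Real.log p / p) := by
        have : 0 ≤ Real.log p / p := div_nonneg (Real.log_natCast_nonneg p) hp0.le
        gcongr
        exact sum_Ico_one_div_mul_succ_le hj a
    _ = 1 / (p * (Real.log p - l)) * Real.log p := by field_simp
    _ ≤ _ := by gcongr

/-- Removing the primes that divide `q` costs little. -/
lemma log_div_le_sum_logPrimes_not_dvd {l : ℝ} (hl : 0 ≤ l) {a b q : ℕ} (ha : 1 ≤ a)
    (hab : a ≤ b) (hq : q ≠ 0) (hω : (q.primeFactors.card : ℝ) ≤ Real.exp l) :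
    (Real.log (b / a) - 8) / (l + b) - Real.exp (-a) ≤
      ∑ p ∈ (logPrimes (l + a) (l + b)).filter (fun p => ¬ p ∣ q),
        1 / (p * (Real.log p - l)) := by
  have h1 := log_div_le_sum_logPrimes hl ha hab
  rw [← Finset.sum_filter_add_sum_filter_not _ (fun p => ¬ p ∣ q)] at h1
  have h2 : ∑ p ∈ (logPrimes (l + a) (l + b)).filter (fun p => ¬ ¬ p ∣ q),
      1 / (p * (Real.log p - l)) ≤ Real.exp (-a) := by
    have ha0 : (1 : ℝ) ≤ a := by exact_mod_cast ha
    calc _ ≤ ∑ p ∈ (logPrimes (l + a) (l + b)).filter (fun p => ¬ ¬ p ∣ q),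
          Real.exp (-(l + a)) := by
          refine Finset.sum_le_sum fun p hp => ?_
          obtain ⟨hpp, hp1, hp2⟩ := mem_logPrimes.1 (Finset.mem_filter.1 hp).1
          have hp0 : (0 : ℝ) < p := by exact_mod_cast hpp.pos
          rw [Real.exp_neg, ← one_div]
          have h3 : Real.exp (l + a) ≤ p := (Real.le_log_iff_exp_le hp0).1 hp1.le
          gcongr
          nlinarith
      _ ≤ q.primeFactors.card * Real.exp (-(l + a)) := by
          rw [Finset.sum_const, nsmul_eq_mul]
          gcongr
          intro p hp
          rw [Finset.mem_filter, not_not] at hp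
          exact Nat.mem_primeFactors.2 ⟨(mem_logPrimes.1 hp.1).1, hp.2, hq⟩
      _ ≤ Real.exp l * Real.exp (-(l + a)) := by gcongr
      _ = Real.exp (-a) := by rw [← Real.exp_add]; ring_nf
  linarith

/-! ### The resonance inequality -/

/-- The Cauchy–Schwarz inequality along a partial matching between `A` and `B`. -/
lemma sum_matching_le {ι : Type*} [DecidableEq ι] (A B : Finset ι) (F : ι → ℝ)
    (R : ι → ι → Prop) [DecidableRel R]
    (h1 : ∀ i ∈ A, ∀ j ∈ B, ∀ j' ∈ B, R i j → R i j' → j = j')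
    (h2 : ∀ i ∈ A, ∀ i' ∈ A, ∀ j ∈ B, R i j → R i' j → i = i') :
    ∑ i ∈ A, ∑ j ∈ B, (if R i j then F i * F j else 0) ≤
      Real.sqrt (∑ i ∈ A, F i ^ 2) * Real.sqrt (∑ j ∈ B, F j ^ 2) := by
  rw [← Finset.sum_product', ← Finset.sum_filter]
  set S := (A ×ˢ B).filter fun s => R s.1 s.2 with hS
  have hmem : ∀ s ∈ S, s.1 ∈ A ∧ s.2 ∈ B ∧ R s.1 s.2 := by
    intro s hs
    rw [hS, Finset.mem_filter, Finset.mem_product] at hs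
    exact ⟨hs.1.1, hs.1.2, hs.2⟩
  refine (Real.sum_mul_le_sqrt_mul_sqrt S (fun s => F s.1) (fun s => F s.2)).trans ?_
  gcongr
  · rw [← Finset.sum_image (f := fun i => F i ^ 2) (g := Prod.fst) (s := S)]
    · refine Finset.sum_le_sum_of_subset_of_nonneg (fun i hi => ?_) fun _ _ _ => sq_nonneg _
      obtain ⟨s, hs, rfl⟩ := Finset.mem_image.1 hi
      exact (hmem s hs).1
    · intro s hs t ht hst
      have hs' := hmem s hs
      have ht' := hmem t ht
      refine Prod.ext hst (h1 _ hs'.1 _ hs'.2.1 _ ht'.2.1 hs'.2.2 ?_)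
      rw [hst]
      exact ht'.2.2
  · rw [← Finset.sum_image (f := fun i => F i ^ 2) (g := Prod.snd) (s := S)]
    · refine Finset.sum_le_sum_of_subset_of_nonneg (fun i hi => ?_) fun _ _ _ => sq_nonneg _
      obtain ⟨s, hs, rfl⟩ := Finset.mem_image.1 hi
      exact (hmem s hs).2.1
    · intro s hs t ht hst
      have hs' := hmem s hs
      have ht' := hmem t ht
      refine Prod.ext (h2 _ hs'.1 _ ht'.1 _ hs'.2.1 hs'.2.2 ?_) hst
      rw [hst]
      exact ht'.2.2

/-- The resonance inequality. The resonator is indexed by integers `m i` prime to `q` of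
arbitrary size: those in a common residue class are merged into one coefficient, the square root
of the sum of the squares of their weights. The cost of the principal character is governed by
the number of integers only. -/
lemma resonance_inequality {q : ℕ} [NeZero q] (x : ℝ) {ι : Type*} [DecidableEq ι] (I : Finset ι)
    (m : ι → ℕ) (hinj : Set.InjOn m I) (hm : ∀ i ∈ I, (m i).Coprime q ∧ 0 < m i) (F : ι → ℝ) :
    ∑ i ∈ I, ∑ j ∈ I, F i * F j *
      (((coprimeUpTo q x ×ˢ coprimeUpTo q x).filter fun ab => ab.1 * m i = ab.2 * m j).card : ℝ) ≤
      (Delta x q ^ 2 + I.card * ((coprimeUpTo q x).card : ℝ) ^ 2 / q.totient) *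
        ∑ i ∈ I, F i ^ 2 := by
  classical
  have hφ : (0 : ℝ) < q.totient := by exact_mod_cast Nat.totient_pos.2 (NeZero.pos q)
  set C := coprimeUpTo q x with hC
  set h : ι → (ZMod q)ˣ := fun i => toUnit q (m i) with hh
  set cls : (ZMod q)ˣ → Finset ι := fun g => I.filter fun i => h i = g with hcls
  set r : (ZMod q)ˣ → ℝ := fun g => Real.sqrt (∑ i ∈ cls g, F i ^ 2) with hr
  have hr2 : ∑ g, r g ^ 2 = ∑ i ∈ I, F i ^ 2 := by
    have e : ∀ g, r g ^ 2 = ∑ i ∈ I with h i = g, F i ^ 2 := fun g =>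
      Real.sq_sqrt (Finset.sum_nonneg fun _ _ => sq_nonneg _)
    simp_rw [e]
    exact Finset.sum_fiberwise I h (fun i => F i ^ 2)
  have hr1 : (∑ g, r g) ^ 2 ≤ I.card * ∑ i ∈ I, F i ^ 2 := by
    have e : ∑ g, r g = ∑ g ∈ I.image h, r g := by
      symm
      refine Finset.sum_subset (Finset.subset_univ _) fun g _ hg => ?_
      have : cls g = ∅ := by
        rw [hcls, Finset.filter_eq_empty_iff]
        intro i hi hig
        exact hg (Finset.mem_image.2 ⟨i, hi, hig⟩)
      simp [hr, this]
    rw [e, ← hr2]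
    calc (∑ g ∈ I.image h, r g) ^ 2 ≤ (I.image h).card * ∑ g ∈ I.image h, r g ^ 2 :=
          sq_sum_le_card_mul_sum_sq
      _ ≤ I.card * ∑ g, r g ^ 2 := by
          refine mul_le_mul (Nat.cast_le.2 Finset.card_image_le) ?_
            (Finset.sum_nonneg fun _ _ => sq_nonneg _) (Nat.cast_nonneg _)
          exact Finset.sum_le_sum_of_subset_of_nonneg (Finset.subset_univ _)
            fun _ _ _ => sq_nonneg _
  have key : ∑ i ∈ I, ∑ j ∈ I, F i * F j *
      (((C ×ˢ C).filter fun ab => ab.1 * m i = ab.2 * m j).card : ℝ) ≤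
      ∑ g, (∑ n ∈ C, r (g * (toUnit q n)⁻¹)) ^ 2 := by
    have e1 : ∑ i ∈ I, ∑ j ∈ I, F i * F j *
        (((C ×ˢ C).filter fun ab => ab.1 * m i = ab.2 * m j).card : ℝ) =
        ∑ a ∈ C, ∑ b ∈ C, ∑ i ∈ I, ∑ j ∈ I,
          if a * m i = b * m j then F i * F j else 0 := by
      rw [← Finset.sum_product' C C (fun a b => ∑ i ∈ I, ∑ j ∈ I,
          if a * m i = b * m j then F i * F j else 0)]
      symm
      rw [Finset.sum_comm]
      refine Finset.sum_congr rfl fun i _ => ?_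
      rw [Finset.sum_comm]
      refine Finset.sum_congr rfl fun j _ => ?_
      rw [← Finset.sum_filter, Finset.sum_const, nsmul_eq_mul, mul_comm]
    have e2 : ∑ g, (∑ n ∈ C, r (g * (toUnit q n)⁻¹)) ^ 2 =
        ∑ a ∈ C, ∑ b ∈ C, ∑ g, r (g * (toUnit q a)⁻¹) * r (g * (toUnit q b)⁻¹) := by
      simp_rw [sq, Finset.sum_mul_sum]
      rw [Finset.sum_comm]
      refine Finset.sum_congr rfl fun a _ => ?_
      rw [Finset.sum_comm]
    rw [e1, e2]
    refine Finset.sum_le_sum fun a ha => Finset.sum_le_sum fun b hb => ?_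
    have ha' := mem_coprimeUpTo.1 ha
    have hb' := mem_coprimeUpTo.1 hb
    -- the pairs with `a m i = b m j` are sorted by the residue class of this product
    have e3 : ∑ i ∈ I, ∑ j ∈ I, (if a * m i = b * m j then F i * F j else 0) ≤
        ∑ g, ∑ i ∈ cls (g * (toUnit q a)⁻¹), ∑ j ∈ cls (g * (toUnit q b)⁻¹),
          (if a * m i = b * m j then F i * F j else 0) := by
      have e4 : ∀ g, ∑ i ∈ cls (g * (toUnit q a)⁻¹), ∑ j ∈ cls (g * (toUnit q b)⁻¹),
          (if a * m i = b * m j then F i * F j else 0) =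
          ∑ i ∈ I with toUnit q a * h i = g, ∑ j ∈ I,
            (if a * m i = b * m j then F i * F j else 0) := by
        intro g
        have e5 : cls (g * (toUnit q a)⁻¹) = I.filter fun i => toUnit q a * h i = g := by
          refine Finset.filter_congr fun i _ => ?_
          rw [eq_mul_inv_iff_mul_eq, mul_comm]
        rw [e5]
        refine Finset.sum_congr rfl fun i hi => ?_
        rw [Finset.mem_filter] at hi
        refine Finset.sum_subset (Finset.filter_subset _ _) fun j hj hj' => ?_
        refine if_neg fun hab => hj' (Finset.mem_filter.2 ⟨hj, ?_⟩)
        rw [eq_mul_inv_iff_mul_eq, mul_comm, ← hi.2, hh]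
        simp only
        rw [← toUnit_mul ha'.2 (hm i hi.1).1, ← toUnit_mul hb'.2 (hm j hj).1, hab]
      simp_rw [e4]
      rw [Finset.sum_fiberwise I (fun i => toUnit q a * h i)]
    refine e3.trans (Finset.sum_le_sum fun g _ => ?_)
    refine sum_matching_le _ _ F (fun i j => a * m i = b * m j) ?_ ?_
    · intro i _ j hj j' hj' h1 h2
      refine hinj (Finset.mem_filter.1 hj).1 (Finset.mem_filter.1 hj').1 ?_
      exact Nat.eq_of_mul_eq_mul_left hb'.1.1 (h1.symm.trans h2)
    · intro i hi i' hi' j _ h1 h2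
      refine hinj (Finset.mem_filter.1 hi).1 (Finset.mem_filter.1 hi').1 ?_
      exact Nat.eq_of_mul_eq_mul_left ha'.1.1 (h1.trans h2.symm)
  refine key.trans ?_
  have h1 := convolution_sq_le x r
  rw [hr2, mul_pow] at h1
  have h2 : ((C.card : ℝ)) ^ 2 * (∑ g, r g) ^ 2 ≤
      (C.card : ℝ) ^ 2 * (I.card * ∑ i ∈ I, F i ^ 2) := by gcongr
  have h3 : q.totient * ∑ g, (∑ n ∈ C, r (g * (toUnit q n)⁻¹)) ^ 2 ≤
      q.totient * ((Delta x q ^ 2 + I.card * (C.card : ℝ) ^ 2 / q.totient) *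
        ∑ i ∈ I, F i ^ 2) := by
    refine (h1.trans (add_le_add_right h2 _)).trans_eq ?_
    field_simp
  exact le_of_mul_le_mul_left h3 hφ

/-! ### Resonators supported on products of primes -/

/-- Chernoff's bound for a sum of independent variables, in terms of unnormalised weights `w i`
of total mass at least `1`; the numbers `D i` bound the second order expansions of the
exponential moments. -/
lemma sum_prod_filter_le_exp {ι S : Type*} [Fintype ι] [DecidableEq ι] [Fintype S]
    (w X : ι → S → ℝ) (hw : ∀ i s, 0 ≤ w i s) (hW : ∀ i, 1 ≤ ∑ s, w i s) {α : ℝ} (hα : 0 ≤ α)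
    (hX : ∀ i s, |α * X i s| ≤ 1) (D : ι → ℝ) (hD0 : ∀ i, 0 ≤ D i)
    (hD : ∀ i, ∑ s, w i s * (α * X i s + (α * X i s) ^ 2) ≤ D i) (Θ : ℝ) :
    ∑ σ : ι → S with Θ ≤ ∑ i, X i (σ i), ∏ i, w i (σ i) ≤
      (∏ i, ∑ s, w i s) * Real.exp (∑ i, D i - α * Θ) := by
  have h1 : ∑ σ : ι → S with Θ ≤ ∑ i, X i (σ i), ∏ i, w i (σ i) ≤
      ∑ σ : ι → S, Real.exp (-(α * Θ)) * ∏ i, w i (σ i) * Real.exp (α * X i (σ i)) := by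
    calc _ ≤ ∑ σ : ι → S with Θ ≤ ∑ i, X i (σ i),
          Real.exp (-(α * Θ)) * ∏ i, w i (σ i) * Real.exp (α * X i (σ i)) := by
          refine Finset.sum_le_sum fun σ hσ => ?_
          rw [Finset.mem_filter] at hσ
          rw [Finset.prod_mul_distrib, ← Real.exp_sum, ← Finset.mul_sum, mul_left_comm,
            ← Real.exp_add]
          refine le_mul_of_one_le_right (Finset.prod_nonneg fun i _ => hw i _) ?_
          refine Real.one_le_exp ?_
          nlinarith [mul_le_mul_of_nonneg_left hσ.2 hα]
      _ ≤ _ := Finset.sum_le_sum_of_subset_of_nonneg (Finset.subset_univ _) fun σ _ _ =>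
          mul_nonneg (Real.exp_pos _).le
            (Finset.prod_nonneg fun i _ => mul_nonneg (hw i _) (Real.exp_pos _).le)
  refine h1.trans ?_
  rw [← Finset.mul_sum, ← Fintype.prod_sum (fun i s => w i s * Real.exp (α * X i s))]
  have h2 : ∏ i, ∑ s, w i s * Real.exp (α * X i s) ≤
      ∏ i, (∑ s, w i s) * Real.exp (D i) := by
    refine Finset.prod_le_prod (fun i _ => Finset.sum_nonneg fun s _ =>
      mul_nonneg (hw i s) (Real.exp_pos _).le) fun i _ => ?_
    have h3 : ∑ s, w i s * Real.exp (α * X i s) ≤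
        ∑ s, (w i s + w i s * (α * X i s + (α * X i s) ^ 2)) := by
      refine Finset.sum_le_sum fun s _ => ?_
      have h4 := (abs_le.1 (Real.abs_exp_sub_one_sub_id_le (hX i s))).2
      nlinarith [hw i s]
    rw [Finset.sum_add_distrib] at h3
    have h5 := Real.add_one_le_exp (D i)
    nlinarith [hW i, hD i, hD0 i]
  calc _ ≤ Real.exp (-(α * Θ)) * ∏ i, (∑ s, w i s) * Real.exp (D i) := by gcongr
    _ = _ := by
      rw [Finset.prod_mul_distrib, ← Real.exp_sum, mul_left_comm, ← Real.exp_add]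
      ring_nf

/-- The weight of a local pair `(α, β)` of exponents at the prime `p`. The exponents `0, 1, 2`
stand for `-1, 0, 1`, so that the resonator lives on quotients of squarefree integers, made
integral by a common denominator. The pairs with `|α - β| = 2` are dropped. -/
noncomputable def pairWeight (f p : ℝ) (s : Fin 3 × Fin 3) : ℝ :=
  if s.1 = s.2 then (if s.1 = 1 then 1 else f ^ 2)
  else if s.1 = 1 ∨ s.2 = 1 then f / Real.sqrt p else 0

/-- The weight attached to an exponent: `1` at the centre and `f` otherwise. -/
noncomputable def expWeight (f : ℝ) (a : Fin 3) : ℝ := if a = 1 then 1 else f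

lemma pairWeight_nonneg {f : ℝ} (hf : 0 ≤ f) (p : ℝ) (s : Fin 3 × Fin 3) :
    0 ≤ pairWeight f p s := by
  unfold pairWeight
  split_ifs <;> positivity

lemma sum_pairWeight (f p : ℝ) : ∑ s, pairWeight f p s = 1 + 2 * f ^ 2 + 4 * (f / Real.sqrt p) := by
  simp [Fintype.sum_prod_type, Fin.sum_univ_three, pairWeight]
  ring

/-- The local weight is at most the product of the weights of the two exponents, divided by the
local factor of the square root of `a₀ b₀`, where `a₀` and `b₀` are the coprime integers with
ratio `p ^ (β - α)`. -/
lemma pairWeight_le {f p : ℝ} (hf : 0 ≤ f) (hp : 0 < p) (s : Fin 3 × Fin 3) :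
    pairWeight f p s * Real.sqrt p ^ ((s.2 - s.1 : ℕ) + (s.1 - s.2 : ℕ)) ≤
      expWeight f s.1 * expWeight f s.2 := by
  have hsp : Real.sqrt p ≠ 0 := (Real.sqrt_pos.2 hp).ne'
  obtain ⟨a, b⟩ := s
  fin_cases a <;> fin_cases b <;> simp [pairWeight, expWeight, sq] <;>
    first | positivity | (field_simp; try rfl)

section Integers

variable {P : Finset ℕ}

/-- The integer `∏ p ^ e p`. -/
def primeProd (e : P → ℕ) : ℕ := ∏ p : P, (p : ℕ) ^ e p

lemma primeProd_pos (hP : ∀ p ∈ P, p.Prime) (e : P → ℕ) : 0 < primeProd e :=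
  Finset.prod_pos fun p _ => pow_pos (hP p p.2).pos _

lemma primeProd_coprime {q : ℕ} (hPq : ∀ p ∈ P, p.Coprime q) (e : P → ℕ) :
    (primeProd e).Coprime q :=
  Nat.Coprime.prod_left fun p _ => Nat.Coprime.pow_left _ (hPq p p.2)

lemma primeProd_injective (hP : ∀ p ∈ P, p.Prime) : Function.Injective (primeProd (P := P)) := by
  classical
  have key : ∀ (e : P → ℕ) (p : P), (primeProd e).factorization p = e p := by
    intro e p
    unfold primeProd
    rw [Nat.factorization_prod fun (r : P) _ => pow_ne_zero _ (hP r r.2).ne_zero,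
      Finsupp.finsetSum_apply]
    rw [Finset.sum_eq_single p]
    · rw [(hP p p.2).factorization_pow, Finsupp.single_eq_same]
    · intro r _ hr
      rw [(hP r r.2).factorization_pow, Finsupp.single_eq_of_ne]
      exact fun h => hr (Subtype.ext h.symm)
    · intro h
      exact absurd (Finset.mem_univ p) h
  intro e e' h
  funext p
  rw [← key e p, ← key e' p, h]

lemma log_primeProd (hP : ∀ p ∈ P, p.Prime) (e : P → ℕ) :
    Real.log (primeProd e) = ∑ p : P, e p * Real.log (p : ℕ) := by
  unfold primeProd
  push_cast
  rw [Real.log_prod fun p _ => pow_ne_zero _ (by exact_mod_cast (hP p p.2).ne_zero)]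
  simp_rw [Real.log_pow]

end Integers

/-- A relation `a₀ m = b₀ n` produces as many solutions of `a m = b n` as there are admissible
common factors of `a` and `b`. -/
lemma card_coprimeUpTo_le_card_filter {q m n a₀ b₀ : ℕ} {x : ℝ} (ha : a₀.Coprime q)
    (hb : b₀.Coprime q) (ha0 : 0 < a₀) (hb0 : 0 < b₀) (h : a₀ * m = b₀ * n) :
    (coprimeUpTo q (x / max (a₀ : ℝ) b₀)).card ≤
      ((coprimeUpTo q x ×ˢ coprimeUpTo q x).filter fun ab => ab.1 * m = ab.2 * n).card := by
  have ha' : (0 : ℝ) < a₀ := by exact_mod_cast ha0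
  refine Finset.card_le_card_of_injOn (fun k => (k * a₀, k * b₀)) ?_ ?_
  · intro k hk
    obtain ⟨⟨hk1, hk2⟩, hk3⟩ := mem_coprimeUpTo.1 hk
    have hmax : (0 : ℝ) < max (a₀ : ℝ) b₀ := lt_max_of_lt_left ha'
    rw [le_div_iff₀ hmax] at hk2
    have hk0 : (0 : ℝ) ≤ k := Nat.cast_nonneg k
    simp only [Finset.coe_filter, Finset.mem_product, Set.mem_ofPred_eq, mem_coprimeUpTo]
    refine ⟨⟨⟨⟨Nat.mul_pos hk1 ha0, ?_⟩, hk3.mul_left ha⟩, ⟨Nat.mul_pos hk1 hb0, ?_⟩,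
      hk3.mul_left hb⟩, by rw [mul_assoc, mul_assoc, h]⟩
    · push_cast
      exact (mul_le_mul_of_nonneg_left (le_max_left _ _) hk0).trans hk2
    · push_cast
      exact (mul_le_mul_of_nonneg_left (le_max_right _ _) hk0).trans hk2
  · intro k _ k' _ hkk
    exact Nat.eq_of_mul_eq_mul_right ha0 (Prod.ext_iff.1 hkk).1

section Resonator

variable {P : Finset ℕ}

/-- The exponent vectors `e ∈ {0, 1, 2} ^ P` for which the primes with `e p ≠ 1` have total cost
at most `Λ`. -/
noncomputable def lowCost (c : ℕ → ℝ) (Λ : ℝ) : Finset (P → Fin 3) :=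
  Finset.univ.filter fun e => ∑ p : P, (if e p = 1 then 0 else c p) ≤ Λ

/-- Rankin's trick: the number of vectors of cost at most `Λ` is at most `exp Λ` times the sum of
`exp (-cost)` over all vectors. -/
lemma card_lowCost_le (c : ℕ → ℝ) (Λ : ℝ) :
    ((lowCost (P := P) c Λ).card : ℝ) ≤ Real.exp (Λ + 2 * ∑ p ∈ P, Real.exp (-c p)) := by
  classical
  set g : P → Fin 3 → ℝ := fun p a => Real.exp (-(if a = 1 then 0 else c p)) with hg
  calc ((lowCost (P := P) c Λ).card : ℝ) = ∑ e ∈ lowCost (P := P) c Λ, (1 : ℝ) := by simp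
    _ ≤ ∑ e ∈ lowCost (P := P) c Λ, Real.exp Λ * ∏ p, g p (e p) := by
        refine Finset.sum_le_sum fun e he => ?_
        have he' := (Finset.mem_filter.1 he).2
        rw [hg, ← Real.exp_sum, ← Real.exp_add]
        refine Real.one_le_exp ?_
        rw [Finset.sum_neg_distrib]
        linarith
    _ ≤ ∑ e : P → Fin 3, Real.exp Λ * ∏ p, g p (e p) :=
        Finset.sum_le_sum_of_subset_of_nonneg (Finset.subset_univ _) fun e _ _ =>
          mul_nonneg (Real.exp_pos _).le (Finset.prod_nonneg fun p _ => (Real.exp_pos _).le)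
    _ = Real.exp Λ * ∏ p : P, (1 + 2 * Real.exp (-c p)) := by
        rw [← Finset.mul_sum, ← Fintype.prod_sum]
        congr 1
        refine Finset.prod_congr rfl fun p _ => ?_
        rw [Fin.sum_univ_three]
        have h2 : ¬ (2 : Fin 3) = 1 := by decide
        simp only [hg, if_neg h2, if_neg (zero_ne_one (α := Fin 3)), if_true, neg_zero,
          Real.exp_zero]
        ring
    _ ≤ Real.exp Λ * ∏ p : P, Real.exp (2 * Real.exp (-c p)) := by
        gcongr with p
        linarith [Real.add_one_le_exp (2 * Real.exp (-c p))]
    _ = _ := by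
        rw [← Real.exp_sum, ← Finset.mul_sum, ← Real.exp_add,
          Finset.sum_coe_sort P fun p => Real.exp (-c p)]

lemma sum_prod_expWeight_sq (f : ℕ → ℝ) :
    ∑ e : P → Fin 3, (∏ p : P, expWeight (f p) (e p)) ^ 2 = ∏ p ∈ P, (1 + 2 * f p ^ 2) := by
  classical
  simp_rw [← Finset.prod_pow]
  rw [← Fintype.prod_sum (fun (p : P) a => expWeight (f p) a ^ 2),
    ← Finset.prod_coe_sort P fun p => 1 + 2 * f p ^ 2]
  refine Finset.prod_congr rfl fun p _ => ?_
  simp [Fin.sum_univ_three, expWeight]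
  ring

/-- The pairs of exponent vectors, both of low cost, for which the numbers `a₀` and `b₀` in the
relation `a₀ m = b₀ n` between the two integers are comparable and not too large. -/
noncomputable def goodPairs (c : ℕ → ℝ) (Λ T Z : ℝ) : Finset (P → Fin 3 × Fin 3) :=
  Finset.univ.filter fun σ =>
    (∑ p : P, (if (σ p).1 = 1 then 0 else c p) ≤ Λ ∧
      ∑ p : P, (if (σ p).2 = 1 then 0 else c p) ≤ Λ) ∧
    |∑ p : P, ((((σ p).2 - (σ p).1 : ℕ) : ℝ) - ((σ p).1 - (σ p).2 : ℕ)) * Real.log (p : ℕ)| ≤ T ∧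
    ∑ p : P, ((((σ p).2 - (σ p).1 : ℕ) : ℝ) + ((σ p).1 - (σ p).2 : ℕ)) * Real.log (p : ℕ) ≤ 2 * Z

/-- Counting the solutions of `a m = b n` for a good pair `(m, n)` of integers through the minimal
solution `(a₀, b₀)`: there are at least `κ x / max a₀ b₀`, and `max a₀ b₀ ≤ exp (T / 2) √(a₀ b₀)`.
-/
lemma sum_goodPairs_le {q : ℕ} (hP : ∀ p ∈ P, p.Prime) (hPq : ∀ p ∈ P, p.Coprime q)
    {f c : ℕ → ℝ} (hf : ∀ p, 0 ≤ f p) {Λ T Z x κ : ℝ} (hx : 0 < x) (hκ : 0 ≤ κ)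
    (hN : ∀ K, x * Real.exp (-(Z + T / 2)) ≤ K → κ * K ≤ (coprimeUpTo q K).card) :
    κ * x * Real.exp (-(T / 2)) *
      ∑ σ ∈ goodPairs (P := P) c Λ T Z, ∏ p : P, pairWeight (f p) (p : ℕ) (σ p) ≤
    ∑ i ∈ lowCost (P := P) c Λ, ∑ j ∈ lowCost (P := P) c Λ,
      (∏ p : P, expWeight (f p) (i p)) * (∏ p : P, expWeight (f p) (j p)) *
      (((coprimeUpTo q x ×ˢ coprimeUpTo q x).filter fun ab =>
        ab.1 * primeProd (fun p => (i p : ℕ)) =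
          ab.2 * primeProd (fun p => (j p : ℕ))).card : ℝ) := by
  classical
  set I := lowCost (P := P) c Λ with hI
  set g : (P → Fin 3) × (P → Fin 3) → ℝ := fun ij =>
      (∏ p : P, expWeight (f p) (ij.1 p)) * (∏ p : P, expWeight (f p) (ij.2 p)) *
      (((coprimeUpTo q x ×ˢ coprimeUpTo q x).filter fun ab =>
        ab.1 * primeProd (fun p => (ij.1 p : ℕ)) =
          ab.2 * primeProd (fun p => (ij.2 p : ℕ))).card : ℝ) with hg
  have hexp : ∀ (e : P → Fin 3), 0 ≤ ∏ p : P, expWeight (f p) (e p) := fun e =>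
    Finset.prod_nonneg fun p _ => by unfold expWeight; split_ifs <;> [norm_num; exact hf p]
  have hg0 : ∀ ij, 0 ≤ g ij := fun ij =>
    mul_nonneg (mul_nonneg (hexp _) (hexp _)) (Nat.cast_nonneg _)
  set split : (P → Fin 3 × Fin 3) → (P → Fin 3) × (P → Fin 3) :=
    fun σ => (fun p => (σ p).1, fun p => (σ p).2) with hsplit
  have hinj : Function.Injective split := by
    intro σ τ h
    funext p
    have h1 := congrFun (Prod.ext_iff.1 h).1 p
    have h2 := congrFun (Prod.ext_iff.1 h).2 p
    exact Prod.ext h1 h2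
  have h1 : ∑ σ ∈ goodPairs (P := P) c Λ T Z, g (split σ) ≤ ∑ ij ∈ I ×ˢ I, g ij := by
    rw [← Finset.sum_image (f := g) (g := split) hinj.injOn]
    refine Finset.sum_le_sum_of_subset_of_nonneg (fun ij hij => ?_) fun ij _ _ => hg0 ij
    obtain ⟨σ, hσ, rfl⟩ := Finset.mem_image.1 hij
    have hσ' := (Finset.mem_filter.1 hσ).2.1
    exact Finset.mem_product.2 ⟨Finset.mem_filter.2 ⟨Finset.mem_univ _, hσ'.1⟩,
      Finset.mem_filter.2 ⟨Finset.mem_univ _, hσ'.2⟩⟩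
  rw [Finset.sum_product] at h1
  refine le_trans ?_ h1
  rw [Finset.mul_sum]
  refine Finset.sum_le_sum fun σ hσ => ?_
  obtain ⟨-, hT, hZ⟩ := (Finset.mem_filter.1 hσ).2
  set up : P → ℕ := fun p => ((σ p).2 - (σ p).1 : ℕ) with hup
  set dn : P → ℕ := fun p => ((σ p).1 - (σ p).2 : ℕ) with hdn
  have hrel : primeProd up * primeProd (fun p => ((σ p).1 : ℕ)) =
      primeProd dn * primeProd (fun p => ((σ p).2 : ℕ)) := by
    unfold primeProd
    rw [← Finset.prod_mul_distrib, ← Finset.prod_mul_distrib]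
    refine Finset.prod_congr rfl fun p _ => ?_
    rw [← pow_add, ← pow_add]
    congr 1
    simp only [hup, hdn]
    omega
  have ha0 : (0 : ℝ) < primeProd up := by exact_mod_cast primeProd_pos hP up
  have hb0 : (0 : ℝ) < primeProd dn := by exact_mod_cast primeProd_pos hP dn
  have hcard := card_coprimeUpTo_le_card_filter (x := x) (primeProd_coprime hPq up)
    (primeProd_coprime hPq dn) (primeProd_pos hP up) (primeProd_pos hP dn) hrel
  -- with `s = log a₀ + log b₀`, the larger of `a₀`, `b₀` is at most `exp ((s + T) / 2)`
  set s : ℝ := ∑ p : P, ((up p : ℝ) + dn p) * Real.log (p : ℕ) with hs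
  have hs' : s = Real.log (primeProd up) + Real.log (primeProd dn) := by
    rw [log_primeProd hP, log_primeProd hP, ← Finset.sum_add_distrib, hs]
    exact Finset.sum_congr rfl fun p _ => by ring
  have hT' : |Real.log (primeProd up) - Real.log (primeProd dn)| ≤ T := by
    rw [log_primeProd hP, log_primeProd hP, ← Finset.sum_sub_distrib]
    simpa only [sub_mul] using hT
  rw [abs_le] at hT'
  have hmax : max (primeProd up : ℝ) (primeProd dn) ≤ Real.exp (s / 2 + T / 2) := by
    refine max_le ?_ ?_
    · rw [← Real.log_le_iff_le_exp ha0]; linarith [hT'.2]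
    · rw [← Real.log_le_iff_le_exp hb0]; linarith [hT'.1]
  have hmax0 : 0 < max (primeProd up : ℝ) (primeProd dn) := lt_max_of_lt_left ha0
  have hK : x * Real.exp (-(s / 2 + T / 2)) ≤ x / max (primeProd up : ℝ) (primeProd dn) := by
    rw [Real.exp_neg, ← div_eq_mul_inv]
    gcongr
  have hNK := hN _ (le_trans (by gcongr; linarith) hK)
  have hcount : κ * (x * Real.exp (-(s / 2 + T / 2))) ≤
      (((coprimeUpTo q x ×ˢ coprimeUpTo q x).filter fun ab =>
        ab.1 * primeProd (fun p => ((σ p).1 : ℕ)) =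
          ab.2 * primeProd (fun p => ((σ p).2 : ℕ))).card : ℝ) :=
    (mul_le_mul_of_nonneg_left hK hκ).trans (hNK.trans (Nat.cast_le.2 hcard))
  have hw : (∏ p : P, pairWeight (f p) (p : ℕ) (σ p)) * Real.exp (s / 2) ≤
      (∏ p : P, expWeight (f p) (σ p).1) * ∏ p : P, expWeight (f p) (σ p).2 := by
    have e : Real.exp (s / 2) = ∏ p : P, Real.sqrt (p : ℕ) ^ (up p + dn p) := by
      rw [hs, Finset.sum_div, Real.exp_sum]
      refine Finset.prod_congr rfl fun p _ => ?_
      have hp0 : (0 : ℝ) < (p : ℕ) := by exact_mod_cast (hP p p.2).pos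
      rw [Real.sqrt_eq_rpow, ← Real.rpow_natCast, ← Real.rpow_mul hp0.le,
        Real.rpow_def_of_pos hp0]
      push_cast
      ring_nf
    rw [e, ← Finset.prod_mul_distrib, ← Finset.prod_mul_distrib]
    refine Finset.prod_le_prod (fun p _ => mul_nonneg (pairWeight_nonneg (hf p) _ _)
      (by positivity)) fun p _ => ?_
    exact pairWeight_le (hf p) (by exact_mod_cast (hP p p.2).pos) (σ p)
  calc κ * x * Real.exp (-(T / 2)) * ∏ p : P, pairWeight (f p) (p : ℕ) (σ p)
      = ((∏ p : P, pairWeight (f p) (p : ℕ) (σ p)) * Real.exp (s / 2)) *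
        (κ * (x * Real.exp (-(s / 2 + T / 2)))) := by
        have : Real.exp (-(T / 2)) = Real.exp (s / 2) * Real.exp (-(s / 2 + T / 2)) := by
          rw [← Real.exp_add]; ring_nf
        rw [this]; ring
    _ ≤ _ := by
        simp only [hg, hsplit]
        exact mul_le_mul hw hcount (by positivity) (mul_nonneg (hexp _) (hexp _))

/-- The lower bound for `Δ(x, q)` given by the resonator, in terms of the mass of the good
pairs. -/
lemma resonator_bound {q : ℕ} [NeZero q] (hP : ∀ p ∈ P, p.Prime) (hPq : ∀ p ∈ P, p.Coprime q)
    {f c : ℕ → ℝ} (hf : ∀ p, 0 ≤ f p) {Λ T Z x κ : ℝ} (hx : 0 < x) (hκ : 0 ≤ κ)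
    (hN : ∀ K, x * Real.exp (-(Z + T / 2)) ≤ K → κ * K ≤ (coprimeUpTo q K).card) :
    κ * x * Real.exp (-(T / 2)) *
      ∑ σ ∈ goodPairs (P := P) c Λ T Z, ∏ p : P, pairWeight (f p) (p : ℕ) (σ p) ≤
    (Delta x q ^ 2 + Real.exp (Λ + 2 * ∑ p ∈ P, Real.exp (-c p)) * x ^ 2 / q.totient) *
      ∏ p ∈ P, (1 + 2 * f p ^ 2) := by
  classical
  have h1 := sum_goodPairs_le hP hPq (c := c) (Λ := Λ) hf hx hκ hN
  have h2 := resonance_inequality (q := q) x (lowCost (P := P) c Λ)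
    (fun e => primeProd (fun p => (e p : ℕ)))
    (fun e _ e' _ h => by
      funext p
      exact Fin.ext (congrFun (primeProd_injective hP h) p))
    (fun e _ => ⟨primeProd_coprime hPq _, primeProd_pos hP _⟩)
    (fun e => ∏ p : P, expWeight (f p) (e p))
  refine (h1.trans h2).trans ?_
  have h3 : ((coprimeUpTo q x).card : ℝ) ≤ x := by
    calc ((coprimeUpTo q x).card : ℝ) ≤ ((Finset.Icc 1 ⌊x⌋₊).card : ℝ) := by
          exact_mod_cast Finset.card_filter_le _ _
      _ ≤ x := by
          rw [Nat.card_Icc, Nat.add_sub_cancel]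
          exact Nat.floor_le hx.le
  have h4 : ∑ e ∈ lowCost (P := P) c Λ, (∏ p : P, expWeight (f p) (e p)) ^ 2 ≤
      ∏ p ∈ P, (1 + 2 * f p ^ 2) := by
    rw [← sum_prod_expWeight_sq]
    exact Finset.sum_le_sum_of_subset_of_nonneg (Finset.subset_univ _) fun _ _ _ => sq_nonneg _
  refine mul_le_mul ?_ h4 (Finset.sum_nonneg fun _ _ => sq_nonneg _) (by positivity)
  gcongr
  exact card_lowCost_le c Λ

end Resonator

/-! ### The mass of the good pairs -/

lemma sum_pairWeight_mul (f p : ℝ) (g : Fin 3 × Fin 3 → ℝ) :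
    ∑ s, pairWeight f p s * g s = g (1, 1) + f ^ 2 * (g (0, 0) + g (2, 2)) +
      f / Real.sqrt p * (g (0, 1) + g (1, 0) + g (1, 2) + g (2, 1)) := by
  simp [Fintype.sum_prod_type, Fin.sum_univ_three, pairWeight]
  ring

section Mass

variable {P : Finset ℕ}

/-- Chernoff's bound for the pairs of exponent vectors, with the explicit constant used for each
of the conditions defining the good pairs. -/
lemma sum_filter_prod_pairWeight_le {f : ℕ → ℝ} (hf : ∀ p, 0 ≤ f p)
    (X : P → Fin 3 × Fin 3 → ℝ) {α : ℝ} (hα : 0 ≤ α) (hX : ∀ p s, |α * X p s| ≤ 1) (D : P → ℝ)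
    (hD0 : ∀ p, 0 ≤ D p)
    (hD : ∀ p : P, ∑ s, pairWeight (f p) (p : ℕ) s * (α * X p s + (α * X p s) ^ 2) ≤ D p)
    (Θ : ℝ) (h : ∑ p, D p - α * Θ ≤ -3) :
    ∑ σ : P → Fin 3 × Fin 3 with Θ ≤ ∑ p, X p (σ p), ∏ p : P, pairWeight (f p) (p : ℕ) (σ p) ≤
      1 / 10 * ∏ p : P, ∑ s, pairWeight (f p) (p : ℕ) s := by
  have hW : ∀ p : P, 1 ≤ ∑ s, pairWeight (f p) (p : ℕ) s := fun p => by
    rw [sum_pairWeight]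
    have h1 := hf p
    have : 0 ≤ f p / Real.sqrt (p : ℕ) := by positivity
    nlinarith [sq_nonneg (f p)]
  refine (sum_prod_filter_le_exp (fun (p : P) s => pairWeight (f p) (p : ℕ) s) X
    (fun p s => pairWeight_nonneg (hf p) _ s) hW hα hX D hD0 hD Θ).trans ?_
  rw [mul_comm]
  have hpos : 0 ≤ ∏ p : P, ∑ s, pairWeight (f p) (p : ℕ) s :=
    Finset.prod_nonneg fun p _ => zero_le_one.trans (hW p)
  refine mul_le_mul_of_nonneg_right ?_ hpos
  calc Real.exp (∑ p, D p - α * Θ) ≤ Real.exp (-3) := Real.exp_le_exp.2 h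
    _ ≤ 1 / 10 := by
      have h1 : Real.exp 3 = Real.exp 1 ^ 3 := by rw [← Real.exp_nat_mul]; norm_num
      have h2 := Real.exp_one_gt_d9
      have h3 : (2.7 : ℝ) ^ 3 ≤ Real.exp 1 ^ 3 := by gcongr; linarith
      rw [Real.exp_neg, h1, ← one_div]
      refine one_div_le_one_div_of_le (by norm_num) (le_trans (by norm_num) h3)

/-- Most of the mass of the pairs of exponent vectors is carried by the good pairs: each of the
conditions defining them fails on at most a tenth of the mass. -/
lemma half_le_sum_goodPairs {f c : ℕ → ℝ} (hf : ∀ p, 0 ≤ f p) {B l τ α Λ D : ℝ}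
    (hc : ∀ p ∈ P, 0 ≤ c p ∧ c p ≤ B) (hlog : ∀ p ∈ P, Real.log p ≤ 2 * l)
    (hD : D = ∑ p ∈ P, 4 * (f p / Real.sqrt p)) (hτ : 0 < τ) (hτ1 : τ ≤ 1) (hl : 1 ≤ l)
    (hα : 0 ≤ α) (hαB : α * B ≤ τ)
    (hΛ : α * ((1 + τ) * ∑ p ∈ P, c p * (2 * f p ^ 2 + 2 * (f p / Real.sqrt p)) - Λ) ≤ -3)
    (hDl : 48 * l ^ 2 ≤ τ ^ 2 * D) :
    1 / 2 * ∏ p ∈ P, (1 + 2 * f p ^ 2 + 4 * (f p / Real.sqrt p)) ≤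
      ∑ σ ∈ goodPairs (P := P) c Λ (τ * D) (4 * l * D),
        ∏ p : P, pairWeight (f p) (p : ℕ) (σ p) := by
  classical
  set M := ∏ p : P, ∑ s, pairWeight (f p) (p : ℕ) s with hM
  have hMeq : ∏ p ∈ P, (1 + 2 * f p ^ 2 + 4 * (f p / Real.sqrt p)) = M := by
    rw [hM, ← Finset.prod_coe_sort P]
    exact Finset.prod_congr rfl fun p _ => (sum_pairWeight _ _).symm
  have hfs : ∀ p : P, 0 ≤ f p / Real.sqrt (p : ℕ) := fun p =>
    div_nonneg (hf p) (Real.sqrt_nonneg _)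
  have hlog0 : ∀ p : P, 0 ≤ Real.log (p : ℕ) := fun p => Real.log_natCast_nonneg p
  have hDsum : ∑ p : P, 4 * (f p / Real.sqrt (p : ℕ)) = D := by
    rw [hD]; exact Finset.sum_coe_sort P fun p : ℕ => 4 * (f p / Real.sqrt p)
  have hD0 : 0 ≤ D := by
    rw [← hDsum]; exact Finset.sum_nonneg fun p _ => mul_nonneg (by norm_num) (hfs p)
  have h10 : ¬ (0 : Fin 3) = 1 := by decide
  have h12 : ¬ (2 : Fin 3) = 1 := by decide
  -- the two conditions on the cost
  have hcost : ∀ pr : Fin 3 × Fin 3 → Fin 3, (pr = Prod.fst ∨ pr = Prod.snd) →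
      ∑ σ : P → Fin 3 × Fin 3 with Λ ≤ ∑ p : P, (if pr (σ p) = 1 then 0 else c p),
        ∏ p : P, pairWeight (f p) (p : ℕ) (σ p) ≤ 1 / 10 * M := by
    intro pr hpr
    refine sum_filter_prod_pairWeight_le hf (fun (p : P) s => if pr s = 1 then 0 else c p) hα ?_
      (fun p => α * ((1 + τ) * (c p * (2 * f p ^ 2 + 2 * (f p / Real.sqrt (p : ℕ)))))) ?_ ?_ Λ ?_
    · intro p s
      obtain ⟨h1, h2⟩ := hc p p.2
      split_ifs
      · simp
      · rw [abs_of_nonneg (by positivity)]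
        nlinarith
    · intro p
      have := (hc p p.2).1
      have := hfs p
      positivity
    · intro p
      obtain ⟨h1, h2⟩ := hc p p.2
      have h3 : (α * c p) ^ 2 ≤ τ * (α * c p) := by
        have h4 : α * c p ≤ τ := by nlinarith
        have h5 : 0 ≤ α * c p := by positivity
        nlinarith
      have h6 : 0 ≤ 2 * f p ^ 2 + 2 * (f p / Real.sqrt (p : ℕ)) := by
        have := hfs p; positivity
      rw [sum_pairWeight_mul]
      rcases hpr with rfl | rfl <;> simp only [if_neg h10, if_neg h12, if_true] <;>
      nlinarith [mul_le_mul_of_nonneg_left h3 h6]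
    · rw [← Finset.mul_sum, ← Finset.mul_sum, ← mul_sub,
        Finset.sum_coe_sort P fun p : ℕ => c p * (2 * f p ^ 2 + 2 * (f p / Real.sqrt p))]
      exact hΛ
  -- the condition that the two numbers are comparable
  have hratio : ∀ ε : ℝ, (ε = 1 ∨ ε = -1) →
      ∑ σ : P → Fin 3 × Fin 3 with τ * D ≤ ∑ p : P, ε *
          (((((σ p).2 - (σ p).1 : ℕ) : ℝ) - ((σ p).1 - (σ p).2 : ℕ)) * Real.log (p : ℕ)),
        ∏ p : P, pairWeight (f p) (p : ℕ) (σ p) ≤ 1 / 10 * M := by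
    intro ε hε
    -- the local variable is symmetric, so that only its second moment enters; `β` balances it
    -- against the deviation `τ D`
    have hε2 : ε ^ 2 = 1 := by rcases hε with rfl | rfl <;> norm_num
    have hl2 : 0 < l ^ 2 := by positivity
    set β := τ / (8 * l ^ 2) with hβ
    have hβ0 : 0 < β := by positivity
    have hβl : β * (8 * l ^ 2) = τ := by rw [hβ]; field_simp
    refine sum_filter_prod_pairWeight_le hf (fun (p : P) (s : Fin 3 × Fin 3) => ε *
      ((((s.2 - s.1 : ℕ) : ℝ) - (s.1 - s.2 : ℕ)) * Real.log (p : ℕ))) hβ0.le ?_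
      (fun p => β ^ 2 * (4 * l ^ 2) * (4 * (f p / Real.sqrt (p : ℕ)))) ?_ ?_ _ ?_
    · intro p s
      have h1 : |(((s.2 - s.1 : ℕ) : ℝ) - (s.1 - s.2 : ℕ))| ≤ 2 := by
        have h2 : (s.2 - s.1 : ℕ) ≤ 2 := by omega
        have h3 : (s.1 - s.2 : ℕ) ≤ 2 := by omega
        have h2' : ((s.2 - s.1 : ℕ) : ℝ) ≤ 2 := by exact_mod_cast h2
        have h3' : ((s.1 - s.2 : ℕ) : ℝ) ≤ 2 := by exact_mod_cast h3
        have h4 : (0 : ℝ) ≤ ((s.2 - s.1 : ℕ) : ℝ) := Nat.cast_nonneg _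
        have h5 : (0 : ℝ) ≤ ((s.1 - s.2 : ℕ) : ℝ) := Nat.cast_nonneg _
        rw [abs_le]
        constructor <;> linarith
      have hε1 : |ε| = 1 := by rcases hε with rfl | rfl <;> simp
      rw [abs_mul, abs_mul, abs_mul, hε1, abs_of_pos hβ0, abs_of_nonneg (hlog0 p), one_mul]
      have h6 := hlog p p.2
      calc _ ≤ β * (2 * (2 * l)) := by gcongr
        _ ≤ β * (8 * l ^ 2) := mul_le_mul_of_nonneg_left (by nlinarith) hβ0.le
        _ ≤ 1 := by rw [hβl]; exact hτ1
    · intro p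
      have := hfs p
      positivity
    · intro p
      rw [sum_pairWeight_mul]
      have h1 : Real.log (p : ℕ) ^ 2 ≤ 4 * l ^ 2 := by
        have := hlog p p.2
        nlinarith [hlog0 p]
      have h2 := mul_le_mul_of_nonneg_left h1
        (mul_nonneg (sq_nonneg β) (mul_nonneg zero_le_four (hfs p)))
      have h3 : (β * (ε * Real.log (p : ℕ))) ^ 2 = β ^ 2 * Real.log (p : ℕ) ^ 2 := by
        rw [mul_pow, mul_pow, hε2, one_mul]
      norm_num
      rw [h3]
      linarith
    · rw [← Finset.mul_sum, hDsum]
      have h1 : β ^ 2 * (4 * l ^ 2) * D - β * (τ * D) = -(β * τ * D / 2) := by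
        have : β ^ 2 * (4 * l ^ 2) = β * τ / 2 := by rw [← hβl]; ring
        rw [this]; ring
      have h2 : β * τ * D = τ ^ 2 * D / (8 * l ^ 2) := by rw [hβ]; ring
      have h3 : 6 ≤ τ ^ 2 * D / (8 * l ^ 2) := by
        rw [le_div_iff₀ (by positivity)]; linarith
      rw [h1, h2]
      linarith
  -- the condition on the size
  have hsize : ∑ σ : P → Fin 3 × Fin 3 with 2 * (4 * l * D) ≤ ∑ p : P,
          ((((σ p).2 - (σ p).1 : ℕ) : ℝ) + ((σ p).1 - (σ p).2 : ℕ)) * Real.log (p : ℕ),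
        ∏ p : P, pairWeight (f p) (p : ℕ) (σ p) ≤ 1 / 10 * M := by
    set β := 1 / (4 * l) with hβ
    have hβ0 : 0 < β := by positivity
    have hβl : β * (4 * l) = 1 := by rw [hβ]; field_simp
    refine sum_filter_prod_pairWeight_le hf (fun (p : P) (s : Fin 3 × Fin 3) =>
      (((s.2 - s.1 : ℕ) : ℝ) + (s.1 - s.2 : ℕ)) * Real.log (p : ℕ)) hβ0.le ?_
      (fun p => 4 * (f p / Real.sqrt (p : ℕ))) ?_ ?_ _ ?_
    · intro p s
      have h1 : (((s.2 - s.1 : ℕ) : ℝ) + (s.1 - s.2 : ℕ)) ≤ 2 := by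
        have h2 : (s.2 - s.1 : ℕ) + (s.1 - s.2 : ℕ) ≤ 2 := by omega
        exact_mod_cast h2
      have h6 := hlog p p.2
      have h7 := hlog0 p
      rw [abs_of_nonneg (by positivity)]
      calc _ ≤ β * (2 * (2 * l)) := by gcongr
        _ = 1 := by rw [← hβl]; ring
    · intro p
      have := hfs p
      positivity
    · intro p
      rw [sum_pairWeight_mul]
      have h1 : β * Real.log (p : ℕ) ≤ 1 / 2 := by
        have h6 := hlog p p.2
        nlinarith
      have h2 : 0 ≤ β * Real.log (p : ℕ) := mul_nonneg hβ0.le (hlog0 p)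
      have h3 : β * Real.log (p : ℕ) + (β * Real.log (p : ℕ)) ^ 2 ≤ 1 := by nlinarith
      have h4 := mul_le_mul_of_nonneg_left h3 (mul_nonneg zero_le_four (hfs p))
      norm_num
      linarith
    · rw [hDsum]
      have h1 : β * (2 * (4 * l * D)) = 2 * D := by
        calc _ = β * (4 * l) * (2 * D) := by ring
          _ = _ := by rw [hβl, one_mul]
      have h2 : 48 ≤ D := by
        have : τ ^ 2 ≤ 1 := by nlinarith
        nlinarith
      rw [h1]
      linarith
  have htot : ∑ σ : P → Fin 3 × Fin 3, ∏ p : P, pairWeight (f p) (p : ℕ) (σ p) = M :=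
    (Fintype.prod_sum _).symm
  have hnn : ∀ σ : P → Fin 3 × Fin 3, 0 ≤ ∏ p : P, pairWeight (f p) (p : ℕ) (σ p) := fun σ =>
    Finset.prod_nonneg fun p _ => pairWeight_nonneg (hf p) _ _
  have h1 := hcost Prod.fst (Or.inl rfl)
  have h2 := hcost Prod.snd (Or.inr rfl)
  have h3 := hratio 1 (Or.inl rfl)
  have h4 := hratio (-1) (Or.inr rfl)
  rw [Finset.sum_filter] at h1 h2 h3 h4 hsize
  have hle : ∑ σ : P → Fin 3 × Fin 3, ∏ p : P, pairWeight (f p) (p : ℕ) (σ p) ≤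
      ∑ σ ∈ goodPairs (P := P) c Λ (τ * D) (4 * l * D), ∏ p : P, pairWeight (f p) (p : ℕ) (σ p) +
      5 * (1 / 10 * M) := by
    have h5 := add_le_add (add_le_add (add_le_add (add_le_add h1 h2) h3) h4) hsize
    simp only [← Finset.sum_add_distrib] at h5
    refine le_trans ?_ (add_le_add_right (h5.trans_eq (by ring)) _)
    unfold goodPairs
    rw [Finset.sum_filter, ← Finset.sum_add_distrib]
    refine Finset.sum_le_sum fun σ _ => ?_
    have h6 := hnn σ
    have hpos : ∀ Q : Prop, [Decidable Q] → 0 ≤ if Q then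
        ∏ p : P, pairWeight (f p) (p : ℕ) (σ p) else 0 := by
      intro Q _; split_ifs; exacts [h6, le_rfl]
    by_cases hg : (∑ p : P, (if (σ p).1 = 1 then 0 else c p) ≤ Λ ∧
        ∑ p : P, (if (σ p).2 = 1 then 0 else c p) ≤ Λ) ∧
        |∑ p : P, ((((σ p).2 - (σ p).1 : ℕ) : ℝ) - ((σ p).1 - (σ p).2 : ℕ)) *
          Real.log (p : ℕ)| ≤ τ * D ∧
        ∑ p : P, ((((σ p).2 - (σ p).1 : ℕ) : ℝ) + ((σ p).1 - (σ p).2 : ℕ)) *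
          Real.log (p : ℕ) ≤ 2 * (4 * l * D)
    · rw [if_pos hg]
      refine le_add_of_nonneg_right ?_
      exact add_nonneg (add_nonneg (add_nonneg (add_nonneg (hpos _) (hpos _)) (hpos _)) (hpos _))
        (hpos _)
    · rw [if_neg hg, zero_add]
      simp only [not_and_or, not_le] at hg
      have hcases : Λ ≤ ∑ p : P, (if (σ p).1 = 1 then 0 else c p) ∨
          Λ ≤ ∑ p : P, (if (σ p).2 = 1 then 0 else c p) ∨
          τ * D ≤ ∑ p : P, (1 : ℝ) * (((((σ p).2 - (σ p).1 : ℕ) : ℝ) - ((σ p).1 - (σ p).2 : ℕ)) *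
            Real.log (p : ℕ)) ∨
          τ * D ≤ ∑ p : P, (-1 : ℝ) * (((((σ p).2 - (σ p).1 : ℕ) : ℝ) -
            ((σ p).1 - (σ p).2 : ℕ)) * Real.log (p : ℕ)) ∨
          2 * (4 * l * D) ≤ ∑ p : P, ((((σ p).2 - (σ p).1 : ℕ) : ℝ) + ((σ p).1 - (σ p).2 : ℕ)) *
            Real.log (p : ℕ) := by
        rcases hg with (hg | hg) | hg | hg
        · exact Or.inl hg.le
        · exact Or.inr (Or.inl hg.le)
        · rw [← Finset.mul_sum, ← Finset.mul_sum, one_mul, neg_one_mul]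
          rcases lt_abs.1 hg with hg | hg
          · exact Or.inr (Or.inr (Or.inl hg.le))
          · exact Or.inr (Or.inr (Or.inr (Or.inl hg.le)))
        · exact Or.inr (Or.inr (Or.inr (Or.inr hg.le)))
      have p1 := hpos (Λ ≤ ∑ p : P, (if (σ p).1 = 1 then 0 else c p))
      have p2 := hpos (Λ ≤ ∑ p : P, (if (σ p).2 = 1 then 0 else c p))
      have p3 := hpos (τ * D ≤ ∑ p : P, (1 : ℝ) * (((((σ p).2 - (σ p).1 : ℕ) : ℝ) -
        ((σ p).1 - (σ p).2 : ℕ)) * Real.log (p : ℕ)))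
      have p4 := hpos (τ * D ≤ ∑ p : P, (-1 : ℝ) * (((((σ p).2 - (σ p).1 : ℕ) : ℝ) -
        ((σ p).1 - (σ p).2 : ℕ)) * Real.log (p : ℕ)))
      have p5 := hpos (2 * (4 * l * D) ≤ ∑ p : P, ((((σ p).2 - (σ p).1 : ℕ) : ℝ) +
        ((σ p).1 - (σ p).2 : ℕ)) * Real.log (p : ℕ))
      rcases hcases with h | h | h | h | h
      · rw [if_pos h] at p1 ⊢; linarith
      · rw [if_pos h] at p2 ⊢; linarith
      · rw [if_pos h] at p3 ⊢; linarith
      · rw [if_pos h] at p4 ⊢; linarith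
      · rw [if_pos h] at p5 ⊢; linarith
  rw [htot] at hle
  rw [hMeq]
  linarith

/-- The gain of the resonator over its norm. -/
lemma exp_mul_prod_le {f : ℕ → ℝ} (hf : ∀ p, 0 ≤ f p) {τ D : ℝ}
    (hsmall : ∀ p ∈ P, 2 * f p ^ 2 + 4 * (f p / Real.sqrt p) ≤ τ)
    (hD : D = ∑ p ∈ P, 4 * (f p / Real.sqrt p)) :
    Real.exp (D / (1 + τ)) * ∏ p ∈ P, (1 + 2 * f p ^ 2) ≤
      ∏ p ∈ P, (1 + 2 * f p ^ 2 + 4 * (f p / Real.sqrt p)) := by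
  rw [hD, Finset.sum_div, Real.exp_sum, ← Finset.prod_mul_distrib]
  refine Finset.prod_le_prod (fun p _ => by positivity) fun p hp => ?_
  have ht : 0 ≤ 4 * (f p / Real.sqrt p) :=
    mul_nonneg (by norm_num) (div_nonneg (hf p) (Real.sqrt_nonneg _))
  have hs := hsmall p hp
  set t := 4 * (f p / Real.sqrt p)
  set g := 1 + 2 * f p ^ 2 with hg
  have hg1 : 1 ≤ g := by nlinarith [sq_nonneg (f p)]
  have hgt : 0 < g + t := by linarith
  have h1 : t / (1 + τ) ≤ t / (g + t) := div_le_div_of_nonneg_left ht hgt (by linarith)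
  have h2 := Real.add_one_le_exp (-(t / (g + t)))
  have h3 : -(t / (g + t)) + 1 = g / (g + t) := by field_simp; ring
  rw [h3, Real.exp_neg, ← one_div] at h2
  calc Real.exp (t / (1 + τ)) * g ≤ Real.exp (t / (g + t)) * g := by gcongr
    _ = Real.exp (t / (g + t)) * (g / (g + t)) * (g + t) := by field_simp
    _ ≤ Real.exp (t / (g + t)) * (1 / Real.exp (t / (g + t))) * (g + t) := by gcongr
    _ = g + t := by field_simp

end Mass

/-! ### Integers prime to `q` in short initial segments -/

/-- A lower bound, with a polynomial loss in the bound `u` for the number of prime factors of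
`q`, for the number of integers up to `K` prime to `q`. For `log K ≤ u ^ 2` the primes suffice,
and for larger `K` inclusion–exclusion does. -/
lemma div_pow_three_le_card_coprimeUpTo {q : ℕ} (hq : q ≠ 0) {u K : ℝ} (hu : 200000 ≤ u)
    (hω : (q.primeFactors.card : ℝ) ≤ u) (hK : Real.exp (Real.sqrt u) ≤ K) :
    1 / u ^ 3 * K ≤ (coprimeUpTo q K).card := by
  have hu0 : 0 < u := by linarith
  have hK4 : 4 * u ^ 3 ≤ K := by
    have h1 := Real.pow_div_factorial_le_exp (Real.sqrt u) (Real.sqrt_nonneg _) 8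
    have h2 : Real.sqrt u ^ 8 = u ^ 4 := by
      rw [show (8 : ℕ) = 2 * 4 by norm_num, pow_mul, Real.sq_sqrt hu0.le]
    rw [h2] at h1
    have h3 : ((Nat.factorial 8 : ℕ) : ℝ) = 40320 := by norm_num [Nat.factorial]
    rw [h3] at h1
    have h4 : 4 * u ^ 3 ≤ u ^ 4 / 40320 := by
      rw [le_div_iff₀ (by norm_num)]
      have : 0 < u ^ 3 := by positivity
      nlinarith
    linarith
  have hu3 : (200000 : ℝ) ^ 3 ≤ u ^ 3 := by gcongr
  have hK1 : 1000 ≤ K := by linarith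
  have hK0 : 0 < K := by linarith
  rcases le_or_gt (Real.log K) (u ^ 2) with h | h
  -- at most `u` primes divide `q`, far fewer than the primes up to `K`
  · have hlK : 0 < Real.log K := Real.log_pos (by linarith)
    have h1 := Chebyshev.pi_ge' (x := K) (by linarith)
    have h2 : K / 2 ≤ (K - 1) * Real.log 2 - Real.log (K + 2) := by
      have h3 : Real.log (K + 2) ≤ K / 20 + 3 := by
        have h4 := Real.log_le_sub_one_of_pos (show 0 < (K + 2) / 20 by positivity)
        rw [Real.log_div (by linarith) (by norm_num)] at h4
        have h5 : Real.log 20 ≤ Real.log (2 ^ (5 : ℕ)) :=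
          Real.log_le_log (by norm_num) (by norm_num)
        rw [Real.log_pow] at h5
        push_cast at h5
        linarith [Real.log_two_lt_d9]
      nlinarith [Real.log_two_gt_d9]
    have h3 : K / 2 / u ^ 2 ≤ Nat.primeCounting ⌊K⌋₊ := by
      refine le_trans ?_ h1
      gcongr
      linarith
    have h4 : (Nat.primeCounting ⌊K⌋₊ : ℝ) ≤ (coprimeUpTo q K).card + q.primeFactors.card := by
      have h5 : Nat.primesLE ⌊K⌋₊ ⊆ coprimeUpTo q K ∪ q.primeFactors := by
        intro p hp
        obtain ⟨hp1, hpp⟩ := Nat.mem_primesLE.1 hp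
        rw [Nat.le_floor_iff' hpp.ne_zero] at hp1
        rw [Finset.mem_union, mem_coprimeUpTo, Nat.mem_primeFactors]
        by_cases hd : p ∣ q
        · exact Or.inr ⟨hpp, hd, hq⟩
        · exact Or.inl ⟨⟨hpp.one_le, hp1⟩, (hpp.coprime_iff_not_dvd).2 hd⟩
      have h6 := (Finset.card_le_card h5).trans (Finset.card_union_le _ _)
      rw [Nat.primesLE_card_eq_primeCounting] at h6
      exact_mod_cast h6
    have h5 : 1 / u ^ 3 * K + u ≤ K / 2 / u ^ 2 := by
      have e1 : K / 2 / u ^ 2 = (K * u / 2) / u ^ 3 := by field_simp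
      have e2 : 1 / u ^ 3 * K + u = (K + u * u ^ 3) / u ^ 3 := by field_simp
      rw [e1, e2]
      gcongr
      nlinarith
    linarith
  -- the error term `2 ^ ω(q)` is now negligible
  · have h1 := (abs_le.1 (abs_card_coprimeUpTo_sub_le hq hK0.le)).1
    have h2 := two_pow_le_exp hω
    have hφ : 1 / (u + 1) ≤ (q.totient : ℝ) / q :=
      (one_div_le_one_div_of_le (Nat.cast_add_one_pos _) (by linarith)).trans
        (inv_card_add_one_le_totient_div hq)
    have h3 : K * (1 / (u + 1)) ≤ K * (q.totient / q) := by gcongr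
    have h4 : Real.exp (u + u) ≤ K := by
      rw [← Real.le_log_iff_exp_le hK0]
      nlinarith
    have h5 : 2 * (u + 1) ≤ Real.exp u := by
      have h6 := Real.quadratic_le_exp_of_nonneg hu0.le
      nlinarith
    have h6 : Real.exp (7 / 10 * u) ≤ K / (2 * (u + 1)) := by
      rw [le_div_iff₀ (by positivity)]
      refine le_trans ?_ h4
      rw [Real.exp_add]
      gcongr
      linarith
    have h7 : 1 / u ^ 3 * K ≤ K / (2 * (u + 1)) := by
      rw [one_div, inv_mul_eq_div]
      gcongr
      nlinarith [sq_nonneg u]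
    have h8 : K * (1 / (u + 1)) = K / (2 * (u + 1)) + K / (2 * (u + 1)) := by
      field_simp; norm_num
    linarith

/-! ### The window of primes -/

/-- The window of primes used by the resonator. Writing `l = log log y`, it consists of the primes
with `l + a < log p ≤ l + b`, where `a` is about `l ^ τ` and `b` about `l ^ (1 - τ)`. -/
lemma eventually_exists_window {τ : ℝ} (hτ : 0 < τ) (hτ1 : τ ≤ 1 / 24) :
    ∀ᶠ l : ℝ in atTop, ∃ a b : ℕ, 1 ≤ a ∧ a ≤ b ∧ (b : ℝ) ≤ τ * l ∧
      (1 - 2 * τ) * Real.log l - 1 ≤ Real.log ((b : ℝ) / a) ∧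
      l * Real.exp (-(a : ℝ)) ≤ τ ^ 2 / 64 ∧ 6 * l * Real.exp (-(τ * a)) ≤ τ := by
  have hpow : Tendsto (fun l : ℝ => l ^ τ) atTop atTop := tendsto_rpow_atTop hτ
  -- `l * exp (-c * l ^ τ) → 0` for every `c > 0`
  have hdecay : ∀ c : ℝ, 0 < c →
      Tendsto (fun l : ℝ => l * Real.exp (-(c * l ^ τ))) atTop (𝓝 0) := by
    intro c hc
    have h1 := (tendsto_rpow_mul_exp_neg_mul_atTop_nhds_zero (1 / τ) c hc).comp hpow
    refine h1.congr' ?_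
    filter_upwards [eventually_gt_atTop 0] with l hl
    simp only [Function.comp]
    rw [← Real.rpow_mul hl.le, mul_one_div_cancel hτ.ne', Real.rpow_one]
    ring_nf
  have e1 := (hdecay 1 one_pos).eventually_le_const
    (show 0 < τ ^ 2 / 64 / Real.exp 1 by positivity)
  have e2 := (hdecay τ hτ).eventually_le_const
    (show 0 < τ / 6 / Real.exp τ by positivity)
  have e3 := hpow.eventually_ge_atTop (1 / τ)
  filter_upwards [e1, e2, e3, eventually_ge_atTop 1] with l h1 h2 h3 hl
  have hl0 : 0 < l := by linarith
  have hA1 : 1 ≤ l ^ τ := Real.one_le_rpow hl hτ.le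
  have hAB : l ^ τ ≤ l ^ (1 - τ) := Real.rpow_le_rpow_of_exponent_le hl (by linarith)
  have hmul : l ^ (1 - τ) * l ^ τ = l := by
    rw [← Real.rpow_add hl0]; simp
  have hfl := Nat.lt_floor_add_one (l ^ τ)
  have hfl' := Nat.floor_le (show 0 ≤ l ^ τ by positivity)
  have ha1 : 1 ≤ ⌊l ^ τ⌋₊ := (Nat.one_le_floor_iff _).2 hA1
  have ha1' : (1 : ℝ) ≤ ⌊l ^ τ⌋₊ := by exact_mod_cast ha1
  have hfB := Nat.lt_floor_add_one (l ^ (1 - τ))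
  have hfB' := Nat.floor_le (show 0 ≤ l ^ (1 - τ) by positivity)
  refine ⟨⌊l ^ τ⌋₊, ⌊l ^ (1 - τ)⌋₊, ha1, Nat.floor_le_floor hAB, ?_, ?_, ?_, ?_⟩
  · refine hfB'.trans ?_
    rw [div_le_iff₀ hτ] at h3
    have : 0 < l ^ (1 - τ) := by positivity
    nlinarith
  · have hb1' : (1 : ℝ) ≤ ⌊l ^ (1 - τ)⌋₊ := by exact_mod_cast ha1.trans (Nat.floor_le_floor hAB)
    have hb : l ^ (1 - τ) / 2 ≤ ⌊l ^ (1 - τ)⌋₊ := by linarith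
    have h4 : Real.log (l ^ (1 - τ) / 2) ≤ Real.log ⌊l ^ (1 - τ)⌋₊ :=
      Real.log_le_log (by positivity) hb
    have h5 : Real.log (⌊l ^ τ⌋₊ : ℝ) ≤ Real.log (l ^ τ) := Real.log_le_log (by linarith) hfl'
    rw [Real.log_div (by positivity) (by norm_num), Real.log_rpow hl0] at h4
    rw [Real.log_rpow hl0] at h5
    rw [Real.log_div (by linarith) (by linarith)]
    linarith [Real.log_two_lt_d9]
  · calc l * Real.exp (-(⌊l ^ τ⌋₊ : ℝ)) ≤ l * Real.exp (1 + -(1 * l ^ τ)) := by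
          gcongr; linarith
      _ = Real.exp 1 * (l * Real.exp (-(1 * l ^ τ))) := by rw [Real.exp_add]; ring
      _ ≤ Real.exp 1 * (τ ^ 2 / 64 / Real.exp 1) := by gcongr
      _ = _ := by field_simp
  · calc 6 * l * Real.exp (-(τ * ⌊l ^ τ⌋₊)) ≤ 6 * l * Real.exp (τ + -(τ * l ^ τ)) := by
          gcongr; nlinarith
      _ = 6 * Real.exp τ * (l * Real.exp (-(τ * l ^ τ))) := by rw [Real.exp_add]; ring
      _ ≤ 6 * Real.exp τ * (τ / 6 / Real.exp τ) := by gcongr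
      _ = _ := by field_simp

/-- A crude upper bound for the sum of the reciprocals of primes. -/
lemma sum_one_div_le_of_log_le {P : Finset ℕ} {M : ℝ} (hP : ∀ p ∈ P, 0 < p ∧ Real.log p ≤ M)
    (hM : 0 ≤ M) : ∑ p ∈ P, 1 / (p : ℝ) ≤ 1 + M := by
  have hsub : P ⊆ Finset.Icc 1 ⌊Real.exp M⌋₊ := fun p hp => by
    obtain ⟨h1, h2⟩ := hP p hp
    refine Finset.mem_Icc.2 ⟨h1, Nat.le_floor ?_⟩
    rwa [← Real.log_le_iff_le_exp (by exact_mod_cast h1)]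
  have h1 := harmonic_floor_le_one_add_log (Real.exp M) (Real.one_le_exp hM)
  rw [Real.log_exp] at h1
  refine le_trans ?_ h1
  rw [harmonic_eq_sum_Icc]
  push_cast
  simp only [one_div]
  exact Finset.sum_le_sum_of_subset_of_nonneg hsub fun _ _ _ => by positivity

/-! ### The optimal weights -/

/-- The resonator inequality for the optimal choice of weights: with `exp l = log y`, the weight
of a prime `p` is proportional to `1 / (√p * (log p - l))`, and its cost is `log p - l`, slightly
enlarged. The gain is `exp D` with `D ^ 2` close to `8 * log y * V`, where `V` is the sum of
`1 / (p * (log p - l))` over the primes used. -/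
lemma weighted_resonator_bound {P : Finset ℕ} {q : ℕ} [NeZero q] (hP : ∀ p ∈ P, p.Prime)
    (hPq : ∀ p ∈ P, p.Coprime q) {τ l a b V D x κ : ℝ} (hτ : 0 < τ) (hτ1 : τ ≤ 1 / 24)
    (hl : 1 ≤ l) (ha : 1 ≤ a) (hbl : b ≤ l)
    (hPab : ∀ p ∈ P, l + a < Real.log p ∧ Real.log p ≤ l + b)
    (hV : V = ∑ p ∈ P, 1 / ((p : ℝ) * (Real.log p - l))) (hVl : 1 ≤ 2 * l * V)
    (hla : l * Real.exp (-a) ≤ τ ^ 2 / 64) (hla' : 6 * l * Real.exp (-(τ * a)) ≤ τ)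
    (hD0 : 0 < D) (hD : D ^ 2 = 8 * (1 - 10 * τ) * Real.exp l * V)
    (hDb : 2 * b * D ≤ τ * Real.exp l) (hDl : 48 * l ^ 2 ≤ τ ^ 2 * D)
    (hb : 3 * b ≤ τ ^ 2 * Real.exp l) (hx : 0 < x) (hκ : 0 ≤ κ)
    (hN : ∀ K, x * Real.exp (-(5 * l * D)) ≤ K → κ * K ≤ (coprimeUpTo q K).card) :
    κ * x / 2 * Real.exp ((1 - 2 * τ) * D) ≤
      Delta x q ^ 2 + Real.exp ((1 - 4 * τ) * Real.exp l) * x ^ 2 / q.totient := by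
  set u := Real.exp l with hu
  have hu0 : 0 < u := Real.exp_pos _
  have hl0 : 0 < l := by linarith
  have hV0 : 0 < V := by
    by_contra! h
    linarith [mul_nonpos_of_nonneg_of_nonpos (show 0 ≤ 2 * l by positivity) h]
  have hPne : P.Nonempty := by
    rw [Finset.nonempty_iff_ne_empty]
    rintro rfl
    simp at hV
    linarith
  have hab : a ≤ b := by
    obtain ⟨p, hp⟩ := hPne
    linarith [hPab p hp]
  have hb0 : 0 < b := by linarith
  have h10 : 0 < 1 - 10 * τ := by linarith
  -- the normalisation `lam` makes the total cost of the weights equal to a little less than `u`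
  set lam := 4 * V / D with hlam
  have hlam0 : 0 < lam := by positivity
  have hlam2 : lam ^ 2 * ((1 - 10 * τ) * u) = 2 * V := by
    rw [hlam, div_pow, hD]; field_simp; norm_num
  set f : ℕ → ℝ := fun p => 1 / (lam * Real.sqrt p * |Real.log p - l|) with hf_def
  set c : ℕ → ℝ := fun p => (1 + τ) * (Real.log p - l) with hc_def
  have hf : ∀ p, 0 ≤ f p := fun p => by positivity
  have hj : ∀ p ∈ P, 1 ≤ Real.log p - l := fun p hp => by linarith [hPab p hp]
  have hp0 : ∀ p ∈ P, (0 : ℝ) < p := fun p hp => by exact_mod_cast (hP p hp).pos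
  have hfs : ∀ p ∈ P, f p / Real.sqrt p = 1 / lam * (1 / (p * (Real.log p - l))) := by
    intro p hp
    have h1 := hj p hp
    have h2 := hp0 p hp
    have h3 : Real.sqrt p ≠ 0 := (Real.sqrt_pos.2 h2).ne'
    have h4 : Real.log p - l ≠ 0 := by linarith
    simp only [hf_def]
    rw [abs_of_pos (by linarith)]
    have h5 := Real.mul_self_sqrt h2.le
    calc _ = 1 / lam * (1 / ((Real.sqrt p * Real.sqrt p) * (Real.log p - l))) := by
          field_simp
      _ = _ := by rw [h5]
  have hf2 : ∀ p ∈ P, f p ^ 2 = 1 / lam ^ 2 * (1 / (p * (Real.log p - l) ^ 2)) := by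
    intro p hp
    have h2 := hp0 p hp
    simp only [hf_def]
    rw [div_pow, mul_pow, mul_pow, Real.sq_sqrt h2.le, sq_abs]
    field_simp
  have hDsum : D = ∑ p ∈ P, 4 * (f p / Real.sqrt p) := by
    rw [Finset.sum_congr rfl fun p hp => by rw [hfs p hp], ← Finset.mul_sum, ← Finset.mul_sum,
      ← hV, hlam]
    field_simp
  -- the terms `f p ^ 2` give `(1 - 10 τ) u`, and the terms `f p / √p` only `O(b D)`
  have hcost : ∑ p ∈ P, c p * (2 * f p ^ 2 + 2 * (f p / Real.sqrt p)) ≤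
      (1 + τ) * ((1 - 10 * τ) * u + b * D / 2) := by
    have h1 : ∀ p ∈ P, c p * (2 * f p ^ 2 + 2 * (f p / Real.sqrt p)) ≤
        (1 + τ) * ((2 / lam ^ 2 + b * (2 / lam)) * (1 / (p * (Real.log p - l)))) := by
      intro p hp
      have h1 := hj p hp
      have h2 := hp0 p hp
      rw [hf2 p hp, hfs p hp]
      simp only [hc_def]
      rw [mul_assoc]
      refine mul_le_mul_of_nonneg_left ?_ (by linarith)
      have h4 : Real.log p - l ≠ 0 := by linarith
      have e1 : (Real.log p - l) * (2 * (1 / lam ^ 2 * (1 / (p * (Real.log p - l) ^ 2))) +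
          2 * (1 / lam * (1 / (p * (Real.log p - l))))) =
          (2 / lam ^ 2 + (Real.log p - l) * (2 / lam)) * (1 / (p * (Real.log p - l))) := by
        field_simp
      rw [e1]
      have h5 : (0 : ℝ) ≤ 1 / (p * (Real.log p - l)) := by positivity
      gcongr
      linarith [hPab p hp]
    refine (Finset.sum_le_sum h1).trans ?_
    rw [← Finset.mul_sum, ← Finset.mul_sum, ← hV]
    have e1 : 2 / lam ^ 2 * V = (1 - 10 * τ) * u := by
      field_simp; linarith
    have e2 : b * (2 / lam) * V = b * D / 2 := by
      rw [hlam]; field_simp; norm_num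
    rw [add_mul (2 / lam ^ 2), e1, e2]
  have hΛ : τ / (2 * b) * ((1 + τ) * ∑ p ∈ P, c p * (2 * f p ^ 2 + 2 * (f p / Real.sqrt p)) -
      (1 - 5 * τ) * u) ≤ -3 := by
    have h1 : (1 + τ) * ∑ p ∈ P, c p * (2 * f p ^ 2 + 2 * (f p / Real.sqrt p)) ≤
        (1 + τ) * ((1 + τ) * ((1 - 10 * τ) * u + b * D / 2)) := by gcongr
    have h2 : (1 + τ) * ((1 + τ) * ((1 - 10 * τ) * u + b * D / 2)) ≤ (1 - 7 * τ) * u := by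
      have h3 : (1 + τ) * (1 + τ) ≤ 1 + 5 / 2 * τ := by
        linarith [mul_le_mul_of_nonneg_left hτ1 hτ.le]
      have h4 : 0 ≤ (1 - 10 * τ) * u + b * D / 2 := by positivity
      calc _ = ((1 + τ) * (1 + τ)) * ((1 - 10 * τ) * u + b * D / 2) := by ring
        _ ≤ (1 + 5 / 2 * τ) * ((1 - 10 * τ) * u + τ * u / 4) :=
            mul_le_mul h3 (by linarith) h4 (by linarith)
        _ ≤ _ := by
            linarith [mul_pos hτ hu0, mul_pos (mul_pos hτ hτ) hu0]
    calc _ ≤ τ / (2 * b) * (-(2 * τ * u)) := by gcongr; linarith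
      _ = -(τ ^ 2 * u / b) := by field_simp
      _ ≤ -3 := by
        rw [neg_le_neg_iff, le_div_iff₀ hb0]; exact hb
  have hgood := half_le_sum_goodPairs (P := P) (f := f) (c := c) hf (B := 2 * b) (l := l) (τ := τ)
    (α := τ / (2 * b)) (Λ := (1 - 5 * τ) * u) (D := D)
    (fun p hp => by
      have h1 := hj p hp
      have h2 := hPab p hp
      simp only [hc_def]
      exact ⟨mul_nonneg (by linarith) (by linarith),
        mul_le_mul (by linarith) (by linarith) (by linarith) (by norm_num)⟩)
    (fun p hp => by linarith [hPab p hp]) hDsum hτ (by linarith) hl (by positivity)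
    (by rw [div_mul_cancel₀ _ (by positivity)]) hΛ hDl
  -- each prime of the window exceeds `u * exp a`, so that the weights are small
  have hsmall : ∀ p ∈ P, 2 * f p ^ 2 + 4 * (f p / Real.sqrt p) ≤ τ := by
    intro p hp
    have h1 := hj p hp
    have h2 := hp0 p hp
    have hpu : u * Real.exp a ≤ p := by
      rw [hu, ← Real.exp_add, ← Real.le_log_iff_exp_le h2]
      exact (hPab p hp).1.le
    have hp1 : (1 : ℝ) ≤ p := by exact_mod_cast (hP p hp).one_le
    have h3 : f p ^ 2 ≤ (τ / 8) ^ 2 := by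
      calc f p ^ 2 = 1 / lam ^ 2 * (1 / (p * (Real.log p - l) ^ 2)) := hf2 p hp
        _ ≤ 1 / lam ^ 2 * (1 / (u * Real.exp a * 1)) := by
            gcongr; exact one_le_pow₀ h1
        _ = (1 - 10 * τ) / (2 * V) * Real.exp (-a) := by
            rw [← hlam2, Real.exp_neg]; field_simp
        _ ≤ l * Real.exp (-a) := by
            gcongr
            rw [div_le_iff₀ (by positivity)]
            linarith
        _ ≤ (τ / 8) ^ 2 := by linarith
    have h4 : f p ≤ τ / 8 := by
      refine le_of_sq_le_sq h3 (by positivity) 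
    have h5 : f p / Real.sqrt p ≤ f p := div_le_self (hf p) (by rwa [Real.one_le_sqrt])
    linarith [mul_le_mul_of_nonneg_left hτ1 hτ.le]
  have hprod := exp_mul_prod_le (P := P) hf hsmall hDsum
  -- `exp (-(log p - l)) = u / p`, and the slight enlargement of the cost gains a factor `exp (-τ
  -- a)`
  have hloss : 2 * ∑ p ∈ P, Real.exp (-c p) ≤ τ * u := by
    have h1 : ∀ p ∈ P, Real.exp (-c p) ≤ u * Real.exp (-(τ * a)) * (1 / p) := by
      intro p hp
      have h2 := hp0 p hp
      have e : -c p = l + -(τ * (Real.log p - l)) - Real.log p := by simp only [hc_def]; ring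
      rw [e, Real.exp_sub, Real.exp_log h2, Real.exp_add, div_eq_mul_one_div, ← hu]
      gcongr
      linarith [hPab p hp]
    have h2 := sum_one_div_le_of_log_le (P := P) (M := l + b)
      (fun p hp => ⟨(hP p hp).pos, (hPab p hp).2⟩) (by positivity)
    calc 2 * ∑ p ∈ P, Real.exp (-c p) ≤ 2 * ∑ p ∈ P, u * Real.exp (-(τ * a)) * (1 / p) := by
          gcongr with p hp; exact h1 p hp
      _ = 2 * (u * Real.exp (-(τ * a)) * ∑ p ∈ P, 1 / (p : ℝ)) := by rw [← Finset.mul_sum]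
      _ ≤ 2 * (u * Real.exp (-(τ * a)) * (3 * l)) := by gcongr; linarith
      _ = u * (6 * l * Real.exp (-(τ * a))) := by ring
      _ ≤ u * τ := by gcongr
      _ = _ := by ring
  have hmain := resonator_bound (P := P) hP hPq (c := c) hf (Λ := (1 - 5 * τ) * u) (T := τ * D)
    (Z := 4 * l * D) hx hκ (fun K hK => hN K (le_trans (by
      gcongr
      linarith [mul_le_mul_of_nonneg_right (show τ / 2 ≤ l by linarith) hD0.le]) hK))
  set R := ∏ p ∈ P, (1 + 2 * f p ^ 2) with hR
  have hR0 : 0 < R := Finset.prod_pos fun p _ => by positivity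
  refine le_of_mul_le_mul_right (le_trans ?_ (hmain.trans ?_)) hR0
  · calc κ * x / 2 * Real.exp ((1 - 2 * τ) * D) * R
        ≤ κ * x / 2 * (Real.exp (-(τ * D / 2)) * Real.exp (D / (1 + τ))) * R := by
          rw [← Real.exp_add]
          gcongr
          have : (1 - τ) * D ≤ D / (1 + τ) := by
            rw [le_div_iff₀ (by linarith)]; linarith [mul_nonneg (sq_nonneg τ) hD0.le]
          linarith [mul_pos hτ hD0]
      _ = κ * x * Real.exp (-(τ * D / 2)) * (1 / 2 * (Real.exp (D / (1 + τ)) * R)) := by ring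
      _ ≤ _ := by
          gcongr
          refine le_trans ?_ hgood
          gcongr
  · gcongr
    linarith

/-! ### Evaluation of the resonator bound -/

/-- The sum over the window is at least nearly `log l / l` by Mertens' theorem; the upper bound is
crude. -/
lemma bounds_sum_window {q : ℕ} (hq : q ≠ 0) {τ l : ℝ} {a b : ℕ} (hτ : 0 < τ)
    (hτ1 : 51 * τ ≤ 1) (hl : 2 ≤ l) (ha : 1 ≤ a) (hab : a ≤ b) (hb : (b : ℝ) ≤ τ * l)
    (hba : (1 - 2 * τ) * Real.log l - 1 ≤ Real.log ((b : ℝ) / a))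
    (hla : l * Real.exp (-(a : ℝ)) ≤ τ ^ 2 / 64) (hL : 9 ≤ τ * Real.log l)
    (hω : (q.primeFactors.card : ℝ) ≤ Real.exp l) {V : ℝ}
    (hV : V = ∑ p ∈ (logPrimes (l + a) (l + b)).filter (fun p => ¬ p ∣ q),
      1 / ((p : ℝ) * (Real.log p - l))) :
    (1 - 5 * τ) * (Real.log l / l) ≤ V ∧ V ≤ 3 * l := by
  have hl0 : 0 < l := by linarith
  have ha1 : (1 : ℝ) ≤ a := by exact_mod_cast ha
  have hLpos : 0 < Real.log l := Real.log_pos (by linarith)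
  constructor
  · have h1 := log_div_le_sum_logPrimes_not_dvd hl0.le ha hab hq hω
    rw [← hV] at h1
    have h2 : (1 - 4 * τ) * (Real.log l / l) ≤ (Real.log ((b : ℝ) / a) - 8) / (l + b) := by
      rw [le_div_iff₀ (by positivity)]
      calc (1 - 4 * τ) * (Real.log l / l) * (l + b)
          ≤ (1 - 4 * τ) * (Real.log l / l) * (l + τ * l) := by
            have : 0 ≤ (1 - 4 * τ) * (Real.log l / l) :=
              mul_nonneg (by linarith) (by positivity)
            gcongr
        _ = (1 - 4 * τ) * (1 + τ) * Real.log l := by field_simp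
        _ ≤ (1 - 3 * τ) * Real.log l := by
            gcongr
            linarith [mul_pos hτ hτ]
        _ ≤ _ := by linarith
    have h3 : Real.exp (-(a : ℝ)) ≤ τ * (Real.log l / l) := by
      rw [← mul_div_assoc, le_div_iff₀ hl0, mul_comm]
      refine hla.trans (le_trans ?_ hL)
      nlinarith
    linarith
  · have h1 := sum_one_div_le_of_log_le (M := l + b)
      (P := (logPrimes (l + a) (l + b)).filter (fun p => ¬ p ∣ q))
      (fun p hp => by
        obtain ⟨h1, h2, h3⟩ := mem_logPrimes.1 (Finset.mem_filter.1 hp).1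
        exact ⟨h1.pos, h3⟩) (by positivity)
    have h2 : V ≤ 1 + (l + b) := by
      rw [hV]
      refine le_trans (Finset.sum_le_sum fun p hp => ?_) h1
      obtain ⟨h1, h2, h3⟩ := mem_logPrimes.1 (Finset.mem_filter.1 hp).1
      have hp : (0 : ℝ) < p := by exact_mod_cast h1.pos
      gcongr
      exact le_mul_of_one_le_right hp.le (by linarith)
    nlinarith

/-- The size of the contribution of the principal character, before the number of vectors used in
the resonator is taken into account. -/
lemma sq_div_totient_le {q : ℕ} (hq : q ≠ 0) {x u : ℝ} (hx : 0 < x)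
    (hy : (q : ℝ) = x * Real.exp u) (hω : (q.primeFactors.card : ℝ) ≤ u) :
    x ^ 2 / q.totient ≤ x * ((u + 1) * Real.exp (-u)) := by
  have hq0 : (0 : ℝ) < q := by exact_mod_cast Nat.pos_of_ne_zero hq
  have hφ0 : (0 : ℝ) < q.totient := by exact_mod_cast Nat.totient_pos.2 (Nat.pos_of_ne_zero hq)
  have hu : 0 ≤ u := (Nat.cast_nonneg _).trans hω
  have hφ : 1 / (u + 1) ≤ (q.totient : ℝ) / q :=
    (one_div_le_one_div_of_le (Nat.cast_add_one_pos _) (by linarith)).trans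
      (inv_card_add_one_le_totient_div hq)
  rw [div_le_div_iff₀ (by positivity) hq0, one_mul, hy] at hφ
  rw [div_le_iff₀ hφ0, Real.exp_neg]
  have : x * ((u + 1) * (Real.exp u)⁻¹) * q.totient =
      x * (Real.exp u)⁻¹ * (q.totient * (u + 1)) := by ring
  rw [this]
  calc x ^ 2 = x * (Real.exp u)⁻¹ * (x * Real.exp u) := by field_simp
    _ ≤ _ := by gcongr

lemma add_one_le_exp_mul {τ u : ℝ} (hτ : 0 < τ) (hu : 0 < u) (h : 1 ≤ τ * (τ * u)) :
    u + 1 ≤ Real.exp (4 * τ * u) := by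
  have h2 := Real.quadratic_le_exp_of_nonneg (show 0 ≤ 4 * τ * u by positivity)
  have h3 : 1 * u ≤ (τ * (τ * u)) * u := by gcongr
  have h4 : 0 < 4 * τ * u := by positivity
  have h5 : (4 * τ * u) ^ 2 / 2 = 8 * ((τ * (τ * u)) * u) := by ring
  linarith

/-- The exponent of the gain, `D = √(8 u V)` up to a small loss with `V` about `log l / l`,
compared with the exponent `√(u * log l / l)` of `scriptL`. The term `3 * l + 2` absorbs the loss
`1 / u ^ 3` in the count of integers prime to `q`. -/
lemma gain_exponent {τ l u V D : ℝ} (hτ : 0 < τ) (hτ1 : 51 * τ ≤ 1) (hl : 2 ≤ l) (hu0 : 0 < u)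
    (hLge : 1 ≤ Real.log l) (hpoly : 25 * l ^ 3 ≤ τ ^ 2 * u) (hD0 : 0 < D)
    (hD : D ^ 2 = 8 * (1 - 10 * τ) * u * V) (hV : (1 - 5 * τ) * (Real.log l / l) ≤ V) :
    2 * ((Real.sqrt 2 - 51 * τ) * Real.sqrt (u * (Real.log l / l))) + (3 * l + 2) ≤
      (1 - 2 * τ) * D := by
  have hl0 : 0 < l := by linarith
  have h10 : 0 < 1 - 10 * τ := by linarith
  set G := Real.sqrt (u * (Real.log l / l)) with hG
  have hG2 : G ^ 2 = u * (Real.log l / l) := Real.sq_sqrt (by positivity)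
  have hG0 : 0 ≤ G := Real.sqrt_nonneg _
  have h2sq : Real.sqrt 2 ^ 2 = 2 := Real.sq_sqrt (by norm_num)
  have hs2 : Real.sqrt 2 ≤ 3 / 2 := by
    refine le_of_sq_le_sq ?_ (by norm_num)
    rw [h2sq]; norm_num
  have hDG : 2 * Real.sqrt 2 * (1 - 15 * τ) * G ≤ D := by
    refine le_of_sq_le_sq ?_ hD0.le
    rw [hD]
    calc (2 * Real.sqrt 2 * (1 - 15 * τ) * G) ^ 2
        = 4 * Real.sqrt 2 ^ 2 * (1 - 15 * τ) ^ 2 * G ^ 2 := by ring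
      _ = 8 * u * (1 - 15 * τ) ^ 2 * (Real.log l / l) := by rw [h2sq, hG2]; ring
      _ ≤ 8 * u * ((1 - 10 * τ) * (1 - 5 * τ)) * (Real.log l / l) := by
          gcongr
          nlinarith
      _ = 8 * (1 - 10 * τ) * u * ((1 - 5 * τ) * (Real.log l / l)) := by ring
      _ ≤ _ := by gcongr
  have hmain : 2 * ((Real.sqrt 2 - 51 * τ) * G) + 51 * τ * G ≤ (1 - 2 * τ) * D := by
    calc 2 * ((Real.sqrt 2 - 51 * τ) * G) + 51 * τ * G
        = (2 * Real.sqrt 2 - 51 * τ) * G := by ring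
      _ ≤ (1 - 2 * τ) * (2 * Real.sqrt 2 * (1 - 15 * τ)) * G := by
          gcongr
          have h1 : Real.sqrt 2 * τ ≤ 3 / 2 * τ := by gcongr
          have h2 : 0 ≤ Real.sqrt 2 * (τ * τ) := by positivity
          linarith
      _ = (1 - 2 * τ) * (2 * Real.sqrt 2 * (1 - 15 * τ) * G) := by ring
      _ ≤ _ := mul_le_mul_of_nonneg_left hDG (by linarith)
  have hslack : 5 * l ≤ 51 * τ * G := by
    refine le_of_sq_le_sq (le_of_mul_le_mul_right ?_ hl0) (by positivity)
    calc (5 * l) ^ 2 * l = 25 * l ^ 3 := by ring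
      _ ≤ 1 * (τ ^ 2 * u) * 1 := by linarith
      _ ≤ 2601 * (τ ^ 2 * u) * Real.log l := by gcongr; norm_num
      _ = 2601 * τ ^ 2 * (u * (Real.log l / l)) * l := by field_simp
      _ = _ := by rw [← hG2]; ring
  linarith

set_option maxHeartbeats 1000000 in
/-- The resonator bound for one pair `(x, q)`, under explicit conditions saying that
`l = log log (q / x)` is large. -/
lemma mul_exp_le_Delta_sq {q : ℕ} (hq : q ≠ 0) {ε τ l x : ℝ} {a b : ℕ} (hε : 0 < ε)
    (hτ : 0 < τ) (hτ1 : 51 * τ ≤ 1) (hl : 2 ≤ l) (ha : 1 ≤ a) (hab : a ≤ b)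
    (hb : (b : ℝ) ≤ τ * l)
    (hba : (1 - 2 * τ) * Real.log l - 1 ≤ Real.log ((b : ℝ) / a))
    (hla : l * Real.exp (-(a : ℝ)) ≤ τ ^ 2 / 64) (hla' : 6 * l * Real.exp (-(τ * a)) ≤ τ)
    (hL : 9 ≤ τ * Real.log l) (hpoly : 2304 * l ^ 5 ≤ τ ^ 4 * Real.exp l)
    (hexp : 50 * l ^ 2 ≤ Real.exp (ε * l)) (hu : 200000 ≤ Real.exp l)
    (hx : Real.exp (Real.log q ^ (1 / 2 + ε)) ≤ x)
    (hxq : x ≤ q / Real.exp ((1 + ε) * q.primeFactors.card))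
    (hy : Real.log (q / x) = Real.exp l) :
    x * Real.exp (2 * ((Real.sqrt 2 - 51 * τ) * Real.sqrt (Real.exp l * (Real.log l / l)))) ≤
      Delta x q ^ 2 := by
  have : NeZero q := ⟨hq⟩
  have hl0 : 0 < l := by linarith
  have hx0 : 0 < x := (Real.exp_pos _).trans_le hx
  have hq0 : (0 : ℝ) < q := by exact_mod_cast Nat.pos_of_ne_zero hq
  set u := Real.exp l with hudef
  have hu0 : 0 < u := Real.exp_pos _
  have hqx : (q : ℝ) = x * Real.exp u := by
    rw [← hy, Real.exp_log (by positivity)]; field_simp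
  have hlogq : Real.log q = Real.log x + u := by
    rw [hqx, Real.log_mul hx0.ne' (Real.exp_pos _).ne', Real.log_exp]
  have hω : (q.primeFactors.card : ℝ) ≤ u := by
    rw [le_div_iff₀ (Real.exp_pos _), ← le_div_iff₀' hx0, ← Real.le_log_iff_exp_le (by positivity),
      hy] at hxq
    exact (le_mul_of_one_le_left (Nat.cast_nonneg _) (by linarith only [hε])).trans hxq
  set s := Real.exp (l / 2) with hs
  have hs0 : 0 < s := Real.exp_pos _
  have hsu : s ^ 2 = u := by rw [hs, hudef, ← Real.exp_nat_mul]; congr 1; push_cast; ring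
  -- this is where the lower bound on `x` enters: `√x` exceeds the integers `a₀`, `b₀` that
  -- occur, whose logarithms are at most `5 l D`, of order `l ^ 2 * √u`
  have hlx : 50 * l ^ 2 * s ≤ Real.log x := by
    have h1 : Real.log q ^ (1 / 2 + ε) ≤ Real.log x := (Real.le_log_iff_exp_le hx0).2 hx
    have h2 : 0 ≤ Real.log x :=
      le_trans (Real.rpow_nonneg (Real.log_natCast_nonneg q) _) h1
    have h3 : u ^ (1 / 2 + ε) ≤ Real.log q ^ (1 / 2 + ε) :=
      Real.rpow_le_rpow hu0.le (by linarith) (by linarith)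
    have h4 : u ^ (1 / 2 + ε) = Real.exp (ε * l) * s := by
      rw [hudef, ← Real.exp_mul, hs, ← Real.exp_add]; congr 1; ring
    have h5 : 50 * l ^ 2 * s ≤ Real.exp (ε * l) * s := by gcongr
    linarith
  have hτ4 : τ ^ 4 ≤ τ := by
    calc τ ^ 4 = τ * τ ^ 3 := by ring
      _ ≤ τ * 1 := by gcongr; exact pow_le_one₀ hτ.le (by linarith)
      _ = τ := mul_one τ
  have hl45 : l ^ 4 ≤ l ^ 5 := pow_le_pow_right₀ (by linarith) (by norm_num)
  have hl5 : l ≤ l ^ 5 := le_self_pow₀ (by linarith) (by norm_num)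
  have hτu : 2304 * l ^ 5 ≤ τ * u := hpoly.trans (by gcongr)
  have hsl : 10 * l ^ 2 ≤ s := by
    refine le_of_sq_le_sq ?_ hs0.le
    rw [hsu]
    have : τ * u ≤ 1 * u := by gcongr; linarith
    calc (10 * l ^ 2) ^ 2 = 100 * l ^ 4 := by ring
      _ ≤ 2304 * l ^ 5 := by linarith [pow_pos hl0 4]
      _ ≤ u := by linarith
  set P := (logPrimes (l + a) (l + b)).filter (fun p => ¬ p ∣ q) with hP
  set V := ∑ p ∈ P, 1 / ((p : ℝ) * (Real.log p - l)) with hV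
  obtain ⟨hV1, hV2⟩ := bounds_sum_window hq hτ hτ1 hl ha hab hb hba hla hL hω hV
  have hLge : 459 ≤ Real.log l := by
    linarith [mul_le_mul_of_nonneg_right hτ1 (Real.log_pos (show 1 < l by linarith)).le]
  have hVl : 1 ≤ 2 * l * V := by
    have h1 : 1 / 2 * (Real.log l / l) ≤ V := le_trans (by gcongr; linarith) hV1
    calc (1 : ℝ) ≤ Real.log l := by linarith
      _ = 2 * l * (1 / 2 * (Real.log l / l)) := by field_simp
      _ ≤ _ := by gcongr
  have hV0 : 0 < V := by
    by_contra! h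
    linarith [mul_nonpos_of_nonneg_of_nonpos (show 0 ≤ 2 * l by positivity) h]
  have h10 : 0 < 1 - 10 * τ := by linarith
  set D := Real.sqrt (8 * (1 - 10 * τ) * u * V) with hDdef
  have hDpos : 0 < 8 * (1 - 10 * τ) * u * V := by positivity
  have hD0 : 0 < D := Real.sqrt_pos.2 hDpos
  have hD : D ^ 2 = 8 * (1 - 10 * τ) * u * V := Real.sq_sqrt hDpos.le
  have hDs : D ≤ 5 * l * s := by
    refine le_of_sq_le_sq ?_ (by positivity)
    rw [hD]
    calc 8 * (1 - 10 * τ) * u * V ≤ 8 * 1 * u * (3 * l) := by gcongr; linarith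
      _ = 24 * u * (l * 1) := by ring
      _ ≤ 25 * u * (l * l) := by gcongr <;> linarith
      _ = _ := by rw [← hsu]; ring
  have hres := weighted_resonator_bound (P := P) (q := q) (τ := τ) (l := l) (a := a) (b := b)
    (V := V) (D := D) (x := x) (κ := 1 / u ^ 3)
    (fun p hp => (mem_logPrimes.1 (Finset.mem_filter.1 hp).1).1)
    (fun p hp => ((mem_logPrimes.1 (Finset.mem_filter.1 hp).1).1.coprime_iff_not_dvd).2
      (Finset.mem_filter.1 hp).2)
    hτ (by linarith) (by linarith) (by exact_mod_cast ha)
    (hb.trans (mul_le_of_le_one_left hl0.le (by linarith)))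
    (fun p hp => (mem_logPrimes.1 (Finset.mem_filter.1 hp).1).2) hV hVl hla hla' hD0 hD
    (by
      calc 2 * b * D ≤ 2 * (τ * l) * (5 * l * s) := by gcongr
        _ = τ * (10 * l ^ 2 * s) := by ring
        _ ≤ τ * (s * s) := by gcongr
        _ = τ * u := by rw [← hsu]; ring)
    (by
      refine le_of_sq_le_sq ?_ (by positivity)
      have h1 : 1 ≤ 8 * (1 - 10 * τ) * l * V := by
        calc (1 : ℝ) ≤ 2 * l * V := hVl
          _ = 2 * (l * V) := by ring
          _ ≤ (8 * (1 - 10 * τ)) * (l * V) := by gcongr; linarith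
          _ = _ := by ring
      have h2 : (48 * l ^ 2) ^ 2 * l ≤ (τ ^ 2 * D) ^ 2 * l := by
        calc (48 * l ^ 2) ^ 2 * l = 2304 * l ^ 5 := by ring
          _ ≤ τ ^ 4 * u * 1 := by linarith
          _ ≤ τ ^ 4 * u * (8 * (1 - 10 * τ) * l * V) := by gcongr
          _ = τ ^ 4 * (8 * (1 - 10 * τ) * u * V) * l := by ring
          _ = _ := by rw [← hD]; ring
      exact le_of_mul_le_mul_right h2 hl0)
    (by
      calc 3 * (b : ℝ) ≤ 3 * (τ * l) := by gcongr
        _ = τ * (3 * l) := by ring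
        _ ≤ τ * (τ * u) := mul_le_mul_of_nonneg_left (by linarith) hτ.le
        _ = _ := by ring)
    hx0 (by positivity)
    (fun K hK => div_pow_three_le_card_coprimeUpTo hq hu hω (le_trans ?_ hK))
  swap
  · rw [← hsu, Real.sqrt_sq hs0.le]
    have e : x * Real.exp (-(5 * l * D)) = Real.exp (Real.log x + -(5 * l * D)) := by
      rw [Real.exp_add, Real.exp_log hx0]
    rw [e]
    refine Real.exp_le_exp.2 ?_
    have h1 : 5 * l * D ≤ 5 * l * (5 * l * s) := by gcongr
    have h2 : 1 * s ≤ l ^ 2 * s := by gcongr; exact one_le_pow₀ (by linarith only [hl])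
    linarith only [h1, h2, hlx, mul_pos (pow_pos hl0 2) hs0]
  have hτ42 : τ ^ 4 * u ≤ τ ^ 2 * u :=
    mul_le_mul_of_nonneg_right (pow_le_pow_of_le_one hτ.le (by linarith) (by norm_num)) hu0.le
  -- the exponent `(1 - 4 τ) u` of the number of vectors is smaller than `log (q / x) = u`
  have hneg : Real.exp ((1 - 4 * τ) * u) * x ^ 2 / q.totient ≤ x := by
    have h1 := add_one_le_exp_mul hτ hu0 (show 1 ≤ τ * (τ * u) by
      linarith only [hpoly, hτ42, one_le_pow₀ (n := 5) (show 1 ≤ l by linarith only [hl])])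
    calc Real.exp ((1 - 4 * τ) * u) * x ^ 2 / q.totient
        = Real.exp ((1 - 4 * τ) * u) * (x ^ 2 / q.totient) := by rw [mul_div_assoc]
      _ ≤ Real.exp ((1 - 4 * τ) * u) * (x * ((u + 1) * Real.exp (-u))) := by
          gcongr; exact sq_div_totient_le hq hx0 hqx hω
      _ ≤ Real.exp ((1 - 4 * τ) * u) * (x * (Real.exp (4 * τ * u) * Real.exp (-u))) := by gcongr
      _ = x * Real.exp ((1 - 4 * τ) * u + (4 * τ * u + -u)) := by
          rw [Real.exp_add, Real.exp_add]; ring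
      _ = x := by
          rw [show (1 - 4 * τ) * u + (4 * τ * u + -u) = 0 by ring, Real.exp_zero, mul_one]
  have hgain := gain_exponent hτ hτ1 hl hu0 (show 1 ≤ Real.log l by linarith)
    (show 25 * l ^ 3 ≤ τ ^ 2 * u by
      linarith only [hpoly, hτ42, pow_pos hl0 5,
        pow_le_pow_right₀ (show 1 ≤ l by linarith) (show 3 ≤ 5 by norm_num)])
    hD0 hD hV1
  set G := Real.sqrt (u * (Real.log l / l)) with hG
  have hG0 : 0 ≤ G := Real.sqrt_nonneg _
  have hs1 : 1 ≤ Real.sqrt 2 := Real.one_le_sqrt.2 (by norm_num)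
  set E := 2 * ((Real.sqrt 2 - 51 * τ) * G) with hE
  have hE0 : 0 ≤ E := mul_nonneg (by norm_num) (mul_nonneg (by linarith) hG0)
  have hE1 : 1 ≤ Real.exp E := Real.one_le_exp hE0
  have h4 : x * (2 * Real.exp E) ≤ 1 / u ^ 3 * x / 2 * Real.exp ((1 - 2 * τ) * D) := by
    have e2 : (4 : ℝ) ≤ Real.exp 2 := by
      linarith only [Real.quadratic_le_exp_of_nonneg (show (0 : ℝ) ≤ 2 by norm_num)]
    have e3 : Real.exp (3 * l) = u ^ 3 := by rw [hudef, ← Real.exp_nat_mul]; norm_num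
    calc x * (2 * Real.exp E) = 1 / u ^ 3 * x / 2 * (Real.exp E * (u ^ 3 * 4)) := by
          field_simp; norm_num
      _ ≤ 1 / u ^ 3 * x / 2 * (Real.exp E * (Real.exp (3 * l) * Real.exp 2)) := by
          rw [e3]; gcongr
      _ = 1 / u ^ 3 * x / 2 * Real.exp (E + (3 * l + 2)) := by
          rw [Real.exp_add, Real.exp_add]
      _ ≤ _ := by gcongr
  have h5 : x * 1 ≤ x * Real.exp E := by gcongr
  linarith only [h4, h5, hres, hneg]

/-! ### The bound for large `q / x`, and uniformity -/

/-- The diagonal argument: a bound with every fixed loss `η` in an exponent gives a bound with a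
loss tending to `0`. -/
lemma exists_tendsto_zero_of_forall_eventually {Q : ℝ → ℕ → Prop}
    (h : ∀ η : ℝ, 0 < η → ∀ᶠ q in atTop, Q η q) :
    ∃ δ : ℕ → ℝ, Tendsto δ atTop (𝓝 0) ∧ ∀ᶠ q in atTop, Q (δ q) q := by
  classical
  have h' : ∀ n : ℕ, ∃ N : ℕ, ∀ q ≥ N, Q (1 / ((n : ℝ) + 1)) q := fun n =>
    eventually_atTop.1 (h _ (by positivity))
  choose N hN using h'
  -- `k q` is the largest `n ≤ q` for which all the thresholds up to `n` have been passed
  set S : ℕ → Finset ℕ := fun q => (Finset.range (q + 1)).filter fun n => N n ≤ q with hS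
  set k : ℕ → ℕ := fun q => (S q).sup id with hk
  have hk_tendsto : Tendsto k atTop atTop := by
    refine tendsto_atTop.2 fun n => ?_
    filter_upwards [eventually_ge_atTop n, eventually_ge_atTop (N n)] with q h1 h2
    exact Finset.le_sup (f := id) (Finset.mem_filter.2 ⟨Finset.mem_range.2 (by omega), h2⟩)
  refine ⟨fun q => 1 / ((k q : ℝ) + 1), ?_, ?_⟩
  · exact tendsto_one_div_add_atTop_nhds_zero_nat.comp hk_tendsto
  · filter_upwards [eventually_ge_atTop (N 0)] with q hq
    have hne : (S q).Nonempty := ⟨0, Finset.mem_filter.2 ⟨Finset.mem_range.2 (by omega), hq⟩⟩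
    obtain ⟨n, hn, hn'⟩ := Finset.exists_mem_eq_sup (S q) hne id
    have hkn : k q = n := hn'
    rw [hkn]
    exact hN n q (Finset.mem_filter.1 hn).2

/-- The bound when `q / x` is large, from the resonator. -/
theorem Delta_lower_bound_of_ge {ε η : ℝ} (hε : 0 < ε) (hη : 0 < η) (hη1 : η ≤ 1) :
    ∃ Y : ℝ, ∀ q : ℕ, q ≠ 0 → ∀ x : ℝ,
      Real.exp (Real.log q ^ (1 / 2 + ε)) ≤ x →
      x ≤ q / Real.exp ((1 + ε) * (q.primeFactors.card : ℝ)) →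
      16 < q / x → Y ≤ q / x →
      Real.sqrt x * scriptL (q / x) ^ (Real.sqrt 2 - η) ≤ Delta x q := by
  have hτ : 0 < η / 51 := by positivity
  have e1 := eventually_exists_window hτ (by linarith)
  have e2 : ∀ᶠ l : ℝ in atTop, 9 ≤ η / 51 * Real.log l :=
    (Real.tendsto_log_atTop.const_mul_atTop hτ).eventually_ge_atTop 9
  have e3 : ∀ᶠ l : ℝ in atTop, 2304 * l ^ 5 ≤ (η / 51) ^ 4 * Real.exp l := by
    have h := (Real.tendsto_exp_div_pow_atTop 5).eventually_ge_atTop (2304 / (η / 51) ^ 4)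
    filter_upwards [h, eventually_gt_atTop 0] with l h hl
    rw [div_le_div_iff₀ (by positivity) (by positivity)] at h
    linarith
  have e4 : ∀ᶠ l : ℝ in atTop, 50 * l ^ 2 ≤ Real.exp (ε * l) := by
    have h := ((Real.tendsto_exp_div_pow_atTop 2).comp
      (tendsto_id.const_mul_atTop hε)).eventually_ge_atTop (50 / ε ^ 2)
    filter_upwards [h, eventually_gt_atTop 0] with l h hl
    simp only [Function.comp, id] at h
    rw [div_le_div_iff₀ (by positivity) (by positivity), mul_pow] at h
    refine le_of_mul_le_mul_right ?_ (show 0 < ε ^ 2 by positivity)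
    linarith
  have e5 : ∀ᶠ l : ℝ in atTop, 200000 ≤ Real.exp l :=
    Real.tendsto_exp_atTop.eventually_ge_atTop _
  have hll : Tendsto (fun y : ℝ => Real.log (Real.log y)) atTop atTop :=
    Real.tendsto_log_atTop.comp Real.tendsto_log_atTop
  obtain ⟨Y, hY⟩ := eventually_atTop.1 (hll.eventually
    (e1.and (e2.and (e3.and (e4.and (e5.and (eventually_ge_atTop 2)))))))
  refine ⟨Y, fun q hq x hx hxq h16 hYq => ?_⟩
  obtain ⟨⟨a, b, ha, hab, hb, hba, hla, hla'⟩, h2, h3, h4, h5, h6⟩ := hY _ hYq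
  have hu : 0 < Real.log (q / x) := Real.log_pos (by linarith)
  have hx0 : 0 < x := (Real.exp_pos _).trans_le hx
  have key := mul_exp_le_Delta_sq hq hε hτ (by linarith) h6 ha hab hb hba hla hla' h2 h3 h4 h5 hx
    hxq (Real.exp_log hu).symm
  rw [show 51 * (η / 51) = η by ring, Real.exp_log hu, ← mul_div_assoc] at key
  refine le_of_sq_le_sq ?_ (Delta_nonneg x)
  refine le_trans (le_of_eq ?_) key
  rw [mul_pow, Real.sq_sqrt hx0.le, scriptL, ← Real.exp_mul, ← Real.exp_nat_mul]
  push_cast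
  ring_nf

end LargeCharSums

open LargeCharSums in
theorem mainTheorem7 (ε : ℝ) (hε : 0 < ε) :
    ∃ c : ℝ, 0 < c ∧ ∃ δ : ℕ → ℝ, Tendsto δ atTop (𝓝 0) ∧
      ∀ᶠ q : ℕ in atTop, ∀ x : ℝ,
        Real.exp (Real.log (q : ℝ) ^ (1 / 2 + ε)) ≤ x →
        x ≤ (q : ℝ) / Real.exp ((1 + ε) * (ArithmeticFunction.cardDistinctFactors q : ℝ)) →
        16 < (q : ℝ) / x →
        c * (Real.sqrt x * LargeCharSums.scriptL ((q : ℝ) / x) ^ (Real.sqrt 2 + δ q)) ≤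
          LargeCharSums.Delta x q := by
  obtain ⟨c, hc, hsmall⟩ := Delta_lower_bound_of_le hε
  have hL : ∀ y : ℝ, 1 ≤ scriptL y := fun y => Real.one_le_exp (Real.sqrt_nonneg _)
  have hcard : ∀ q : ℕ, (ArithmeticFunction.cardDistinctFactors q : ℝ) = q.primeFactors.card :=
    fun q => by rw [ArithmeticFunction.cardDistinctFactors_apply]; rfl
  obtain ⟨δ, hδ, h⟩ := exists_tendsto_zero_of_forall_eventually
    (Q := fun η q => ∀ x : ℝ, Real.exp (Real.log (q : ℝ) ^ (1 / 2 + ε)) ≤ x →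
        x ≤ (q : ℝ) / Real.exp ((1 + ε) * (q.primeFactors.card : ℝ)) →
        16 < (q : ℝ) / x →
        min c 1 * (Real.sqrt x * scriptL ((q : ℝ) / x) ^ (Real.sqrt 2 - η)) ≤ Delta x q) (by
      intro η hη
      obtain ⟨Y, hY⟩ := Delta_lower_bound_of_ge hε (lt_min hη one_pos) (min_le_right η 1)
      filter_upwards [hsmall Y, eventually_ne_atTop 0] with q hq hq0 x hx hxq h16
      rcases le_total ((q : ℝ) / x) Y with h | h
      · refine le_trans ?_ (hq x hxq h16 h)
        gcongr
        · have := zero_le_one.trans (hL ((q : ℝ) / x))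
          positivity
        · exact min_le_left _ _
        · exact hL _
        · linarith
      · refine le_trans ?_ (hY q hq0 x hx hxq h16 h)
        calc _ ≤ 1 * (Real.sqrt x * scriptL ((q : ℝ) / x) ^ (Real.sqrt 2 - min η 1)) := by
              gcongr
              · have := zero_le_one.trans (hL ((q : ℝ) / x))
                positivity
              · exact min_le_right _ _
              · exact hL _
              · exact min_le_left _ _
          _ = _ := one_mul _)
  refine ⟨min c 1, lt_min hc one_pos, fun q => -δ q, by simpa using hδ.neg, ?_⟩
  filter_upwards [h] with q hq x hx hxq h16
  rw [hcard] at hxq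
  simpa only [sub_eq_add_neg] using hq x hx hxq h16
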